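/- **Setting.** The Chimera graph $\mathcal C_{M,N,L}$ has vertex set $\{1,\dots,M\}\times\{1,\dots,N\}\times\{0,1\}\times\{1,\dots,L\}$ and edges $(x,y,0,k)\sim(x+1,y,0,k)$, $(x,y,1,k)\sim(x,y+1,1,k)$ and $(x,y,0,k_1)\sim(x,y,1,k_2)$. The unit cell $(x,y)$ consists of the vertices whose first two coordinates are $x,y$. A horizontal wire is a set $\{(x+i,y,0,k):0\le i<t\}$ and a vertical wire a set $\{(x,y+i,1,k):0\le i<t\}$, with $t\ge1$. An *ell* is the union of a horizontal and a vertical wire such that an end of the one is adjacent to an end of the other; the unit cell of these two ends is its *corner*. The *ell block* of an ell $\ell$ is the pair $(X,c)$ of the set $X$ of unit cells that meet $\ell$ and the corner $c$ of $\ell$. The horizontal (vertical) component of $(X,c)$ consists of the cells of $X$ other than $c$ in the same row (column) as $c$. The width and the height of the block are the lengths of the two wires of $\ell$. An *ell bundle* in an ell block is a possibly empty set of pairwise vertex-disjoint ells with that ell block. A *block clique embedding* is a set of $n$ ell blocks, with $n$ unit cells each, such that any two distinct blocks of the set share exactly one unit cell, and this cell is in the horizontal component of one of them and in the vertical component of the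 other. A *native clique embedding* (with chain length $n+1$) in an induced subgraph $G$ of $\mathcal C_{M,N,L}$ is a collection of $n$ ell bundles, one in each block of some block clique embedding, all of whose ells are contained in $G$. Its *size* is the total number of its ells. **Algorithm** $\mathrm{NativeCliqueEmbed}(G,n)$. For an ell block $(X,c)$ with $n$ cells, let $R_{\rm to}(X,c)$ and $R_{\rm from}(X,c)$ be the bounding rectangle of $X$ without the row of $c$ and without the column of $c$, respectively. First compute a maximum bundle of ells of $G$ in each ell block with $n$ cells, by listing the horizontal and the vertical wires in $G$ that span the block, and pairing them off; let $\|\mathcal X\|$ be the total size of these bundles over a set $\mathcal X$ of ell blocks. For $i=1,\dots,n-1$: set $P(R)\leftarrow\emptyset$ for each rectangle $R$ of height $i$ and width $n-i$; then for each ell block $(X,c)$ of height $i$ and width $n-i+1$, let $\mathcal B\leftarrow P(R_{\rm to}(X,c))\cup\{(X,c)\}$ (just $\{(X,c)\}$ if $i=1$), and if $\|P(R_{\rm from}(X,c))\|<\|\mathcal B\|$, set $P(R_{\rm from}(X,c))\leftarrow\mathcal B$. Finally set $\mathcal B_{\max}\leftarrow\emptyset$; for each ell block $(X,c)$ of height $n$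 and width $1$, let $\mathcal B\leftarrow P(R_{\rm to}(X,c))\cup\{(X,c)\}$ (just $\{(X,c)\}$ if $n=1$), and if $\|\mathcal B_{\max}\|<\|\mathcal B\|$, set $\mathcal B_{\max}\leftarrow\mathcal B$. Return the maximum bundles of the blocks in $\mathcal B_{\max}$. **Theorem.** Let $L\ge1$, let $1\le n\le\min\{M,N\}$, and let $G$ be an induced subgraph of $\mathcal C_{M,N,L}$. Then $\mathrm{NativeCliqueEmbed}(G,n)$ returns at most $n$ bundles, which, when completed by empty bundles to a collection of $n$ bundles, form a native clique embedding with chain length $n+1$ in $G$, and this embedding has the maximum size among all native clique embeddings with chain length $n+1$ in $G$. Implemented on a unit-cost random access machine, the algorithm (including the computation of the maximum bundles) takes $O(n^2MNL)$ steps, with an absolute implied constant. -/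

import Mathlib

namespace NativeClique

/-! ### The Chimera graph -/

/-- A vertex `(x, y, o, k)` of the Chimera graph, every coordinate numbered from `0`: it lies in
the unit cell `(x, y)`; it is horizontal if `o = 0` and vertical if `o = 1`. -/
abbrev Vertex (M N L : ℕ) := Fin M × Fin N × Fin 2 × Fin L

/-- A unit cell of the `M × N` grid. -/
abbrev Cell (M N : ℕ) := Fin M × Fin N

section Chimera

variable {M N L : ℕ}

/-- The unit cell of a vertex. -/
def Vertex.cell (v : Vertex M N L) : Cell M N := (v.1, v.2.1)

/-- Horizontal or vertical. -/
def Vertex.side (v : Vertex M N L) : Fin 2 := v.2.2.1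

/-- The index of a vertex within its side of its unit cell. -/
def Vertex.idx (v : Vertex M N L) : Fin L := v.2.2.2

/-- The Chimera graph: an `M × N` grid of complete bipartite graphs `K_{L,L}`. -/
def chimera (M N L : ℕ) : SimpleGraph (Vertex M N L) :=
  SimpleGraph.fromRel fun u v =>
    -- horizontal inter-cell couplings
    (u.side = 0 ∧ v.side = 0 ∧ u.idx = v.idx ∧
      u.cell.1.val + 1 = v.cell.1.val ∧ u.cell.2 = v.cell.2) ∨
    -- vertical inter-cell couplings
    (u.side = 1 ∧ v.side = 1 ∧ u.idx = v.idx ∧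
      u.cell.1 = v.cell.1 ∧ u.cell.2.val + 1 = v.cell.2.val) ∨
    -- intra-cell couplings
    (u.side = 0 ∧ v.side = 1 ∧ u.cell = v.cell)

/-! ### Wires, ells, ell blocks, ell bundles -/

/-- `S` is the horizontal wire whose ends are `a` (west) and `b` (east). -/
def IsHorizontalWire (S : Finset (Vertex M N L)) (a b : Vertex M N L) : Prop :=
  a.side = 0 ∧ b.side = 0 ∧ a.idx = b.idx ∧ a.cell.2 = b.cell.2 ∧ a.cell.1 ≤ b.cell.1 ∧
  ∀ v, v ∈ S ↔ v.side = 0 ∧ v.idx = a.idx ∧ v.cell.2 = a.cell.2 ∧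
    a.cell.1 ≤ v.cell.1 ∧ v.cell.1 ≤ b.cell.1

/-- `S` is the vertical wire whose ends are `a` (south) and `b` (north). -/
def IsVerticalWire (S : Finset (Vertex M N L)) (a b : Vertex M N L) : Prop :=
  a.side = 1 ∧ b.side = 1 ∧ a.idx = b.idx ∧ a.cell.1 = b.cell.1 ∧ a.cell.2 ≤ b.cell.2 ∧
  ∀ v, v ∈ S ↔ v.side = 1 ∧ v.idx = a.idx ∧ v.cell.1 = a.cell.1 ∧
    a.cell.2 ≤ v.cell.2 ∧ v.cell.2 ≤ b.cell.2

/-- `l` is an ell with corner `c`: the union of a horizontal and a vertical wire such that some end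
of the former is adjacent to some end of the latter, both of them lying in the unit cell `c`. -/
def IsEll (l : Finset (Vertex M N L)) (c : Cell M N) : Prop :=
  ∃ H V : Finset (Vertex M N L), ∃ a b a' b' : Vertex M N L,
    IsHorizontalWire H a b ∧ IsVerticalWire V a' b' ∧ l = H ∪ V ∧
    ∃ p q : Vertex M N L, (p = a ∨ p = b) ∧ (q = a' ∨ q = b') ∧
      (chimera M N L).Adj p q ∧ p.cell = c ∧ q.cell = c

/-- A pair `(X, c)` of a set of unit cells and a unit cell. -/
abbrev Block (M N : ℕ) := Finset (Cell M N) × Cell M N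

/-- `b = (X, c)` is the ell block of the ell `l`: `X` is the set of the unit cells that meet `l`,
and `c` is the corner of `l`. -/
def HasBlock (l : Finset (Vertex M N L)) (b : Block M N) : Prop :=
  IsEll l b.2 ∧ l.image Vertex.cell = b.1

/-- `b` is an ell block of the Chimera graph. -/
def IsEllBlock (L : ℕ) (b : Block M N) : Prop :=
  ∃ l : Finset (Vertex M N L), HasBlock l b

/-- The horizontal component of an ell block (without its corner). -/
def Block.horizontal (b : Block M N) : Finset (Cell M N) :=
  (b.1.filter fun z => z.2 = b.2.2).erase b.2

/-- The vertical component of an ell block (without its corner). -/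
def Block.vertical (b : Block M N) : Finset (Cell M N) :=
  (b.1.filter fun z => z.1 = b.2.1).erase b.2

/-- A block clique embedding: a set of `n` ell blocks with `n` unit cells each, any two of which
share exactly one unit cell, which is in the horizontal component of one of them and in the vertical
component of the other. -/
structure IsBlockCliqueEmbedding (L n : ℕ) (X : Finset (Block M N)) : Prop where
  isEllBlock : ∀ b ∈ X, IsEllBlock L b
  card_eq : X.card = n
  card_cells : ∀ b ∈ X, b.1.card = n
  inter : ∀ b ∈ X, ∀ b' ∈ X, b ≠ b' → ∃ z, b.1 ∩ b'.1 = {z} ∧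
    ((z ∈ b.horizontal ∧ z ∈ b'.vertical) ∨ (z ∈ b.vertical ∧ z ∈ b'.horizontal))

/-- `B` is a (possibly empty) ell bundle in the ell block `b`, all of whose ells lie in the
induced subgraph `G`. -/
structure IsBundleIn (G : (chimera M N L).Subgraph) (b : Block M N)
    (B : Finset (Finset (Vertex M N L))) : Prop where
  hasBlock : ∀ l ∈ B, HasBlock l b
  subset : ∀ l ∈ B, ∀ v ∈ l, v ∈ G.verts
  disjoint : ∀ l ∈ B, ∀ l' ∈ B, l ≠ l' → Disjoint l l'

/-- A native clique embedding in `G` (with chain length `n + 1`): the collection of the `n` bundles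
obtained by choosing a bundle in every ell block of some block clique embedding. -/
def IsNativeCliqueEmbedding (G : (chimera M N L).Subgraph) (n : ℕ)
    (𝓑 : Multiset (Finset (Finset (Vertex M N L)))) : Prop :=
  ∃ X : Finset (Block M N), IsBlockCliqueEmbedding L n X ∧
    ∃ B : Block M N → Finset (Finset (Vertex M N L)),
      (∀ b ∈ X, IsBundleIn G b (B b)) ∧ 𝓑 = X.val.map B

/-- The size of a collection of bundles: the number of ells (chains) in their union. -/
def size (𝓑 : Multiset (Finset (Finset (Vertex M N L)))) : ℕ :=
  (𝓑.toFinset.biUnion id).card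

end Chimera

/-! ### A random access machine with a step count

Programs act on finitely many integer registers and finitely many arrays of integers, which are
addressed by short tuples. -/

/-- The registers of the machine. -/
inductive Var
  | M | N | L | n
  | i | w | x | y | sx | sy | numSx | numSy | xl | yl | xe | ye | fits | tmp
  | toH | toX | toY | frX | frY
  | k | t | f | g | ok | col | cntH | cntV
  | curLen | bestLen | total | totalCur | totalOther
  | bht | bcx | bcy | bsx | bsy | p | q | sz | kH | kV | pos
  deriving DecidableEq

/-- The arrays of the machine. -/
inductive Arr
  | inG
  | bundleSize | bundleH | bundleV
  | mpeLen | mpe | cur | best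
  | outSize | out
  deriving DecidableEq

/-- A memory configuration. -/
structure State where
  var : Var → ℕ
  arr : Arr → List ℕ → ℕ

def State.set (s : State) (v : Var) (a : ℕ) : State :=
  { s with var := fun v' => if v' = v then a else s.var v' }

def State.put (s : State) (A : Arr) (j : List ℕ) (a : ℕ) : State :=
  { s with arr := fun A' j' => if A' = A ∧ j' = j then a else s.arr A' j' }

/-- Operands of instructions: registers and numerals. -/
inductive Opd
  | var (v : Var)
  | num (a : ℕ)

instance : Coe Var Opd := ⟨Opd.var⟩
instance (a : ℕ) : OfNat Opd a := ⟨Opd.num a⟩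

def Opd.eval (s : State) : Opd → ℕ
  | var v => s.var v
  | num a => a

/-- Right-hand sides of assignments. -/
inductive Rhs
  | opd (a : Opd)
  | add (a b : Opd)
  /-- truncated subtraction -/
  | sub (a b : Opd)
  | read (A : Arr) (j : List Opd)

def Rhs.eval (s : State) : Rhs → ℕ
  | opd a => a.eval s
  | add a b => a.eval s + b.eval s
  | sub a b => a.eval s - b.eval s
  | read A j => s.arr A (j.map (Opd.eval s))

/-- Arithmetic takes one step; an array access takes one more step for every index. -/
def Rhs.time : Rhs → ℕ
  | read _ j => 1 + j.length
  | _ => 1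

/-- Tests. -/
inductive Test
  | isLt (a b : Opd)
  | isEq (a b : Opd)

def Test.eval (s : State) : Test → Bool
  | isLt a b => decide (a.eval s < b.eval s)
  | isEq a b => decide (a.eval s = b.eval s)

/-- Programs. -/
inductive Prog
  | skip
  | assign (v : Var) (e : Rhs)
  | store (A : Arr) (j : List Opd) (a : Opd)
  | seq (P Q : Prog)
  | ite (c : Test) (P Q : Prog)
  /-- `loop v a P` runs `P` for `v = 0, …, a - 1`, where `a` is evaluated once, on entry. -/
  | loop (v : Var) (a : Opd) (P : Prog)

/-- `iterate F m s` applies `F 0`, `F 1`, …, `F (m - 1)` in this order, starting from `s`. -/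
def iterate (F : ℕ → State → State) : ℕ → State → State
  | 0, s => s
  | m + 1, s => F m (iterate F m s)

/-- The memory after the execution of a program. -/
def Prog.exec : Prog → State → State
  | skip, s => s
  | assign v e, s => s.set v (e.eval s)
  | store A j a, s => s.put A (j.map (Opd.eval s)) (a.eval s)
  | seq P Q, s => Q.exec (P.exec s)
  | ite c P Q, s => if c.eval s then P.exec s else Q.exec s
  | loop v a P, s => iterate (fun m s' => P.exec (s'.set v m)) (a.eval s) s

/-- The number of steps that a program takes: one for every statement, test and loop iteration, in
addition to the steps for the evaluation of expressions and the access of arrays. -/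
def Prog.time : Prog → State → ℕ
  | skip, _ => 1
  | assign _ e, _ => 1 + e.time
  | store _ j _, _ => 1 + j.length
  | seq P Q, s => P.time s + Q.time (P.exec s)
  | ite c P Q, s => 1 + if c.eval s then P.time s else Q.time s
  | loop v a P, s => 1 + ∑ m ∈ Finset.range (a.eval s),
      (1 + P.time ((iterate (fun m s' => P.exec (s'.set v m)) m s).set v m))

/-- Sequential composition of a list of programs. -/
def Prog.block : List Prog → Prog
  | [] => Prog.skip
  | [P] => P
  | P :: Q :: l => Prog.seq P (Prog.block (Q :: l))

infix:60 " ≔ " => Prog.assign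

/-! ### The algorithm

An ell block with `n` cells is represented by its height `i`, its corner `(x, y)`, and two bits:
`sx = 0` / `1` if the horizontal wires extend to the east / west from the corner, and `sy = 0` / `1`
if the vertical wires extend to the north / south.  A bit is `0` if the corresponding wires have
length one, so that every ell block has just one representation.  A working rectangle of height `h`
and width `n - h` is represented by `h` and its south-western cell. -/

open Prog Rhs Var Arr Test

/-- Is the ell block of height `i` and width `w` with corner `(x, y)` and orientation `sx`, `sy`
contained in the grid?  If so, set `fits` to `1`, and `(xl, yl)` to the south-western cell of its
bounding box. -/
def geometry : Prog := block [
  fits ≔ opd 1,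
  ite (isEq sx 0)
    (xl ≔ opd x)
    (block [
      tmp ≔ add x 1,
      ite (isLt tmp w) (fits ≔ opd 0) skip,
      xl ≔ sub tmp w]),
  ite (isEq sy 0)
    (yl ≔ opd y)
    (block [
      tmp ≔ add y 1,
      ite (isLt tmp i) (fits ≔ opd 0) skip,
      yl ≔ sub tmp i]),
  xe ≔ add xl w,
  ite (isLt M xe) (fits ≔ opd 0) skip,
  ye ≔ add yl i,
  ite (isLt N ye) (fits ≔ opd 0) skip]

/-- The working rectangle `R_to` immediately before the placement of the current ell block: its
bounding box without the row of the corner. -/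
def rectTo : Prog := block [
  toH ≔ sub i 1,
  toX ≔ opd xl,
  ite (isEq sy 0) (toY ≔ add yl 1) (toY ≔ opd yl)]

/-- The working rectangle `R_from` immediately after the placement of the current ell block: its
bounding box without the column of the corner. -/
def rectFrom : Prog := block [
  ite (isEq sx 0) (frX ≔ add xl 1) (frX ≔ opd xl),
  frY ≔ opd yl]

/-- For each ell block of height `i` and width `w = n + 1 - i`, run `P`. -/
def forEachBlock (P : Prog) : Prog := block [
  w ≔ add n 1,
  w ≔ sub w i,
  ite (isEq w 1) (numSx ≔ opd 1) (numSx ≔ opd 2),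
  ite (isEq i 1) (numSy ≔ opd 1) (numSy ≔ opd 2),
  loop x M (loop y N (loop sx numSx (loop sy numSy (block [
    geometry,
    ite (isEq fits 1) P skip]))))]

/-- A maximum bundle of the current ell block: list the indices of the horizontal and of the
vertical wires that lie in `G` and span the block, and match the `j`-th horizontal wire with the
`j`-th vertical one. -/
def computeMaxBundle : Prog := block [
  cntH ≔ opd 0,
  loop k L (block [
    ok ≔ opd 1,
    loop t w (block [
      col ≔ add xl t,
      g ≔ read inG [col, y, 0, k],
      ite (isEq g 0) (ok ≔ opd 0) skip]),
    ite (isEq ok 1)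
      (block [store bundleH [i, x, y, sx, sy, cntH] k, cntH ≔ add cntH 1])
      skip]),
  cntV ≔ opd 0,
  loop k L (block [
    ok ≔ opd 1,
    loop t i (block [
      col ≔ add yl t,
      g ≔ read inG [x, col, 1, k],
      ite (isEq g 0) (ok ≔ opd 0) skip]),
    ite (isEq ok 1)
      (block [store bundleV [i, x, y, sx, sy, cntV] k, cntV ≔ add cntV 1])
      skip]),
  ite (isLt cntH cntV)
    (store bundleSize [i, x, y, sx, sy] cntH)
    (store bundleSize [i, x, y, sx, sy] cntV)]

/-- Copy the list of `m` ell blocks stored in the array `A` at `j` to the array `A'` at `j'`. -/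
def copyBlocks (m : Opd) (A : Arr) (j : List Opd) (A' : Arr) (j' : List Opd) : Prog :=
  loop t m (loop f 5 (block [
    tmp ≔ read A (j ++ [Opd.var t, Opd.var f]),
    store A' (j' ++ [Opd.var t, Opd.var f]) tmp]))

/-- Load the block number `t` of the list stored in the array `A` at `j`. -/
def loadBlock (A : Arr) (j : List Opd) : Prog := block [
  bht ≔ read A (j ++ [Opd.var t, Opd.num 0]),
  bcx ≔ read A (j ++ [Opd.var t, Opd.num 1]),
  bcy ≔ read A (j ++ [Opd.var t, Opd.num 2]),
  bsx ≔ read A (j ++ [Opd.var t, Opd.num 3]),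
  bsy ≔ read A (j ++ [Opd.var t, Opd.num 4])]

/-- Compute the total size of the maximum bundles of the `m` ell blocks stored in the array
`A` at `j`. -/
def totalSize (m : Opd) (A : Arr) (j : List Opd) : Prog := block [
  total ≔ opd 0,
  loop t m (block [
    loadBlock A j,
    sz ≔ read bundleSize [bht, bcx, bcy, bsx, bsy],
    total ≔ add total sz])]

/-- `cur ← maxPartialEmbedding(R_to(X, c)) ∪ {(X, c)}` for the current ell block `(X, c)`, or
`cur ← {(X, c)}` if the block has height `1`. -/
def extend : Prog := block [
  rectTo,
  ite (isEq i 1)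
    (curLen ≔ opd 0)
    (block [
      curLen ≔ read mpeLen [toH, toX, toY],
      copyBlocks curLen mpe [toH, toX, toY] cur []]),
  store cur [curLen, 0] i,
  store cur [curLen, 1] x,
  store cur [curLen, 2] y,
  store cur [curLen, 3] sx,
  store cur [curLen, 4] sy,
  curLen ≔ add curLen 1]

/-- Preprocessing: a maximum bundle for each ell block. -/
def preprocess : Prog :=
  loop p n (block [
    i ≔ add p 1,
    forEachBlock computeMaxBundle])

/-- For each rectangle of height `i` and width `n - i`, set `maxPartialEmbedding(R) ← ∅`. -/
def clearRectangles : Prog := block [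
  w ≔ sub n i,
  xe ≔ sub M w,
  xe ≔ add xe 1,
  ye ≔ sub N i,
  ye ≔ add ye 1,
  loop x xe (loop y ye (store mpeLen [i, x, y] 0))]

/-- One pass of the main loop for the current ell block. -/
def relax : Prog := block [
  extend,
  rectFrom,
  totalSize curLen cur [],
  totalCur ≔ opd total,
  tmp ≔ read mpeLen [i, frX, frY],
  totalSize tmp mpe [i, frX, frY],
  totalOther ≔ opd total,
  ite (isLt totalOther totalCur)
    (block [
      store mpeLen [i, frX, frY] curLen,
      copyBlocks curLen cur [] mpe [i, frX, frY]])
    skip]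

/-- One pass of the final loop for the current ell block. -/
def relaxFinal : Prog := block [
  extend,
  totalSize curLen cur [],
  totalCur ≔ opd total,
  totalSize bestLen best [],
  totalOther ≔ opd total,
  ite (isLt totalOther totalCur)
    (block [
      bestLen ≔ opd curLen,
      copyBlocks curLen cur [] best []])
    skip]

/-- Write out the maximum bundle of each ell block in `best`, vertex by vertex: `out[t, p, q, ·]`
holds the four coordinates of vertex `q` of ell `p` of bundle `t`, and bundle `t` has
`outSize[t]` ells. -/
def writeOutput : Prog :=
  loop t bestLen (block [
    loadBlock best [],
    i ≔ opd bht,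
    x ≔ opd bcx,
    y ≔ opd bcy,
    sx ≔ opd bsx,
    sy ≔ opd bsy,
    w ≔ add n 1,
    w ≔ sub w i,
    geometry,
    sz ≔ read bundleSize [i, x, y, sx, sy],
    store outSize [t] sz,
    loop p sz (block [
      kH ≔ read bundleH [i, x, y, sx, sy, p],
      kV ≔ read bundleV [i, x, y, sx, sy, p],
      loop q w (block [
        col ≔ add xl q,
        store out [t, p, q, 0] col,
        store out [t, p, q, 1] y,
        store out [t, p, q, 2] 0,
        store out [t, p, q, 3] kH]),
      loop q i (block [
        col ≔ add yl q,
        pos ≔ add w q,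
        store out [t, p, pos, 0] x,
        store out [t, p, pos, 1] col,
        store out [t, p, pos, 2] 1,
        store out [t, p, pos, 3] kV])])])

/-- The algorithm NativeCliqueEmbed, including the preprocessing. -/
def nativeCliqueEmbed : Prog := block [
  preprocess,
  tmp ≔ sub n 1,
  loop p tmp (block [
    i ≔ add p 1,
    clearRectangles,
    forEachBlock relax]),
  bestLen ≔ opd 0,
  i ≔ opd n,
  forEachBlock relaxFinal,
  writeOutput]

/-! ### Input and output -/

section InputOutput

variable {M N L : ℕ}

/-- The coordinates of a vertex, as natural numbers. -/
def Vertex.coords (v : Vertex M N L) : List ℕ :=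
  [v.cell.1.val, v.cell.2.val, v.side.val, v.idx.val]

open Classical in
/-- The input of the algorithm: the numbers `M`, `N`, `L`, `n`, and the characteristic function of
the vertex set of `G`.  All other cells of the memory are zero. -/
noncomputable def input (G : (chimera M N L).Subgraph) (n : ℕ) : State where
  var
    | Var.M => M
    | Var.N => N
    | Var.L => L
    | Var.n => n
    | _ => 0
  arr A j := if A = Arr.inG ∧ ∃ v ∈ G.verts, v.coords = j then 1 else 0

/-- The collection of sets of ells found in the output arrays; every ell is given by its `n + 1`
vertices, every vertex by its coordinates. -/
def output (n : ℕ) (s : State) : Multiset (Finset (Finset (List ℕ))) :=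
  (Multiset.range (s.var Var.bestLen)).map fun t =>
    (Finset.range (s.arr Arr.outSize [t])).image fun p =>
      (Finset.range (n + 1)).image fun q =>
        [s.arr Arr.out [t, p, q, 0], s.arr Arr.out [t, p, q, 1],
          s.arr Arr.out [t, p, q, 2], s.arr Arr.out [t, p, q, 3]]

/-- A collection of bundles with every vertex replaced by its coordinates. -/
def toCoords (𝓑 : Multiset (Finset (Finset (Vertex M N L)))) :
    Multiset (Finset (Finset (List ℕ))) :=
  𝓑.map fun B => B.image fun l => l.image Vertex.coords

end InputOutput

end NativeClique

namespace NativeClique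

/-! ### A program logic for memory contents and running time -/

/-! A block clique embedding is the same thing as a chain: a sequence of blocks of heights `1, …, n`
in which the rectangle `R_to` of every block is the rectangle `R_from` of its predecessor.
Maximising the total bundle size over all embeddings is therefore a heaviest-path problem on working
rectangles, which dynamic programming solves.

Chains from embeddings (`exists_chain_of_dominates`, `IsBlockCliqueEmbedding.exists_chain`). Let a
block dominate another if its horizontal component meets the vertical component of the other; this
is a tournament on the `n` blocks. The corners lie in pairwise distinct rows and columns, and a
block has only `n - 1` cells besides its corner in which to meet the `n - 1` other blocks. So each
of these cells is used exactly once, and the height of a block is one more than the number of blocks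
that dominate it. There is no cyclic triple: one of the three corner columns lies between the other
two, and the row of a block is an interval. Hence domination is the linear order by height, and the
heights are `1, …, n`. For consecutive blocks, one interval is contained in another of the same
length, both for the columns and for the rows, so the two working rectangles agree.

Embeddings from chains (`Chain.spec`, `Chain.isBlockCliqueEmbedding`). Every block placed so far
spans all columns of the current working rectangle, has its corner outside these columns, and has
its vertical wires within the rows. So the next block meets each earlier one in exactly one cell, of
the required kind.

Bundles (`Code.Valid.card_bundle`, `IsBundleIn.card_le`, `HasBlock.corner_unique`). Disjoint ells in
one block have distinct horizontal and distinct vertical indices, so a maximum bundle has as many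
ells as the scarcer kind of spanning wire. An ell determines its block, so bundles in distinct
blocks are disjoint and sizes add up.

The dynamic program (`relax_phase`, `relaxFinal_phase`). A stored list starts empty and is replaced
only by a strictly heavier one, so it may lack an initial part of a chain. The invariants are that
it is a final segment of some chain (`Partial`) and, once its height is done, at least as heavy as
every chain for its rectangle (`Optimal`). The former holds for the empty list because every
rectangle in the grid is left by some chain (`exists_chain`); this is where `n ≤ M` enters. The
missing blocks receive empty bundles.

Correctness and running time are proved together, through the judgement `Ends`. There are at most
four orientations for each of the `M * N` corners and `n` heights; a block costs `O(n * L)` steps in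
the preprocessing and `O(n)` steps in the main loops, where lists of at most `n` blocks are copied
and summed. -/

@[simp] theorem State.set_var (s : State) (v v' : Var) (a : ℕ) :
    (s.set v a).var v' = if v' = v then a else s.var v' := rfl

@[simp] theorem State.set_arr (s : State) (v : Var) (a : ℕ) : (s.set v a).arr = s.arr := rfl

@[simp] theorem State.put_var (s : State) (A : Arr) (j : List ℕ) (a : ℕ) :
    (s.put A j a).var = s.var := rfl

@[simp] theorem State.put_arr (s : State) (A A' : Arr) (j j' : List ℕ) (a : ℕ) :
    (s.put A j a).arr A' j' = if A' = A ∧ j' = j then a else s.arr A' j' := rfl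

theorem State.put_arr_of_ne (s : State) {A A' : Arr} (h : A' ≠ A) (j : List ℕ) (a : ℕ) :
    (s.put A j a).arr A' = s.arr A' := by
  funext j'; simp [h]

/-- May the program assign to the register? -/
def Prog.writesVar : Prog → Var → Bool
  | skip, _ => false
  | assign v _, v' => decide (v' = v)
  | store _ _ _, _ => false
  | seq P Q, v' => P.writesVar v' || Q.writesVar v'
  | ite _ P Q, v' => P.writesVar v' || Q.writesVar v'
  | loop v _ P, v' => decide (v' = v) || P.writesVar v'

/-- May the program store to the array? -/
def Prog.writesArr : Prog → Arr → Bool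
  | skip, _ => false
  | assign _ _, _ => false
  | store A _ _, A' => decide (A' = A)
  | seq P Q, A' => P.writesArr A' || Q.writesArr A'
  | ite _ P Q, A' => P.writesArr A' || Q.writesArr A'
  | loop _ _ P, A' => P.writesArr A'

/-- The memory `s'` differs from `s` at most in what `P` may write. -/
structure Frame (P : Prog) (s s' : State) : Prop where
  var : ∀ v, P.writesVar v = false → s'.var v = s.var v
  arr : ∀ A, P.writesArr A = false → s'.arr A = s.arr A

theorem Frame.refl (P : Prog) (s : State) : Frame P s s := ⟨fun _ _ => rfl, fun _ _ => rfl⟩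

theorem Frame.trans {P : Prog} {s s' s'' : State} (h : Frame P s s') (h' : Frame P s' s'') :
    Frame P s s'' :=
  ⟨fun v hv => (h'.var v hv).trans (h.var v hv), fun A hA => (h'.arr A hA).trans (h.arr A hA)⟩

theorem iterate_frame (R : Prog) (F : ℕ → State → State)
    (h : ∀ m s, Frame R s (F m s)) (m : ℕ) (s : State) : Frame R s (iterate F m s) := by
  induction m with
  | zero => exact Frame.refl _ _
  | succ m ih => exact ih.trans (h m _)

theorem Prog.loop_body_frame {v : Var} {a : Opd} {P : Prog} (ih : ∀ s, Frame P s (P.exec s))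
    (m : ℕ) (s : State) : Frame (loop v a P) s (P.exec (s.set v m)) := by
  refine ⟨fun v' hv => ?_, fun A hA => ?_⟩
  · simp only [writesVar, Bool.or_eq_false_iff, decide_eq_false_iff_not] at hv
    rw [(ih _).var v' hv.2, State.set_var, if_neg hv.1]
  · simp only [writesArr] at hA
    rw [(ih _).arr A hA, State.set_arr]

theorem Prog.exec_frame (P : Prog) : ∀ s, Frame P s (P.exec s) := by
  induction P with
  | skip => exact fun s => Frame.refl _ _
  | assign v e =>
    refine fun s => ⟨fun v' hv => ?_, fun A _ => rfl⟩
    simp only [writesVar, decide_eq_false_iff_not] at hv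
    simp [exec, hv]
  | store A j a =>
    refine fun s => ⟨fun v' _ => rfl, fun A' hA => ?_⟩
    simp only [writesArr, decide_eq_false_iff_not] at hA
    exact State.put_arr_of_ne _ hA _ _
  | seq P Q hP hQ =>
    refine fun s => ⟨fun v hv => ?_, fun A hA => ?_⟩
    · simp only [writesVar, Bool.or_eq_false_iff] at hv
      exact ((hQ _).var v hv.2).trans ((hP _).var v hv.1)
    · simp only [writesArr, Bool.or_eq_false_iff] at hA
      exact ((hQ _).arr A hA.2).trans ((hP _).arr A hA.1)
  | ite c P Q hP hQ =>
    refine fun s => ⟨fun v hv => ?_, fun A hA => ?_⟩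
    · simp only [writesVar, Bool.or_eq_false_iff] at hv
      simp only [exec]
      split
      · exact (hP _).var v hv.1
      · exact (hQ _).var v hv.2
    · simp only [writesArr, Bool.or_eq_false_iff] at hA
      simp only [exec]
      split
      · exact (hP _).arr A hA.1
      · exact (hQ _).arr A hA.2
  | loop v a P ih =>
    exact fun s => iterate_frame _ _ (fun m s => loop_body_frame ih m s) _ _

/-! ### Rules for total correctness with a time bound -/

/-- Started in `s`, the program `P` takes at most `T` steps and ends in a memory satisfying `R`. -/
structure Ends (P : Prog) (s : State) (T : ℕ) (R : State → Prop) : Prop where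
  post : R (P.exec s)
  time : P.time s ≤ T

namespace Ends

variable {P Q : Prog} {s : State} {T T₁ T₂ : ℕ} {R R₁ : State → Prop}

/-- The frame comes for free from the syntax of `P`, so a postcondition needs to describe only what
the program changes. The rule `seq` offers it to its continuation in the same way. -/
theorem mono (h : Ends P s T₁ R₁) (hT : T₁ ≤ T)
    (hR : ∀ s', R₁ s' → Frame P s s' → R s') : Ends P s T R :=
  ⟨hR _ h.post (P.exec_frame s), h.time.trans hT⟩

theorem le (h : Ends P s T₁ R) (hT : T₁ ≤ T) : Ends P s T R := ⟨h.post, h.time.trans hT⟩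

theorem skip (h : R s) : Ends Prog.skip s 1 R := ⟨h, le_rfl⟩

theorem assign {v : Var} {e : Rhs} (h : R (s.set v (e.eval s))) :
    Ends (Prog.assign v e) s (1 + e.time) R := ⟨h, le_rfl⟩

theorem store {A : Arr} {j : List Opd} {a : Opd}
    (h : R (s.put A (j.map (Opd.eval s)) (a.eval s))) :
    Ends (Prog.store A j a) s (1 + j.length) R := ⟨h, le_rfl⟩

theorem seq (h : Ends P s T₁ R₁) (k : ∀ s', R₁ s' → Frame P s s' → Ends Q s' T₂ R) :
    Ends (Prog.seq P Q) s (T₁ + T₂) R :=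
  ⟨(k _ h.post (P.exec_frame s)).post, Nat.add_le_add h.time (k _ h.post (P.exec_frame s)).time⟩

theorem ite {c : Test} (h₁ : c.eval s = true → Ends P s T R)
    (h₂ : c.eval s = false → Ends Q s T R) : Ends (Prog.ite c P Q) s (1 + T) R := by
  cases h : c.eval s with
  | true => exact ⟨by simpa [Prog.exec, h] using (h₁ h).post,
      by simpa [Prog.time, h] using (h₁ h).time⟩
  | false => exact ⟨by simpa [Prog.exec, h] using (h₂ h).post,
      by simpa [Prog.time, h] using (h₂ h).time⟩

/-- `I m` describes the memory before pass `m`, when the loop register still has its old value. The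
frame given to the body is that of the whole loop since its entry, so facts from before the loop
carry over to every pass. -/
theorem loop {v : Var} {a : Opd} {b : ℕ} (I : ℕ → State → Prop) (hb : a.eval s = b) (h₀ : I 0 s)
    (h : ∀ m < b, ∀ s', Frame (Prog.loop v a P) s s' → I m s' →
      Ends P (s'.set v m) T (I (m + 1))) :
    Ends (Prog.loop v a P) s (1 + b * (1 + T)) (I b) := by
  subst hb
  have key : ∀ m ≤ a.eval s, I m (iterate (fun m s' => P.exec (s'.set v m)) m s) := by
    intro m hm
    induction m with
    | zero => exact h₀
    | succ m ih =>
      exact (h m hm _ (iterate_frame _ _ (fun m s => Prog.loop_body_frame P.exec_frame m s) _ _)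
        (ih (by omega))).post
  refine ⟨key _ le_rfl, ?_⟩
  simp only [Prog.time]
  refine Nat.add_le_add_left ?_ 1
  refine (Finset.sum_le_card_nsmul _ _ (1 + T) fun m hm => ?_).trans (by simp)
  rw [Finset.mem_range] at hm
  exact Nat.add_le_add_left (h m hm _
    (iterate_frame _ _ (fun m s => Prog.loop_body_frame P.exec_frame m s) _ _)
    (key m hm.le)).time 1

/-- A loop all of whose passes keep an invariant and the facts `Post c`, and of which pass `m`
establishes `Post c` for every `c` selected by `m`, establishes all of these facts. -/
theorem loop_forall {α : Type*} {v : Var} {a : Opd} {b : ℕ} (I : State → Prop)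
    (Post : α → State → Prop) (sel : ℕ → α → Prop) (hb : a.eval s = b) (h₀ : I s)
    (h : ∀ m < b, ∀ s', Frame (Prog.loop v a P) s s' → I s' →
      Ends P (s'.set v m) T fun s'' =>
        I s'' ∧ (∀ c, Post c s' → Post c s'') ∧ ∀ c, sel m c → Post c s'') :
    Ends (Prog.loop v a P) s (1 + b * (1 + T)) fun s' =>
      I s' ∧ (∀ c, Post c s → Post c s') ∧ ∀ m < b, ∀ c, sel m c → Post c s' := by
  refine loop (fun m s' => I s' ∧ (∀ c, Post c s → Post c s') ∧
    ∀ k < m, ∀ c, sel k c → Post c s') hb ⟨h₀, fun _ h => h, by simp⟩ ?_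
  rintro m hm s' hf ⟨h1, h2, h3⟩
  refine (h m hm s' hf h1).mono le_rfl ?_
  rintro s'' ⟨k1, k2, k3⟩ -
  refine ⟨k1, fun c hc => k2 c (h2 c hc), fun k hk c hc => ?_⟩
  rcases Nat.lt_succ_iff_lt_or_eq.1 hk with hk | rfl
  · exact k2 c (h3 k hk c hc)
  · exact k3 c hc

end Ends

/-- Programs without loops. -/
def Prog.loopFree : Prog → Bool
  | seq P Q => P.loopFree && Q.loopFree
  | ite _ P Q => P.loopFree && Q.loopFree
  | loop _ _ _ => false
  | _ => true

/-- A bound for the running time of a program without loops. -/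
def Prog.cost : Prog → ℕ
  | skip => 1
  | assign _ e => 1 + e.time
  | store _ j _ => 1 + j.length
  | seq P Q => P.cost + Q.cost
  | ite _ P Q => 1 + max P.cost Q.cost
  | loop _ _ _ => 0

theorem Prog.time_le_cost (P : Prog) : P.loopFree = true → ∀ s, P.time s ≤ P.cost := by
  induction P with
  | skip => exact fun _ _ => le_rfl
  | assign v e => exact fun _ _ => le_rfl
  | store A j a => exact fun _ _ => le_rfl
  | seq P Q hP hQ =>
    intro h s
    simp only [loopFree, Bool.and_eq_true] at h
    exact Nat.add_le_add (hP h.1 _) (hQ h.2 _)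
  | ite c P Q hP hQ =>
    intro h s
    simp only [loopFree, Bool.and_eq_true] at h
    simp only [time, cost]
    split
    · exact Nat.add_le_add_left ((hP h.1 _).trans (le_max_left _ _)) 1
    · exact Nat.add_le_add_left ((hQ h.2 _).trans (le_max_right _ _)) 1
  | loop v a P ih => intro h; simp [loopFree] at h

/-- For straight-line code, `simp` evaluates `exec` symbolically and `cost` is a numeral that
`decide` can compare. -/
theorem Ends.of_loopFree {P : Prog} {s : State} {R : State → Prop} (h : R (P.exec s))
    (hP : P.loopFree = true := by rfl) : Ends P s P.cost R :=
  ⟨h, P.time_le_cost hP s⟩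

end NativeClique

namespace NativeClique

/-! ### Codes of ell blocks -/

/-- The representation of an ell block in the memory: its height, its corner, its orientation. -/
@[ext] structure Code where
  h : ℕ
  x : ℕ
  y : ℕ
  sx : ℕ
  sy : ℕ
  deriving DecidableEq

namespace Code

/-- The index of a code in the arrays. -/
def key (c : Code) : List ℕ := [c.h, c.x, c.y, c.sx, c.sy]

/-- The width of a block with `n` cells. -/
def wd (n : ℕ) (c : Code) : ℕ := n + 1 - c.h

/-- The first column of the bounding box. -/
def left (n : ℕ) (c : Code) : ℕ := if c.sx = 0 then c.x else c.x + 1 - c.wd n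

/-- The first row of the bounding box. -/
def bot (c : Code) : ℕ := if c.sy = 0 then c.y else c.y + 1 - c.h

/-- The block is contained in the grid. -/
def Fits (M N n : ℕ) (c : Code) : Prop :=
  (c.sx ≠ 0 → c.wd n ≤ c.x + 1) ∧ (c.sy ≠ 0 → c.h ≤ c.y + 1) ∧
    c.left n + c.wd n ≤ M ∧ c.bot + c.h ≤ N

/-- The code represents an ell block with `n` cells. -/
structure Valid (M N n : ℕ) (c : Code) : Prop where
  one_le : 1 ≤ c.h
  le : c.h ≤ n
  x_lt : c.x < M
  y_lt : c.y < N
  sx_lt : c.sx < if c.wd n = 1 then 1 else 2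
  sy_lt : c.sy < if c.h = 1 then 1 else 2
  fits : c.Fits M N n

/-- The first row of the working rectangle before the placement of the block. -/
def toY (c : Code) : ℕ := if c.sy = 0 then c.bot + 1 else c.bot

/-- The first column of the working rectangle after the placement of the block. -/
def frX (n : ℕ) (c : Code) : ℕ := if c.sx = 0 then c.left n + 1 else c.left n

end Code

/-- The registers hold the data of the current block `c`. -/
structure Current (n : ℕ) (c : Code) (s : State) : Prop where
  i : s.var Var.i = c.h
  w : s.var Var.w = c.wd n
  x : s.var Var.x = c.x
  y : s.var Var.y = c.y
  sx : s.var Var.sx = c.sx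
  sy : s.var Var.sy = c.sy

/-- The registers hold the data of the current block `c` and the corner of its bounding box. -/
structure Placed (n : ℕ) (c : Code) (s : State) : Prop extends Current n c s where
  xl : s.var Var.xl = c.left n
  yl : s.var Var.yl = c.bot

/-- The parameters of the input are in their registers. -/
structure Params (M N L n : ℕ) (s : State) : Prop where
  rM : s.var Var.M = M
  rN : s.var Var.N = N
  rL : s.var Var.L = L
  rn : s.var Var.n = n

/-- For wires that extend to the west or the south, `left` and `bot` are truncated differences. The
first two clauses of `Fits` say that no truncation takes place; `fits` is cleared if one of them
fails, so the values are meaningful exactly when they are used. -/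
theorem geometry_spec {M N L n : ℕ} {c : Code} {s : State} (hp : Params M N L n s)
    (hc : Current n c s) : Ends geometry s 40 fun s' =>
      s'.var Var.xl = c.left n ∧ s'.var Var.yl = c.bot ∧
        (s'.var Var.fits = 1 ↔ c.Fits M N n) := by
  obtain ⟨hM, hN, -, -⟩ := hp
  obtain ⟨hi, hw, hx, hy, hsx, hsy⟩ := hc
  refine Ends.le (T₁ := 2 + (12 + (12 + _))) (Ends.seq
    (R₁ := fun s' => s'.var Var.fits = 1)
    (Ends.assign (by simp [Rhs.eval, Opd.eval])) fun s₁ f₁ g₁ => Ends.seq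
    (R₁ := fun s' => s'.var Var.xl = c.left n ∧
      (s'.var Var.fits = 1 ↔ (c.sx ≠ 0 → c.wd n ≤ c.x + 1)))
    (Ends.le (Ends.of_loopFree ?_) (by decide)) fun s₂ f₂ g₂ => Ends.seq
    (R₁ := fun s' => s'.var Var.yl = c.bot ∧
      (s'.var Var.fits = 1 ↔ s₂.var Var.fits = 1 ∧ (c.sy ≠ 0 → c.h ≤ c.y + 1)))
    (Ends.le (Ends.of_loopFree ?_) (by decide)) fun s₃ f₃ g₃ => Ends.of_loopFree ?_) (by decide)
  · rw [← g₁.var _ rfl] at hw hx hsx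
    by_cases h1 : c.sx = 0
    · simp [Prog.exec, Rhs.eval, Opd.eval, Test.eval, hsx, h1, hx, Code.left, f₁]
    · by_cases h2 : c.x + 1 < c.wd n
      · simp [Prog.exec, Prog.block, Rhs.eval, Opd.eval, Test.eval, hsx, h1, hx, hw, Code.left, h2]
      · simp [Prog.exec, Prog.block, Rhs.eval, Opd.eval, Test.eval, hsx, h1, hx, hw, Code.left, h2,
          f₁]
        omega
  · rw [← g₁.var _ rfl, ← g₂.var _ rfl] at hi hy hsy
    by_cases h1 : c.sy = 0
    · simp [Prog.exec, Rhs.eval, Opd.eval, Test.eval, hsy, h1, hy, Code.bot]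
    · by_cases h2 : c.y + 1 < c.h
      · simp [Prog.exec, Prog.block, Rhs.eval, Opd.eval, Test.eval, hsy, h1, hy, hi, Code.bot, h2]
      · simp [Prog.exec, Prog.block, Rhs.eval, Opd.eval, Test.eval, hsy, h1, hy, hi, Code.bot, h2]
        omega
  · rw [← g₁.var _ rfl, ← g₂.var _ rfl, ← g₃.var _ rfl] at hM hN hi hw
    have hxl : s₃.var Var.xl = c.left n := (g₃.var _ rfl).trans f₂.1
    have hfit := f₃.2.trans (and_congr_left' f₂.2)
    by_cases h1 : M < c.left n + c.wd n <;> by_cases h2 : N < c.bot + c.h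
    · simp [Prog.exec, Rhs.eval, Prog.block, Opd.eval, Test.eval, hM, hN, hi, hw, hxl, f₃.1,
        h1, h2, Code.Fits]
    · simp [Prog.exec, Rhs.eval, Prog.block, Opd.eval, Test.eval, hM, hN, hi, hw, hxl, f₃.1,
        h1, h2, Code.Fits]
    · simp [Prog.exec, Rhs.eval, Prog.block, Opd.eval, Test.eval, hM, hN, hi, hw, hxl, f₃.1,
        h1, h2, Code.Fits]
    · simp [Prog.exec, Rhs.eval, Prog.block, Opd.eval, Test.eval, hM, hN, hi, hw, hxl, f₃.1,
        h1, h2, Code.Fits, hfit]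
      omega

/-! ### The loop over all ell blocks of a given height -/

/-- Two memories with the same arrays and the same values of the registers that matter beyond the
processing of a single ell block. -/
structure SameData (s s' : State) : Prop where
  arr : s'.arr = s.arr
  M : s'.var Var.M = s.var Var.M
  N : s'.var Var.N = s.var Var.N
  L : s'.var Var.L = s.var Var.L
  n : s'.var Var.n = s.var Var.n
  i : s'.var Var.i = s.var Var.i
  bestLen : s'.var Var.bestLen = s.var Var.bestLen

theorem Params.of_frame {M N L n : ℕ} {s s' : State} {P : Prog} (h : Params M N L n s)
    (f : Frame P s s') (hM : P.writesVar Var.M = false := by rfl)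
    (hN : P.writesVar Var.N = false := by rfl) (hL : P.writesVar Var.L = false := by rfl)
    (hn : P.writesVar Var.n = false := by rfl) : Params M N L n s' :=
  ⟨(f.var _ hM).trans h.rM, (f.var _ hN).trans h.rN, (f.var _ hL).trans h.rL, (f.var _ hn).trans h.rn⟩

theorem Params.set {M N L n : ℕ} {s : State} (h : Params M N L n s) {v : Var} {a : ℕ}
    (hv : Var.M ≠ v ∧ Var.N ≠ v ∧ Var.L ≠ v ∧ Var.n ≠ v := by decide) :
    Params M N L n (s.set v a) :=
  ⟨by simp [hv, h.rM], by simp [hv, h.rN], by simp [hv, h.rL], by simp [hv, h.rn]⟩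

/-- The registers that are constant during `forEachBlock`. -/
structure Header (M N L n h : ℕ) (s : State) : Prop extends Params M N L n s where
  i : s.var Var.i = h
  w : s.var Var.w = n + 1 - h
  numSx : s.var Var.numSx = if n + 1 - h = 1 then 1 else 2
  numSy : s.var Var.numSy = if h = 1 then 1 else 2

theorem Header.of_eq {M N L n h : ℕ} {s s' : State} (H : Header M N L n h s)
    (e : ∀ v ∈ [Var.M, Var.N, Var.L, Var.n, Var.i, Var.w, Var.numSx, Var.numSy],
      s'.var v = s.var v) : Header M N L n h s' := by
  simp only [List.mem_cons, List.not_mem_nil, or_false, forall_eq_or_imp, forall_eq] at e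
  obtain ⟨h1, h2, h3, h4, h5, h6, h7, h8⟩ := e
  exact ⟨⟨h1.trans H.rM, h2.trans H.rN, h3.trans H.rL, h4.trans H.rn⟩, h5.trans H.i, h6.trans H.w,
    h7.trans H.numSx, h8.trans H.numSy⟩

/-- The registers that a program run by `forEachBlock` leaves alone. -/
def blockRegisters : List Var :=
  [Var.M, Var.N, Var.L, Var.n, Var.i, Var.w, Var.numSx, Var.numSy, Var.x, Var.y, Var.sx, Var.sy]

/-- Each pass establishes `Post c` for its own block and must preserve the facts established by
earlier passes. Between two passes the loop registers and the registers of `geometry` change, so `I`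
and `Post` may depend only on what `SameData` fixes. -/
theorem forEachBlock_loops {M N L n h T : ℕ} {P : Prog}
    (hP : ∀ v ∈ blockRegisters, P.writesVar v = false)
    (I : State → Prop) (Post : Code → State → Prop)
    (hI : ∀ s s', SameData s s' → I s → I s')
    (hPost : ∀ c s s', SameData s s' → Post c s → Post c s')
    {s : State} (H₀ : Header M N L n h s) (h₁ : 1 ≤ h) (hn : h ≤ n)
    (h₀ : I s)
    (hbody : ∀ c s, c.Valid M N n → c.h = h → Params M N L n s → Placed n c s → I s →
      Ends P s T fun s' => I s' ∧ (∀ c', Post c' s → Post c' s') ∧ Post c s') :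
    Ends (Prog.loop Var.x Var.M (Prog.loop Var.y Var.N (Prog.loop Var.sx Var.numSx
      (Prog.loop Var.sy Var.numSy (Prog.block
        [geometry, Prog.ite (Test.isEq Var.fits 1) P Prog.skip]))))) s
      (1 + M * (1 + (1 + N * (1 + (1 + 2 * (1 + (1 + 2 * (1 + (40 + (1 + (T + 1)))))))))))
      fun s' => I s' ∧ (∀ c, Post c s → Post c s') ∧
        ∀ c : Code, c.Valid M N n → c.h = h → Post c s' := by
  simp only [blockRegisters, List.mem_cons, List.not_mem_nil, or_false, forall_eq_or_imp,
    forall_eq] at hP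
  obtain ⟨pM, pN, pL, pn, pi, pw, pnx, pny, px, py, psx, psy⟩ := hP
  -- The innermost body. `Post c` is owed only for valid `c`, so a block that does not fit leaves
  -- nothing to prove.
  have core : ∀ (c : Code) (s : State), c.h = h → c.x < M → c.y < N →
      (c.sx < if n + 1 - h = 1 then 1 else 2) → (c.sy < if h = 1 then 1 else 2) →
      Header M N L n h s → Current n c s → I s →
      Ends (Prog.block [geometry, Prog.ite (Test.isEq Var.fits 1) P Prog.skip]) s
        (40 + (1 + (T + 1))) fun s' =>
        (I s' ∧ Header M N L n h s') ∧ (∀ c', Post c' s → Post c' s') ∧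
          (c.Valid M N n → Post c s') := by
    intro c s hc hx hy hsx hsy H hcur hIs
    refine Ends.seq (geometry_spec H.toParams hcur) ?_
    rintro s₁ ⟨e1, e2, e3⟩ f
    have hsd : SameData s s₁ := ⟨funext fun A => f.arr A (by cases A <;> rfl), f.var _ rfl,
      f.var _ rfl, f.var _ rfl, f.var _ rfl, f.var _ rfl, f.var _ rfl⟩
    have H₁ : Header M N L n h s₁ := H.of_eq (by
      simp only [List.mem_cons, List.not_mem_nil, or_false, forall_eq_or_imp, forall_eq]
      exact ⟨f.var _ rfl, f.var _ rfl, f.var _ rfl, f.var _ rfl, f.var _ rfl, f.var _ rfl,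
        f.var _ rfl, f.var _ rfl⟩)
    refine Ends.ite (fun ht => ?_) fun ht => ?_
    · have hfit := e3.1 (of_decide_eq_true ht)
      have hv : c.Valid M N n :=
        ⟨by omega, by omega, hx, hy, by simpa [Code.wd, hc] using hsx, by simpa [hc] using hsy, hfit⟩
      have hpl : Placed n c s₁ :=
        ⟨⟨(f.var _ rfl).trans hcur.i, (f.var _ rfl).trans hcur.w, (f.var _ rfl).trans hcur.x,
          (f.var _ rfl).trans hcur.y, (f.var _ rfl).trans hcur.sx, (f.var _ rfl).trans hcur.sy⟩,
          e1, e2⟩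
      refine (hbody c s₁ hv hc H₁.toParams hpl (hI _ _ hsd hIs)).mono (by omega) ?_
      rintro s₂ ⟨k1, k2, k3⟩ f₂
      refine ⟨⟨k1, H₁.of_eq ?_⟩, fun c' hc' => k2 c' (hPost _ _ _ hsd hc'), fun _ => k3⟩
      simp only [List.mem_cons, List.not_mem_nil, or_false, forall_eq_or_imp, forall_eq]
      exact ⟨f₂.var _ pM, f₂.var _ pN, f₂.var _ pL, f₂.var _ pn, f₂.var _ pi, f₂.var _ pw,
        f₂.var _ pnx, f₂.var _ pny⟩
    · refine (Ends.skip ?_).le (by omega)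
      refine ⟨⟨hI _ _ hsd hIs, H₁⟩, fun c' hc' => hPost _ _ _ hsd hc', fun hv => ?_⟩
      simp [Test.eval, Opd.eval, e3.2 hv.fits] at ht
  have sd : ∀ (s : State) (v : Var) (m : ℕ), v ∈ [Var.x, Var.y, Var.sx, Var.sy] →
      SameData s (s.set v m) := by
    intro s v m hv
    simp only [List.mem_cons, List.not_mem_nil, or_false] at hv
    rcases hv with rfl | rfl | rfl | rfl <;> exact ⟨rfl, rfl, rfl, rfl, rfl, rfl, rfl⟩
  have hd : ∀ (s : State) (v : Var) (m : ℕ), v ∈ [Var.x, Var.y, Var.sx, Var.sy] →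
      I s ∧ Header M N L n h s → I (s.set v m) ∧ Header M N L n h (s.set v m) := by
    rintro s v m hv ⟨h1, h2⟩
    refine ⟨hI _ _ (sd s v m hv) h1, h2.of_eq ?_⟩
    simp only [List.mem_cons, List.not_mem_nil, or_false] at hv
    simp only [List.mem_cons, List.not_mem_nil, or_false, forall_eq_or_imp, forall_eq]
    rcases hv with rfl | rfl | rfl | rfl <;>
      exact ⟨rfl, rfl, rfl, rfl, rfl, rfl, rfl, rfl⟩
  -- There are one or two values of each orientation bit; the time bound always allows two.
  have b2 : ∀ p : Prop, [Decidable p] → (if p then 1 else 2) ≤ 2 := by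
    intro p _; split <;> omega
  refine Ends.mono (R₁ := fun s' => (I s' ∧ Header M N L n h s') ∧ (∀ c, Post c s → Post c s') ∧
        ∀ m < M, ∀ c : Code, (c.Valid M N n ∧ c.h = h ∧ c.x = m) → Post c s')
      (Ends.loop_forall (b := M)
      (T := 1 + N * (1 + (1 + 2 * (1 + (1 + 2 * (1 + (40 + (1 + (T + 1)))))))))
      (fun s' => I s' ∧ Header M N L n h s') Post
      -- Each of the four nested loops fixes one more coordinate of the codes for which it is
      -- responsible.
      (fun m c => c.Valid M N n ∧ c.h = h ∧ c.x = m) H₀.rM ⟨h₀, H₀⟩ fun mx hmx sx hfx hIx => ?_)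
      le_rfl ?_
  · have hIx' := hd sx Var.x mx (by simp) hIx
    refine (Ends.loop_forall (b := N) (a := Opd.var Var.N) (s := sx.set Var.x mx)
      (T := 1 + 2 * (1 + (1 + 2 * (1 + (40 + (1 + (T + 1)))))))
      (fun s' => I s' ∧ Header M N L n h s') Post
      (fun m c => c.Valid M N n ∧ c.h = h ∧ c.x = mx ∧ c.y = m) hIx'.2.rN hIx'
      fun my hmy sy hfy hIy => ?_).mono le_rfl ?_
    · have hIy' := hd sy Var.y my (by simp) hIy
      refine (Ends.loop_forall (a := Opd.var Var.numSx) (s := sy.set Var.y my)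
        (T := 1 + 2 * (1 + (40 + (1 + (T + 1)))))
        (fun s' => I s' ∧ Header M N L n h s') Post
        (fun m c => c.Valid M N n ∧ c.h = h ∧ c.x = mx ∧ c.y = my ∧ c.sx = m) hIy'.2.numSx hIy'
        fun msx hmsx ssx hfsx hIsx => ?_).mono
        (Nat.add_le_add_left (Nat.mul_le_mul_right _ (b2 _)) 1) ?_
      · have hIsx' := hd ssx Var.sx msx (by simp) hIsx
        refine (Ends.loop_forall (a := Opd.var Var.numSy) (s := ssx.set Var.sx msx)
          (T := 40 + (1 + (T + 1)))
          (fun s' => I s' ∧ Header M N L n h s') Post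
          (fun m c => c.Valid M N n ∧ c.h = h ∧ c.x = mx ∧ c.y = my ∧ c.sx = msx ∧ c.sy = m)
          hIsx'.2.numSy hIsx' fun msy hmsy ssy hfsy hIsy => ?_).mono
          (Nat.add_le_add_left (Nat.mul_le_mul_right _ (b2 _)) 1) ?_
        · have hIsy' := hd ssy Var.sy msy (by simp) hIsy
          -- The registers of the outer loops survive the earlier passes of the inner ones, so the
          -- four loop registers together hold the code under consideration.
          have wx : ∀ v : Var, v = Var.x ∨ v = Var.y ∨ v = Var.sx → v ≠ Var.sy →
              ssy.var v = (ssx.set Var.sx msx).var v := by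
            rintro v (rfl | rfl | rfl) hv <;> apply hfsy.var <;>
              simp [Prog.writesVar, Prog.block, geometry, px, py, psx]
          have ex : ssy.var Var.x = mx := by
            rw [wx _ (by simp) (by simp)]
            simp only [State.set_var, reduceCtorEq, if_false]
            rw [hfsx.var _ (by simp [Prog.writesVar, Prog.block, geometry, px])]
            simp only [State.set_var, reduceCtorEq, if_false]
            rw [hfy.var _ (by simp [Prog.writesVar, Prog.block, geometry, px])]
            simp
          have ey : ssy.var Var.y = my := by
            rw [wx _ (by simp) (by simp)]
            simp only [State.set_var, reduceCtorEq, if_false]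
            rw [hfsx.var _ (by simp [Prog.writesVar, Prog.block, geometry, py])]
            simp
          have esx : ssy.var Var.sx = msx := by
            rw [wx _ (by simp) (by simp)]
            simp
          refine (core ⟨h, mx, my, msx, msy⟩ (ssy.set Var.sy msy) rfl hmx hmy hmsx hmsy hIsy'.2
            ⟨hIsy'.2.i, hIsy'.2.w, ?_, ?_, ?_, ?_⟩ hIsy'.1).mono le_rfl ?_
          · simpa using ex
          · simpa using ey
          · simpa using esx
          · simp
          · rintro s' ⟨k1, k2, k3⟩ -
            refine ⟨k1, fun c hc => k2 c (hPost _ _ _ (sd _ _ _ (by simp)) hc), ?_⟩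
            rintro ⟨ch, cx, cy, csx, csy⟩ ⟨hv, rfl, rfl, rfl, rfl, rfl⟩
            exact k3 hv
        · rintro s' ⟨k1, k2, k3⟩ -
          refine ⟨k1, fun c hc => k2 c (hPost _ _ _ (sd _ _ _ (by simp)) hc), ?_⟩
          rintro c ⟨hv, hc, h1, h2, h3⟩
          refine k3 c.sy ?_ c ⟨hv, hc, h1, h2, h3, rfl⟩
          simpa [hc] using hv.sy_lt
      · rintro s' ⟨k1, k2, k3⟩ -
        refine ⟨k1, fun c hc => k2 c (hPost _ _ _ (sd _ _ _ (by simp)) hc), ?_⟩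
        rintro c ⟨hv, hc, h1, h2⟩
        refine k3 c.sx ?_ c ⟨hv, hc, h1, h2, rfl⟩
        simpa [hc, Code.wd] using hv.sx_lt
    · rintro s' ⟨k1, k2, k3⟩ -
      refine ⟨k1, fun c hc => k2 c (hPost _ _ _ (sd _ _ _ (by simp)) hc), ?_⟩
      rintro c ⟨hv, hc, h1⟩
      exact k3 c.y hv.y_lt c ⟨hv, hc, h1, rfl⟩
  · rintro s' ⟨k1, k2, k3⟩ -
    exact ⟨k1.1, k2, fun c hv hc => k3 c.x hv.x_lt c ⟨hv, hc, rfl⟩⟩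

theorem forEachBlock_spec {M N L n h T : ℕ} {P : Prog}
    (hP : ∀ v ∈ blockRegisters, P.writesVar v = false)
    (I : State → Prop) (Post : Code → State → Prop)
    (hI : ∀ s s', SameData s s' → I s → I s')
    (hPost : ∀ c s s', SameData s s' → Post c s → Post c s')
    {s : State} (hp : Params M N L n s) (hi : s.var Var.i = h) (h₁ : 1 ≤ h) (hn : h ≤ n)
    (h₀ : I s)
    (hbody : ∀ c s, c.Valid M N n → c.h = h → Params M N L n s → Placed n c s → I s →
      Ends P s T fun s' => I s' ∧ (∀ c', Post c' s → Post c' s') ∧ Post c s') :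
    Ends (forEachBlock P) s
      (12 + (1 + M * (1 + (1 + N * (1 + (1 + 2 * (1 + (1 + 2 * (1 + (40 + (1 + (T + 1))))))))))))
      fun s' => I s' ∧ (∀ c, Post c s → Post c s') ∧
        ∀ c : Code, c.Valid M N n → c.h = h → Post c s' := by
  obtain ⟨pM, pN, pL, pn, pi, -⟩ := by
    simpa only [blockRegisters, List.mem_cons, List.not_mem_nil, or_false, forall_eq_or_imp,
      forall_eq] using hP
  have hloop := fun s₄ H₀ h₀ => forEachBlock_loops hP I Post hI hPost (s := s₄) (M := M) (N := N)
    (L := L) (n := n) (h := h) H₀ h₁ hn h₀ hbody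
  generalize 1 + M * _ = T₀ at hloop ⊢
  refine Ends.le (T₁ := 2 + (2 + (3 + (3 + T₀))))
    (Ends.seq (R₁ := fun s' => s'.var Var.w = n + 1) ?_ fun s₁ e₁ f₁ =>
    Ends.seq (R₁ := fun s' => s'.var Var.w = n + 1 - h) ?_ fun s₂ e₂ f₂ =>
    Ends.seq (R₁ := fun s' => s'.var Var.numSx = if n + 1 - h = 1 then 1 else 2) ?_
      fun s₃ e₃ f₃ =>
    Ends.seq (R₁ := fun s' => s'.var Var.numSy = if h = 1 then 1 else 2) ?_ fun s₄ e₄ f₄ =>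
    (hloop s₄ ?_ ?_).mono le_rfl ?_) (by omega)
  · exact Ends.assign (by simp [Rhs.eval, Opd.eval, hp.rn])
  · exact Ends.assign (by simp [Rhs.eval, Opd.eval, e₁, f₁.var Var.i rfl, hi])
  · refine Ends.ite (T := 2) (fun ht => Ends.assign ?_) fun ht => Ends.assign ?_
    · have := of_decide_eq_true ht
      simp_all [Opd.eval, Rhs.eval]
    · have := of_decide_eq_false ht
      simp_all [Opd.eval, Rhs.eval]
  · have hi₃ : s₃.var Var.i = h := by rw [f₃.var _ rfl, f₂.var _ rfl, f₁.var _ rfl, hi]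
    refine Ends.ite (T := 2) (fun ht => Ends.assign ?_) fun ht => Ends.assign ?_
    · have := of_decide_eq_true ht
      simp_all [Opd.eval, Rhs.eval]
    · have := of_decide_eq_false ht
      simp_all [Opd.eval, Rhs.eval]
  all_goals
    have hsd : SameData s s₄ := ⟨by
      funext A
      rw [f₄.arr A rfl, f₃.arr A rfl, f₂.arr A rfl, f₁.arr A rfl],
      by rw [f₄.var _ rfl, f₃.var _ rfl, f₂.var _ rfl, f₁.var _ rfl],
      by rw [f₄.var _ rfl, f₃.var _ rfl, f₂.var _ rfl, f₁.var _ rfl],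
      by rw [f₄.var _ rfl, f₃.var _ rfl, f₂.var _ rfl, f₁.var _ rfl],
      by rw [f₄.var _ rfl, f₃.var _ rfl, f₂.var _ rfl, f₁.var _ rfl],
      by rw [f₄.var _ rfl, f₃.var _ rfl, f₂.var _ rfl, f₁.var _ rfl],
      by rw [f₄.var _ rfl, f₃.var _ rfl, f₂.var _ rfl, f₁.var _ rfl]⟩
  · exact ⟨⟨hsd.M.trans hp.rM, hsd.N.trans hp.rN, hsd.L.trans hp.rL,
      hsd.n.trans hp.rn⟩, hsd.i.trans hi, by rw [f₄.var _ rfl, f₃.var _ rfl, e₂],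
      by rw [f₄.var _ rfl, e₃], e₄⟩
  · exact hI _ _ hsd h₀
  · rintro s' ⟨k1, k2, k3⟩ -
    exact ⟨k1, fun c hc => k2 c (hPost _ _ _ hsd hc), k3⟩

end NativeClique

namespace NativeClique

/-! ### Lists of codes in the memory -/

/-- The code number `t` of the list stored in the array `A` at `j`. -/
def readBlock (s : State) (A : Arr) (j : List ℕ) (t : ℕ) : Code :=
  ⟨s.arr A (j ++ [t, 0]), s.arr A (j ++ [t, 1]), s.arr A (j ++ [t, 2]), s.arr A (j ++ [t, 3]),
    s.arr A (j ++ [t, 4])⟩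

/-- The list of `m` codes stored in the array `A` at `j`. -/
def readBlocks (s : State) (A : Arr) (j : List ℕ) (m : ℕ) : List Code :=
  (List.range m).map (readBlock s A j)

@[simp] theorem length_readBlocks (s : State) (A : Arr) (j : List ℕ) (m : ℕ) :
    (readBlocks s A j m).length = m := by simp [readBlocks]

theorem readBlocks_succ (s : State) (A : Arr) (j : List ℕ) (m : ℕ) :
    readBlocks s A j (m + 1) = readBlocks s A j m ++ [readBlock s A j m] := by
  simp [readBlocks, List.range_succ]

theorem readBlocks_congr {s s' : State} {A A' : Arr} {j j' : List ℕ} {m : ℕ}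
    (h : ∀ t < m, ∀ f < 5, s'.arr A' (j' ++ [t, f]) = s.arr A (j ++ [t, f])) :
    readBlocks s' A' j' m = readBlocks s A j m := by
  refine List.map_congr_left fun t ht => ?_
  have := h t (List.mem_range.1 ht)
  simp [readBlock, this]

/-- The total of the stored bundle sizes of a list of codes. -/
def total (s : State) (l : List Code) : ℕ := (l.map fun c => s.arr Arr.bundleSize c.key).sum

theorem total_congr {s s' : State} (h : s'.arr Arr.bundleSize = s.arr Arr.bundleSize)
    (l : List Code) : total s' l = total s l := by simp [total, h]

@[simp] theorem total_nil (s : State) : total s [] = 0 := rfl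

theorem total_append (s : State) (l l' : List Code) :
    total s (l ++ l') = total s l + total s l' := by simp [total]

theorem total_singleton (s : State) (c : Code) :
    total s [c] = s.arr Arr.bundleSize c.key := by simp [total]

/-- The operands `j` have the values `J` in `s`, independently of the registers in `vs`. -/
def Index (vs : List Var) (s : State) (j : List Opd) (J : List ℕ) : Prop :=
  ∀ s' : State, (∀ v ∉ vs, s'.var v = s.var v) → j.map (Opd.eval s') = J

theorem index_nil (vs : List Var) (s : State) : Index vs s [] [] := fun _ _ => rfl

theorem index_triple {vs : List Var} {s : State} {u₁ u₂ u₃ : Var} (h₁ : u₁ ∉ vs) (h₂ : u₂ ∉ vs)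
    (h₃ : u₃ ∉ vs) :
    Index vs s [Opd.var u₁, Opd.var u₂, Opd.var u₃] [s.var u₁, s.var u₂, s.var u₃] := by
  intro s' h
  simp [Opd.eval, h _ h₁, h _ h₂, h _ h₃]

theorem copyBlocks_spec {m : Opd} {A A' : Arr} {j j' : List Opd} {s : State} {k : ℕ}
    {J J' : List ℕ} (hm : m.eval s = k) (hA : A ≠ A')
    (hj : Index [Var.t, Var.f, Var.tmp] s j J) (hj' : Index [Var.t, Var.f, Var.tmp] s j' J') :
    Ends (copyBlocks m A j A' j') s
      (1 + k * (1 + (1 + 5 * (1 + (j.length + j'.length + 7))))) fun s' =>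
      readBlocks s' A' J' k = readBlocks s A J k ∧
        ∀ idx, (∀ t f, idx ≠ J' ++ [t, f]) → s'.arr A' idx = s.arr A' idx := by
  -- The entries that precede `(t, f)` in the lexicographic order have been copied, and nothing
  -- outside the target list has changed. A finished inner loop turns `K t 5` into `K (t + 1) 0`.
  let K : ℕ → ℕ → State → Prop := fun t f s' =>
    (∀ t' f', f' < 5 → (t' < t ∨ t' = t ∧ f' < f) →
      s'.arr A' (J' ++ [t', f']) = s.arr A (J ++ [t', f'])) ∧
    ∀ idx, (∀ t f, idx ≠ J' ++ [t, f]) → s'.arr A' idx = s.arr A' idx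
  refine Ends.mono (Ends.loop (fun t s' => K t 0 s') hm ⟨fun t' f' _ h => by omega,
    fun _ _ => rfl⟩ (T := 1 + 5 * (1 + (j.length + j'.length + 7)))
    fun t ht s₁ g₁ h₁ => ?_) le_rfl ?_
  · refine Ends.mono (Ends.loop (a := 5) (b := 5) (s := s₁.set Var.t t) (fun f s' => K t f s') rfl h₁
      (T := j.length + j'.length + 7) fun f hf s₂ g₂ h₂ => ?_) le_rfl ?_
    · have hv : ∀ v ∉ [Var.t, Var.f, Var.tmp], s₂.var v = s.var v := by
        intro v hv
        simp only [List.mem_cons, List.not_mem_nil, or_false, not_or] at hv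
        rw [g₂.var v (by simp [Prog.writesVar, Prog.block, hv]), State.set_var, if_neg hv.1,
          g₁.var v (by simp [Prog.writesVar, Prog.block, hv])]
      have hA₂ : s₂.arr A = s.arr A := by
        rw [g₂.arr A (by simp [Prog.writesArr, Prog.block, hA]), State.set_arr,
          g₁.arr A (by simp [Prog.writesArr, Prog.block, hA])]
      have ht₂ : s₂.var Var.t = t := by
        rw [g₂.var _ rfl]; simp
      refine ⟨?_, ?_⟩
      · have e1 : List.map (Opd.eval (s₂.set Var.f f)) j = J := hj _ (by
          intro v hv'
          simp only [List.mem_cons, List.not_mem_nil, or_false, not_or] at hv'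
          simp [hv', hv v (by simp [hv'])])
        have e2 : ∀ a, List.map (Opd.eval ((s₂.set Var.f f).set Var.tmp a)) j' = J' := fun a =>
          hj' _ (by
          intro v hv'
          simp only [List.mem_cons, List.not_mem_nil, or_false, not_or] at hv'
          simp [hv', hv v (by simp [hv'])])
        have e3 : ((Prog.block [Prog.assign Var.tmp (Rhs.read A (j ++ [Opd.var Var.t, Opd.var Var.f])),
            Prog.store A' (j' ++ [Opd.var Var.t, Opd.var Var.f]) Var.tmp]).exec
              (s₂.set Var.f f)).arr A' =
            fun idx => if idx = J' ++ [t, f] then s.arr A (J ++ [t, f]) else s₂.arr A' idx := by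
          funext idx
          simp [Prog.exec, Prog.block, Rhs.eval, Opd.eval, e1, e2, ht₂, hA₂]
        refine ⟨fun t' f' hf' h => ?_, fun idx hidx => ?_⟩
        · rw [e3]
          by_cases hc : t' = t ∧ f' = f
          · simp [hc]
          · simp only [List.append_cancel_left_eq, List.cons.injEq, and_true, hc, if_false]
            exact h₂.1 t' f' hf' (by omega)
        · rw [e3]
          simp only [hidx t f, if_false]
          exact h₂.2 idx hidx
      · simp only [Prog.time, Prog.block, Rhs.time, List.length_append, List.length_cons,
          List.length_nil]
        omega
    · rintro s' ⟨h, h'⟩ -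
      exact ⟨fun t' f' hf' ht' => h t' f' hf' (by omega), h'⟩
  · rintro s' ⟨h, h'⟩ -
    exact ⟨readBlocks_congr fun t ht f hf => h t f hf (Or.inl ht), h'⟩

/-- The registers used by `totalSize`. -/
def totalRegisters : List Var :=
  [Var.t, Var.total, Var.sz, Var.bht, Var.bcx, Var.bcy, Var.bsx, Var.bsy]

theorem totalSize_spec {m : Opd} {A : Arr} {j : List Opd} {s : State} {k : ℕ}
    {J : List ℕ} (hm : m.eval (s.set Var.total 0) = k) (hj : Index totalRegisters s j J) :
    Ends (totalSize m A j) s (2 + (1 + k * (1 + (5 * j.length + 29)))) fun s' =>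
      s'.var Var.total = total s (readBlocks s A J k) := by
  refine Ends.seq (R₁ := fun s' => s' = s.set Var.total 0) (Ends.assign rfl) ?_
  rintro s₀ rfl f₀
  refine Ends.loop (fun t s' => s'.var Var.total = total s (readBlocks s A J t)) hm rfl
    fun t ht s₁ f₁ h₁ => ⟨?_, ?_⟩
  · have hv : ∀ v ∉ totalRegisters, s₁.var v = s.var v := by
      intro v hv
      simp only [totalRegisters, List.mem_cons, List.not_mem_nil, or_false, not_or] at hv
      rw [f₁.var v (by simp [Prog.writesVar, Prog.block, loadBlock, hv]), State.set_var,
        if_neg hv.2.1]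
    have ha : s₁.arr = s.arr := funext fun A =>
      f₁.arr A (by simp [Prog.writesArr, Prog.block, loadBlock])
    -- The operands `j` are evaluated anew after each of the five loads, in a memory where one more
    -- register has been overwritten; `Index` guarantees that the address stays the same.
    have e : ∀ s' : State, (∀ v ∉ totalRegisters, s'.var v = s₁.var v) →
        List.map (Opd.eval s') j = J := fun s' h => hj _ fun v hv' => (h v hv').trans (hv v hv')
    have e0 := e (s₁.set Var.t t) (by
      intro v hv
      simp only [totalRegisters, List.mem_cons, List.not_mem_nil, or_false, not_or] at hv
      simp [hv])
    have e1 := fun a => e ((s₁.set Var.t t).set Var.bht a) (by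
      intro v hv
      simp only [totalRegisters, List.mem_cons, List.not_mem_nil, or_false, not_or] at hv
      simp [hv])
    have e2 := fun a b => e (((s₁.set Var.t t).set Var.bht a).set Var.bcx b) (by
      intro v hv
      simp only [totalRegisters, List.mem_cons, List.not_mem_nil, or_false, not_or] at hv
      simp [hv])
    have e3 := fun a b c => e ((((s₁.set Var.t t).set Var.bht a).set Var.bcx b).set Var.bcy c) (by
      intro v hv
      simp only [totalRegisters, List.mem_cons, List.not_mem_nil, or_false, not_or] at hv
      simp [hv])
    have e4 := fun a b c d =>
      e (((((s₁.set Var.t t).set Var.bht a).set Var.bcx b).set Var.bcy c).set Var.bsx d) (by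
      intro v hv
      simp only [totalRegisters, List.mem_cons, List.not_mem_nil, or_false, not_or] at hv
      simp [hv])
    rw [readBlocks_succ, total_append, total_singleton, ← h₁]
    simp [Prog.exec, Prog.block, loadBlock, Rhs.eval, Opd.eval, e0, e1, e2, e3, e4, ha,
      readBlock, Code.key]
  · simp only [Prog.time, Prog.block, loadBlock, Rhs.time, List.length_append, List.length_cons,
      List.length_nil]
    omega

end NativeClique

namespace NativeClique

/-! ### The passes of the main loops -/

/-- The partial embedding stored for the working rectangle of height `h` with south-western cell
`(x, y)`. -/
def table (s : State) (h x y : ℕ) : List Code :=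
  readBlocks s Arr.mpe [h, x, y] (s.arr Arr.mpeLen [h, x, y])

/-- The partial embedding that the current block `c` is appended to. -/
def previous (n : ℕ) (s : State) (c : Code) : List Code :=
  if c.h = 1 then [] else table s (c.h - 1) (c.left n) c.toY

theorem rectTo_spec {n : ℕ} {c : Code} {s : State} (hc : Placed n c s) :
    Ends rectTo s 9 fun s' => s'.var Var.toH = c.h - 1 ∧ s'.var Var.toX = c.left n ∧
      s'.var Var.toY = c.toY := by
  refine (Ends.of_loopFree ?_).le (by decide)
  by_cases h : c.sy = 0 <;>
  simp [rectTo, Prog.block, Prog.exec, Rhs.eval, Opd.eval, Test.eval, hc.i, hc.xl, hc.yl, hc.sy,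
    Code.toY, h]

theorem rectFrom_spec {n : ℕ} {c : Code} {s : State} (hc : Placed n c s) :
    Ends rectFrom s 9 fun s' => s'.var Var.frX = c.frX n ∧ s'.var Var.frY = c.bot := by
  refine (Ends.of_loopFree ?_).le (by decide)
  by_cases h : c.sx = 0 <;>
  simp [rectFrom, Prog.block, Prog.exec, Rhs.eval, Opd.eval, Test.eval, hc.xl, hc.yl, hc.sx,
    Code.frX, h]

theorem Placed.of_frame {n : ℕ} {c : Code} {s s' : State} {P : Prog} (h : Placed n c s)
    (f : Frame P s s') (h₁ : P.writesVar Var.i = false := by rfl)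
    (h₂ : P.writesVar Var.w = false := by rfl) (h₃ : P.writesVar Var.x = false := by rfl)
    (h₄ : P.writesVar Var.y = false := by rfl) (h₅ : P.writesVar Var.sx = false := by rfl)
    (h₆ : P.writesVar Var.sy = false := by rfl) (h₇ : P.writesVar Var.xl = false := by rfl)
    (h₈ : P.writesVar Var.yl = false := by rfl) : Placed n c s' :=
  ⟨⟨(f.var _ h₁).trans h.i, (f.var _ h₂).trans h.w, (f.var _ h₃).trans h.x,
    (f.var _ h₄).trans h.y, (f.var _ h₅).trans h.sx, (f.var _ h₆).trans h.sy⟩,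
    (f.var _ h₇).trans h.xl, (f.var _ h₈).trans h.yl⟩

theorem extend_spec {n k : ℕ} {c : Code} {s : State} (hc : Placed n c s)
    (hk : (previous n s c).length ≤ k) :
    Ends extend s (40 + 57 * k) fun s' =>
      s'.var Var.curLen = (previous n s c).length + 1 ∧
        readBlocks s' Arr.cur [] ((previous n s c).length + 1) = previous n s c ++ [c] := by
  -- Copying one code takes `57 = 2 + 5 * 11` steps: five fields, read with three indices more than
  -- they are stored with.
  refine Ends.le (T₁ := 9 + ((7 + 57 * k) + 24)) (Ends.seq (rectTo_spec hc) ?_) (by omega)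
  rintro s₁ ⟨e1, e2, e3⟩ f₁
  have hc₁ : Placed n c s₁ := hc.of_frame f₁
  refine Ends.seq (R₁ := fun s' => s'.var Var.curLen = (previous n s c).length ∧
    readBlocks s' Arr.cur [] (previous n s c).length = previous n s c)
    (Ends.le (T₁ := 1 + (6 + 57 * k)) (Ends.ite (fun ht => ?_) fun ht => ?_) (by omega)) ?_
  · have : c.h = 1 := hc₁.i.symm.trans (of_decide_eq_true ht)
    refine Ends.le (Ends.assign ?_) (by simp only [Rhs.time]; omega)
    simp [previous, this, Rhs.eval, Opd.eval, readBlocks]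
  · have h1 : c.h ≠ 1 := fun h => of_decide_eq_false ht (hc₁.i.trans h)
    have hprev : previous n s c = table s (c.h - 1) (c.left n) c.toY := by simp [previous, h1]
    have hlen : (previous n s c).length = s.arr Arr.mpeLen [c.h - 1, c.left n, c.toY] := by
      rw [hprev, table, length_readBlocks]
    rw [hlen] at hk
    refine Ends.le (T₁ := 5 + (1 + s.arr Arr.mpeLen [c.h - 1, c.left n, c.toY] * 57)) (Ends.seq
      (R₁ := fun s' => s'.var Var.curLen = s.arr Arr.mpeLen [c.h - 1, c.left n, c.toY])
      (Ends.assign ?_) fun s₂ h₂ f₂ => ?_) (by omega)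
    · simp [Rhs.eval, Opd.eval, e1, e2, e3, f₁.arr Arr.mpeLen rfl]
    · refine (copyBlocks_spec (m := Opd.var Var.curLen) (s := s₂) (J := [s₂.var Var.toH, s₂.var Var.toX, s₂.var Var.toY]) (J' := [])
        h₂ (by decide) (index_triple (by decide) (by decide) (by decide))
        (index_nil _ _)).mono le_rfl ?_
      rintro s₃ ⟨h, -⟩ f₃
      refine ⟨by rw [f₃.var _ rfl, h₂, hlen], ?_⟩
      rw [hlen, h, hprev, table, f₂.var _ rfl, f₂.var _ rfl, f₂.var _ rfl, e1, e2, e3]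
      refine readBlocks_congr fun t _ f _ => ?_
      rw [f₂.arr _ rfl, f₁.arr _ rfl]
  · rintro s₂ ⟨h1, h2⟩ f₂
    have hc₂ : Placed n c s₂ := hc₁.of_frame f₂
    refine (Ends.of_loopFree ?_).le (by decide)
    refine ⟨by simp [Prog.block, Prog.exec, Rhs.eval, Opd.eval, h1], ?_⟩
    rw [readBlocks_succ]
    congr 1
    · conv_rhs => rw [← h2]
      refine readBlocks_congr fun t ht f hf => ?_
      have : t ≠ (previous n s c).length := ht.ne
      simp [Prog.block, Prog.exec, Rhs.eval, Opd.eval, h1, this]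
    · simp [Prog.block, Prog.exec, Rhs.eval, Opd.eval, h1, readBlock, hc₂.i, hc₂.x, hc₂.y, hc₂.sx,
        hc₂.sy]

/-- Seen from the table, a pass is one conditional update of the entry for `R_from`; in case of a
tie the old list stays. `k` bounds both list lengths and serves the running time only. -/
theorem relax_spec {n k : ℕ} {c : Code} {s : State} (hc : Placed n c s)
    (hk : (previous n s c).length ≤ k) (hk' : (table s c.h (c.frX n) c.bot).length ≤ k) :
    Ends relax s (300 + 200 * k) fun s' => ∀ h x y, table s' h x y =
      if (h = c.h ∧ x = c.frX n ∧ y = c.bot) ∧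
        total s (table s c.h (c.frX n) c.bot) < total s (previous n s c ++ [c])
      then previous n s c ++ [c] else table s h x y := by
  set p := previous n s c with hp
  set q := table s c.h (c.frX n) c.bot with hq
  have hql : q.length = s.arr Arr.mpeLen [c.h, c.frX n, c.bot] := by simp [hq, table]
  -- Per list entry, summation takes 30 steps for `cur`, and 45 for `mpe` because of its three
  -- further indices in each of five reads; copying takes 57.
  refine Ends.le (T₁ := (40 + 57 * k) + (9 + ((2 + (1 + (k + 1) * 30)) + (2 + (5 +
    ((2 + (1 + k * 45)) + (2 + (1 + (5 + (1 + (k + 1) * 57)))))))))) ?_ (by omega)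
  refine Ends.seq (extend_spec hc hk) ?_
  rintro s₁ ⟨h1, h1'⟩ f₁
  have hc₁ := hc.of_frame f₁
  refine Ends.seq (rectFrom_spec hc₁) ?_
  rintro s₂ ⟨h2, h2'⟩ f₂
  have hc₂ := hc₁.of_frame f₂
  have cur₂ : readBlocks s₂ Arr.cur [] (p.length + 1) = p ++ [c] := by
    rw [← h1']; exact readBlocks_congr fun _ _ _ _ => by rw [f₂.arr _ rfl]
  refine Ends.seq (Ends.le (totalSize_spec (J := []) (k := p.length + 1)
    (by simp [Opd.eval, f₂.var Var.curLen rfl, h1, hp]) (index_nil _ _))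
    (Nat.add_le_add_left (Nat.add_le_add_left (Nat.mul_le_mul_right 30 (by omega)) 1) 2)) ?_
  intro s₃ h3 f₃
  have hc₃ := hc₂.of_frame f₃
  rw [cur₂] at h3
  refine Ends.seq (Ends.assign (R := fun s' => s'.var Var.totalCur = total s (p ++ [c])) ?_) ?_
  · simp only [Rhs.eval, Opd.eval, State.set_var, if_true, h3]
    exact total_congr (by rw [f₂.arr _ rfl, f₁.arr _ rfl]) _
  intro s₄ h4 f₄
  have hc₄ := hc₃.of_frame f₄
  refine Ends.seq (Ends.assign (R := fun s' => s'.var Var.tmp = q.length) ?_) ?_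
  · simp only [Rhs.eval, Opd.eval, State.set_var, if_true, List.map_cons, List.map_nil, hc₄.i, hql]
    rw [f₄.var _ rfl, f₃.var _ rfl, h2, f₄.var _ rfl, f₃.var _ rfl, h2', f₄.arr _ rfl, f₃.arr _ rfl,
      f₂.arr _ rfl, f₁.arr _ rfl]
  intro s₅ h5 f₅
  have hc₅ := hc₄.of_frame f₅
  have hfx : s₅.var Var.frX = c.frX n := by
    rw [f₅.var _ rfl, f₄.var _ rfl, f₃.var _ rfl, h2]
  have hfy : s₅.var Var.frY = c.bot := by
    rw [f₅.var _ rfl, f₄.var _ rfl, f₃.var _ rfl, h2']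
  refine Ends.seq (Ends.le (totalSize_spec (J := [c.h, c.frX n, c.bot]) (k := q.length)
    (by simp [Opd.eval, h5]) (by
      have := index_triple (vs := totalRegisters) (s := s₅) (u₁ := Var.i) (u₂ := Var.frX)
        (u₃ := Var.frY) (by decide) (by decide) (by decide)
      rwa [hfx, hfy, hc₅.i] at this))
    (Nat.add_le_add_left (Nat.add_le_add_left (Nat.mul_le_mul_right 45 hk') 1) 2)) ?_
  intro s₆ h6 f₆
  have hc₆ := hc₅.of_frame f₆
  have hmpe : ∀ A ∈ [Arr.mpe, Arr.mpeLen, Arr.bundleSize], s₆.arr A = s.arr A := by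
    simp only [List.mem_cons, List.not_mem_nil, or_false, forall_eq_or_imp, forall_eq]
    refine ⟨?_, ?_, ?_⟩ <;>
    rw [f₆.arr _ rfl, f₅.arr _ rfl, f₄.arr _ rfl, f₃.arr _ rfl, f₂.arr _ rfl, f₁.arr _ rfl]
  have h6' : s₆.var Var.total = total s q := by
    rw [h6, total_congr (s := s)]
    · congr 1
      rw [hql, hq, table]
      refine readBlocks_congr fun t _ f _ => ?_
      rw [← f₆.arr Arr.mpe rfl, hmpe _ (by simp)]
    · rw [← f₆.arr Arr.bundleSize rfl, hmpe _ (by simp)]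
  refine Ends.seq (Ends.assign (R := fun s' => s'.var Var.totalOther = total s q) ?_) ?_
  · simp only [Rhs.eval, Opd.eval, State.set_var, if_true, h6']
  intro s₇ h7 f₇
  have hc₇ := hc₆.of_frame f₇
  have h7' : s₇.var Var.totalCur = total s (p ++ [c]) := by
    rw [f₇.var _ rfl, f₆.var _ rfl, f₅.var _ rfl, h4]
  have table₇ : ∀ h x y, table s₇ h x y = table s h x y := fun h x y => by
    rw [table, table, f₇.arr Arr.mpeLen rfl, hmpe _ (by simp)]
    refine readBlocks_congr fun t _ f _ => ?_
    rw [f₇.arr _ rfl, hmpe _ (by simp)]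
  refine Ends.ite (fun ht => ?_) fun ht => ?_
  · have hlt : total s q < total s (p ++ [c]) := by
      have := of_decide_eq_true ht
      simpa only [Opd.eval, h7, h7'] using this
    have hcl : s₇.var Var.curLen = p.length + 1 := by
      rw [f₇.var _ rfl, f₆.var _ rfl, f₅.var _ rfl, f₄.var _ rfl, f₃.var _ rfl, f₂.var _ rfl, h1]
    have hfx₇ : s₇.var Var.frX = c.frX n := by rw [f₇.var _ rfl, f₆.var _ rfl, hfx]
    have hfy₇ : s₇.var Var.frY = c.bot := by rw [f₇.var _ rfl, f₆.var _ rfl, hfy]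
    refine Ends.le (T₁ := 4 + (1 + (k + 1) * 57)) (Ends.seq (Ends.store (R := fun s' =>
      s' = s₇.put Arr.mpeLen [c.h, c.frX n, c.bot] (p.length + 1)) ?_) ?_) (by omega)
    · simp [Opd.eval, hc₇.i, hfx₇, hfy₇, hcl]
    intro s₈ h8 f₈
    have hc₈ := hc₇.of_frame f₈
    refine Ends.mono (T₁ := 1 + (p.length + 1) * 57) (copyBlocks_spec (J := [])
      (J' := [c.h, c.frX n, c.bot]) (k := p.length + 1) ?_
      (by decide) (index_nil _ _) ?_)
      (Nat.add_le_add_left (Nat.mul_le_mul_right 57 (by omega)) 1) ?_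
    · rw [← hcl, ← f₈.var _ rfl]; rfl
    · have := index_triple (vs := [Var.t, Var.f, Var.tmp]) (s := s₈) (u₁ := Var.i) (u₂ := Var.frX)
        (u₃ := Var.frY) (by decide) (by decide) (by decide)
      rwa [hc₈.i, f₈.var _ rfl, f₈.var _ rfl, hfx₇, hfy₇] at this
    rintro s₉ ⟨h9, h9'⟩ f₉
    have hlen : ∀ idx, s₉.arr Arr.mpeLen idx =
        if idx = [c.h, c.frX n, c.bot] then p.length + 1 else s₇.arr Arr.mpeLen idx := fun idx => by
      rw [f₉.arr _ rfl, h8]; simp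
    intro h x y
    by_cases hxy : h = c.h ∧ x = c.frX n ∧ y = c.bot
    · obtain ⟨rfl, rfl, rfl⟩ := hxy
      rw [if_pos ⟨⟨rfl, rfl, rfl⟩, hlt⟩, table, hlen, if_pos rfl, h9, ← cur₂]
      refine readBlocks_congr fun t _ f _ => ?_
      rw [f₈.arr _ rfl, f₇.arr _ rfl, f₆.arr _ rfl, f₅.arr _ rfl, f₄.arr _ rfl, f₃.arr _ rfl]
    -- The lists of different rectangles are stored under different prefixes `[h, x, y]`, so the
    -- copy does not touch this one.
    · rw [if_neg (fun hh => hxy hh.1), table, hlen, if_neg (by simpa using hxy), ← table₇, table]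
      refine readBlocks_congr fun t _ f _ => ?_
      rw [h9', f₈.arr _ rfl]
      intro t' f' he
      simp only [List.cons_append, List.nil_append, List.cons.injEq] at he
      exact hxy ⟨he.1, he.2.1, he.2.2.1⟩
  · refine (Ends.skip ?_).le (by omega)
    have hge : ¬ total s q < total s (p ++ [c]) := by
      have := of_decide_eq_false ht
      simpa only [Opd.eval, h7, h7'] using this
    intro h x y
    rw [if_neg (fun hh => hge hh.2), table₇]

/-- The list of blocks with the greatest total that has been found. -/
def bestList (s : State) : List Code := readBlocks s Arr.best [] (s.var Var.bestLen)

theorem relaxFinal_spec {n k : ℕ} {c : Code} {s : State} (hc : Placed n c s)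
    (hk : (previous n s c).length ≤ k) (hk' : (bestList s).length ≤ k) :
    Ends relaxFinal s (300 + 200 * k) fun s' => bestList s' =
      if total s (bestList s) < total s (previous n s c ++ [c])
      then previous n s c ++ [c] else bestList s := by
  set p := previous n s c with hp
  set q := bestList s with hq
  have hql : q.length = s.var Var.bestLen := by simp [hq, bestList]
  refine Ends.le (T₁ := (40 + 57 * k) + ((2 + (1 + (k + 1) * 30)) + (2 +
    ((2 + (1 + k * 30)) + (2 + (1 + (5 + (1 + (k + 1) * 57)))))))) ?_ (by omega)
  refine Ends.seq (extend_spec hc hk) ?_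
  rintro s₁ ⟨h1, h1'⟩ f₁
  refine Ends.seq (Ends.le (totalSize_spec (J := []) (k := p.length + 1)
    (by simp [Opd.eval, h1, hp]) (index_nil _ _))
    (Nat.add_le_add_left (Nat.add_le_add_left (Nat.mul_le_mul_right 30 (by omega)) 1) 2)) ?_
  intro s₃ h3 f₃
  rw [h1'] at h3
  refine Ends.seq (Ends.assign (R := fun s' => s'.var Var.totalCur = total s (p ++ [c])) ?_) ?_
  · simp only [Rhs.eval, Opd.eval, State.set_var, if_true, h3]
    exact total_congr (by rw [f₁.arr _ rfl]) _
  intro s₄ h4 f₄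
  have hb₄ : s₄.var Var.bestLen = q.length := by
    rw [f₄.var _ rfl, f₃.var _ rfl, f₁.var _ rfl, hql]
  refine Ends.seq (Ends.le (totalSize_spec (J := []) (k := q.length)
    (by simp [Opd.eval, hb₄]) (index_nil _ _))
    (Nat.add_le_add_left (Nat.add_le_add_left (Nat.mul_le_mul_right 30 hk') 1) 2)) ?_
  intro s₆ h6 f₆
  have hmpe : ∀ A ∈ [Arr.best, Arr.bundleSize], s₆.arr A = s.arr A := by
    simp only [List.mem_cons, List.not_mem_nil, or_false, forall_eq_or_imp, forall_eq]
    refine ⟨?_, ?_⟩ <;> rw [f₆.arr _ rfl, f₄.arr _ rfl, f₃.arr _ rfl, f₁.arr _ rfl]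
  have h6' : s₆.var Var.total = total s q := by
    rw [h6, total_congr (s := s)]
    · congr 1
      rw [hql, hq, bestList]
      refine readBlocks_congr fun t _ f _ => ?_
      rw [← f₆.arr Arr.best rfl, hmpe _ (by simp)]
    · rw [← f₆.arr Arr.bundleSize rfl, hmpe _ (by simp)]
  refine Ends.seq (Ends.assign (R := fun s' => s'.var Var.totalOther = total s q) ?_) ?_
  · simp only [Rhs.eval, Opd.eval, State.set_var, if_true, h6']
  intro s₇ h7 f₇
  have h7' : s₇.var Var.totalCur = total s (p ++ [c]) := by
    rw [f₇.var _ rfl, f₆.var _ rfl, h4]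
  refine Ends.ite (fun ht => ?_) fun ht => ?_
  · have hlt : total s q < total s (p ++ [c]) := by
      have := of_decide_eq_true ht
      simpa only [Opd.eval, h7, h7'] using this
    have hcl : s₇.var Var.curLen = p.length + 1 := by
      rw [f₇.var _ rfl, f₆.var _ rfl, f₄.var _ rfl, f₃.var _ rfl, h1]
    refine Ends.le (T₁ := 2 + (1 + (k + 1) * 57)) (Ends.seq (Ends.assign (R := fun s' =>
      s'.var Var.bestLen = p.length + 1) ?_) ?_) (by omega)
    · simp [Rhs.eval, Opd.eval, hcl]
    intro s₈ h8 f₈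
    refine Ends.mono (T₁ := 1 + (p.length + 1) * 42) (copyBlocks_spec (J := [])
      (J' := []) (k := p.length + 1) ?_ (by decide) (index_nil _ _) (index_nil _ _))
      (Nat.add_le_add_left (Nat.mul_le_mul (by omega) (by omega)) 1) ?_
    · rw [← hcl, ← f₈.var _ rfl]; rfl
    rintro s₉ ⟨h9, -⟩ f₉
    rw [if_pos hlt, bestList, f₉.var _ rfl, h8, h9, ← h1']
    refine readBlocks_congr fun t _ f _ => ?_
    rw [f₈.arr _ rfl, f₇.arr _ rfl, f₆.arr _ rfl, f₄.arr _ rfl, f₃.arr _ rfl]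
  · refine (Ends.skip ?_).le (by omega)
    have hge : ¬ total s q < total s (p ++ [c]) := by
      have := of_decide_eq_false ht
      simpa only [Opd.eval, h7, h7'] using this
    rw [if_neg hge, hq, bestList, bestList, f₇.var _ rfl, f₆.var _ rfl, hb₄, hql]
    refine readBlocks_congr fun t _ f _ => ?_
    rw [f₇.arr _ rfl, hmpe _ (by simp)]

end NativeClique

namespace NativeClique

/-! ### The computation of the maximum bundles -/

theorem Code.key_injective : Function.Injective Code.key := by
  rintro ⟨⟩ ⟨⟩ h
  simpa [Code.key] using h

/-- The indices of the horizontal wires that span the block `c`, where `g` is the characteristic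
function of the vertex set. -/
def hIndices (g : List ℕ → ℕ) (L n : ℕ) (c : Code) : List ℕ :=
  (List.range L).filter fun k => decide (∀ t < c.wd n, g [c.left n + t, c.y, 0, k] ≠ 0)

/-- The indices of the vertical wires that span the block `c`. -/
def vIndices (g : List ℕ → ℕ) (L : ℕ) (c : Code) : List ℕ :=
  (List.range L).filter fun k => decide (∀ t < c.h, g [c.x, c.bot + t, 1, k] ≠ 0)

/-- The size of a maximum bundle in the block `c`. -/
def weight (g : List ℕ → ℕ) (L n : ℕ) (c : Code) : ℕ :=
  min (hIndices g L n c).length (vIndices g L c).length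

/-- The memory holds a maximum bundle in the block `c`. -/
structure HasBundle (g : List ℕ → ℕ) (L n : ℕ) (c : Code) (s : State) : Prop where
  size : s.arr Arr.bundleSize c.key = weight g L n c
  horizontal : ∀ j < (hIndices g L n c).length,
    s.arr Arr.bundleH (c.key ++ [j]) = (hIndices g L n c).getD j 0
  vertical : ∀ j < (vIndices g L c).length,
    s.arr Arr.bundleV (c.key ++ [j]) = (vIndices g L c).getD j 0

theorem HasBundle.congr {g : List ℕ → ℕ} {L n : ℕ} {c : Code} {s s' : State}
    (h : HasBundle g L n c s) (h₁ : s'.arr Arr.bundleSize = s.arr Arr.bundleSize)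
    (h₂ : s'.arr Arr.bundleH = s.arr Arr.bundleH) (h₃ : s'.arr Arr.bundleV = s.arr Arr.bundleV) :
    HasBundle g L n c s' :=
  ⟨by rw [h₁, h.size], by rw [h₂]; exact h.horizontal, by rw [h₃]; exact h.vertical⟩

/-- List the indices of the wires of length `b` in one direction that lie in `G`. -/
def listWires (b base : Var) (idx : List Opd) (A : Arr) (cnt : Var) : Prog :=
  Prog.loop Var.k Var.L (Prog.block [
    Prog.assign Var.ok (Rhs.opd 1),
    Prog.loop Var.t b (Prog.block [
      Prog.assign Var.col (Rhs.add base Var.t),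
      Prog.assign Var.g (Rhs.read Arr.inG idx),
      Prog.ite (Test.isEq Var.g 0) (Prog.assign Var.ok (Rhs.opd 0)) Prog.skip]),
    Prog.ite (Test.isEq Var.ok 1)
      (Prog.block [
        Prog.store A [Var.i, Var.x, Var.y, Var.sx, Var.sy, cnt] Var.k,
        Prog.assign cnt (Rhs.add cnt 1)])
      Prog.skip])

theorem List.getD_concat_of_lt {l : List ℕ} {j a : ℕ} (h : j < l.length) :
    (l ++ [a]).getD j 0 = l.getD j 0 := by
  simp [List.getD_eq_getElem?_getD, List.getElem?_append_left h]

/-- Both halves of `computeMaxBundle` are instances of `listWires`. `F` is the address read in `inG`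
as a function of the position along the wire and the wire index; the disjunctions on registers and
arrays only rule out interference. -/
theorem listWires_spec {n L b₀ base₀ : ℕ} {c : Code} {s : State} {b base cnt : Var}
    {idx : List Opd} {A : Arr} {g : List ℕ → ℕ} {F : ℕ → ℕ → List ℕ}
    (hcnt : cnt = Var.cntH ∨ cnt = Var.cntV) (hA : A = Arr.bundleH ∨ A = Arr.bundleV)
    (hg : s.arr Arr.inG = g) (hL : s.var Var.L = L) (hc : Placed n c s)
    (hb : s.var b = b₀) (hb' : b = Var.w ∨ b = Var.i)
    (hbase : s.var base = base₀) (hbase' : base = Var.xl ∨ base = Var.yl)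
    (h₀ : s.var cnt = 0) (hlen : idx.length = 4)
    (hidx : ∀ s' : State, s'.var Var.x = c.x → s'.var Var.y = c.y →
      idx.map (Opd.eval s') = F (s'.var Var.col) (s'.var Var.k)) :
    let l := (List.range L).filter fun k => decide (∀ t < b₀, g (F (base₀ + t) k) ≠ 0)
    Ends (listWires b base idx A cnt) s (1 + L * (1 + (2 + ((1 + b₀ * (1 + 11)) + 10))))
      fun s' => s'.var cnt = l.length ∧
        (∀ j < l.length, s'.arr A (c.key ++ [j]) = l.getD j 0) ∧
        ∀ idx', (∀ j, idx' ≠ c.key ++ [j]) → s'.arr A idx' = s.arr A idx' := by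
  intro l
  let p : ℕ → Bool := fun k => decide (∀ t < b₀, g (F (base₀ + t) k) ≠ 0)
  refine Ends.loop (fun m s' => s'.var cnt = ((List.range m).filter p).length ∧
    (∀ j < ((List.range m).filter p).length,
      s'.arr A (c.key ++ [j]) = ((List.range m).filter p).getD j 0) ∧
    ∀ idx', (∀ j, idx' ≠ c.key ++ [j]) → s'.arr A idx' = s.arr A idx') hL
    ⟨by simpa using h₀, by simp, fun _ _ => rfl⟩ fun m hm s₁ f₁ ⟨k1, k2, k3⟩ => ?_
  have hbne : b ≠ Var.k ∧ b ≠ Var.ok ∧ b ≠ Var.t ∧ b ≠ Var.col ∧ b ≠ Var.g ∧ b ≠ cnt := by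
    rcases hb' with rfl | rfl <;> rcases hcnt with rfl | rfl <;> decide
  have hbasene : base ≠ Var.k ∧ base ≠ Var.ok ∧ base ≠ Var.t ∧ base ≠ Var.col ∧ base ≠ Var.g ∧
      base ≠ cnt := by
    rcases hbase' with rfl | rfl <;> rcases hcnt with rfl | rfl <;> decide
  have hcntne : cnt ≠ Var.k ∧ cnt ≠ Var.ok ∧ cnt ≠ Var.t ∧ cnt ≠ Var.col ∧ cnt ≠ Var.g := by
    rcases hcnt with rfl | rfl <;> decide
  have hc₁ : Placed n c s₁ := by
    rcases hcnt with rfl | rfl <;> exact hc.of_frame f₁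
  have hb₁ : s₁.var b = b₀ := by
    rw [f₁.var b (by simp [Prog.writesVar, Prog.block, hbne]), hb]
  have hbase₁ : s₁.var base = base₀ := by
    rw [f₁.var base (by simp [Prog.writesVar, Prog.block, hbasene]), hbase]
  have hg₁ : s₁.arr Arr.inG = g := by
    rw [f₁.arr _ (by rcases hA with rfl | rfl <;> rfl), hg]
  refine Ends.seq (R₁ := fun s' => s' = (s₁.set Var.k m).set Var.ok 1) (Ends.assign rfl) ?_
  rintro s₂ e₂ f₂
  have hc₂ : Placed n c s₂ := by
    subst e₂
    exact ⟨⟨hc₁.i, hc₁.w, hc₁.x, hc₁.y, hc₁.sx, hc₁.sy⟩, hc₁.xl, hc₁.yl⟩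
  -- After `t` passes of the inner loop, `ok` tells whether the first `t` vertices of wire `m` are
  -- in the graph.
  refine Ends.seq (R₁ := fun s' => s'.var Var.ok = if p m then 1 else 0)
    (Ends.mono (Ends.loop (b := b₀) (T := 11) (fun t s' => s'.var Var.ok =
      if ∀ t' < t, g (F (base₀ + t') m) ≠ 0 then 1 else 0) ?_ ?_ fun t ht s₃ f₃ h₃ => ?_)
      le_rfl ?_) ?_
  · simp [Opd.eval, e₂, hbne, hb₁]
  · simp [e₂]
  · have hc₃ : Placed n c s₃ := hc₂.of_frame f₃
    have hbase₃ : s₃.var base = base₀ := by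
      rw [f₃.var base (by simp [Prog.writesVar, Prog.block, hbasene]), e₂]
      simp [hbasene, hbase₁]
    have hk₃ : s₃.var Var.k = m := by rw [f₃.var _ rfl, e₂]; simp
    have hg₃ : s₃.arr Arr.inG = g := by rw [f₃.arr _ rfl, e₂]; simp [hg₁]
    refine Ends.le (Ends.of_loopFree ?_) (by
      simp only [Prog.block, Prog.cost, Rhs.time, hlen]; decide)
    have hi := hidx ((s₃.set Var.t t).set Var.col (base₀ + t)) (by simpa using hc₃.x)
      (by simpa using hc₃.y)
    simp only [State.set_var, reduceCtorEq, if_false, if_true, hk₃] at hi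
    by_cases h : g (F (base₀ + t) m) = 0
    · simp [Prog.block, Prog.exec, Rhs.eval, Opd.eval, Test.eval, hbase₃, hbasene, hi, hg₃, h]
      exact ⟨t, by omega, h⟩
    · have : (∀ t' < t + 1, g (F (base₀ + t') m) ≠ 0) ↔ ∀ t' < t, g (F (base₀ + t') m) ≠ 0 := by
        refine ⟨fun h' t' ht' => h' t' (by omega), fun h' t' ht' => ?_⟩
        rcases Nat.lt_succ_iff_lt_or_eq.1 ht' with ht' | rfl
        · exact h' t' ht'
        · exact h
      simp only [this]
      simpa [Prog.block, Prog.exec, Rhs.eval, Opd.eval, Test.eval, hbase₃, hbasene, hi, hg₃, h]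
        using h₃
  · intro s' h _
    simpa [p] using h
  intro s₄ h₄ f₄
  have hc₄ : Placed n c s₄ := hc₂.of_frame f₄
  have hcnt₄ : s₄.var cnt = ((List.range m).filter p).length := by
    rw [f₄.var cnt (by simp [Prog.writesVar, Prog.block, hcntne]), e₂]
    simp [hcntne, k1]
  have hA₄ : s₄.arr A = s₁.arr A := by
    rw [f₄.arr A (by rcases hA with rfl | rfl <;> rfl), e₂]; simp
  have hk₄ : s₄.var Var.k = m := by rw [f₄.var _ rfl, e₂]; simp
  refine Ends.le (T₁ := 1 + 9) (Ends.ite (fun ht => ?_) fun ht => ?_) (by omega)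
  · have hp : p m = true := by
      have := of_decide_eq_true ht
      by_contra hp
      simp [Opd.eval, h₄, hp] at this
    refine Ends.le (Ends.of_loopFree ?_) (by simp [Prog.block, Prog.cost, Rhs.time])
    have hfil : (List.range (m + 1)).filter p = (List.range m).filter p ++ [m] := by
      simp [List.range_succ, List.filter_append, hp]
    rw [hfil]
    have hkey : [c.h, c.x, c.y, c.sx, c.sy, ((List.range m).filter p).length] =
      c.key ++ [((List.range m).filter p).length] := rfl
    simp only [Prog.block, Prog.exec, Rhs.eval, Opd.eval, List.map_cons, List.map_nil, hc₄.i, hc₄.x,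
      hc₄.y, hc₄.sx, hc₄.sy, hcnt₄, hk₄, State.set_arr, State.set_var, State.put_arr,
      State.put_var, hA₄, if_true, true_and, List.length_append, List.length_singleton, hkey]
    refine ⟨fun j hj => ?_, fun idx' hidx' => ?_⟩
    · rcases Nat.lt_succ_iff_lt_or_eq.1 hj with hj | rfl
      · rw [if_neg (by simp; omega), List.getD_concat_of_lt hj, k2 j hj]
      · simp [List.getD_eq_getElem?_getD]
    · rw [if_neg (hidx' _), k3 _ hidx']
  · have hp : p m = false := by
      have := of_decide_eq_false ht
      by_contra hp
      simp [Opd.eval, h₄, hp] at this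
    have hfil : (List.range (m + 1)).filter p = (List.range m).filter p := by
      simp [List.range_succ, List.filter_append, hp]
    refine (Ends.skip ?_).le (by omega)
    rw [hfil, hA₄]
    exact ⟨hcnt₄, k2, k3⟩

theorem computeMaxBundle_spec {M N L n : ℕ} {c : Code} {s : State} {g : List ℕ → ℕ}
    (hp : Params M N L n s) (hc : Placed n c s) (hg : s.arr Arr.inG = g) (hv : c.Valid M N n) :
    Ends computeMaxBundle s (16 + 40 * L + 12 * L * (n + 1)) fun s' =>
      (∀ c', HasBundle g L n c' s → HasBundle g L n c' s') ∧ HasBundle g L n c s' := by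
  refine Ends.le (T₁ := 2 + ((1 + L * (1 + (2 + ((1 + c.wd n * (1 + 11)) + 10)))) +
    (2 + ((1 + L * (1 + (2 + ((1 + c.h * (1 + 11)) + 10)))) + 7)))) ?_ ?_
  swap
  -- An ell with `n` cells has `n + 1` vertices, so the two inner loops make `n + 1` passes in total
  -- for every wire index.
  · have hn : n + 1 = c.wd n + c.h := by have := hv.le; simp only [Code.wd]; omega
    rw [hn]
    nlinarith
  refine Ends.seq (R₁ := fun s' => s'.var Var.cntH = 0) (Ends.assign (by
    simp [Rhs.eval, Opd.eval])) fun s₁ h₁ f₁ => ?_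
  have hc₁ := hc.of_frame f₁
  have hg₁ : s₁.arr Arr.inG = g := by rw [f₁.arr _ rfl, hg]
  refine Ends.seq (listWires_spec (A := Arr.bundleH) (base := Var.xl)
    (F := fun col k => [col, c.y, 0, k]) (Or.inl rfl) (Or.inl rfl) hg₁
    (by rw [f₁.var _ rfl, hp.rL]) hc₁ hc₁.w (Or.inl rfl) hc₁.xl (Or.inl rfl) h₁ rfl
    (fun s' _ hy => by simp [Opd.eval, hy])) ?_
  rintro s₂ ⟨h₂, h₂', h₂''⟩ f₂
  have hc₂ : Placed n c s₂ := hc₁.of_frame f₂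
  refine Ends.seq (R₁ := fun s' => s'.var Var.cntV = 0) (Ends.assign (by
    simp [Rhs.eval, Opd.eval])) fun s₃ h₃ f₃ => ?_
  have hc₃ := hc₂.of_frame f₃
  have hg₃ : s₃.arr Arr.inG = g := by rw [f₃.arr _ rfl, f₂.arr _ rfl, hg₁]
  refine Ends.seq (listWires_spec (A := Arr.bundleV) (base := Var.yl)
    (F := fun col k => [c.x, col, 1, k]) (Or.inr rfl) (Or.inr rfl) hg₃
    (by rw [f₃.var _ rfl, f₂.var _ rfl, f₁.var _ rfl, hp.rL]) hc₃ hc₃.i (Or.inr rfl)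
    hc₃.yl (Or.inr rfl) h₃ rfl (fun s' hx _ => by simp [Opd.eval, hx])) ?_
  rintro s₄ ⟨h₄, h₄', h₄''⟩ f₄
  have hc₄ : Placed n c s₄ := hc₃.of_frame f₄
  have hH : s₄.var Var.cntH = (hIndices g L n c).length := by
    rw [f₄.var _ rfl, f₃.var _ rfl, h₂]; rfl
  have hV : s₄.var Var.cntV = (vIndices g L c).length := h₄
  have hbs : s₄.arr Arr.bundleSize = s.arr Arr.bundleSize := by
    rw [f₄.arr _ rfl, f₃.arr _ rfl, f₂.arr _ rfl, f₁.arr _ rfl]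
  have hbH : s₄.arr Arr.bundleH = s₂.arr Arr.bundleH := by
    rw [f₄.arr _ rfl, f₃.arr _ rfl]
  have hbV : s₃.arr Arr.bundleV = s.arr Arr.bundleV := by
    rw [f₃.arr _ rfl, f₂.arr _ rfl, f₁.arr _ rfl]
  refine Ends.mono (T₁ := 1 + 6) (R₁ := fun s' => ∀ j, s'.arr Arr.bundleSize j =
    if j = c.key then weight g L n c else s₄.arr Arr.bundleSize j)
    (Ends.ite (fun ht => Ends.store fun j => ?_) fun ht => Ends.store fun j => ?_) le_rfl ?_
  · have := of_decide_eq_true ht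
    simp only [Opd.eval, hH, hV] at this
    simp [Opd.eval, hc₄.i, hc₄.x, hc₄.y, hc₄.sx, hc₄.sy, hH, Code.key, weight, min_eq_left this.le]
  · have := of_decide_eq_false ht
    simp only [Opd.eval, hH, hV, not_lt] at this
    simp [Opd.eval, hc₄.i, hc₄.x, hc₄.y, hc₄.sx, hc₄.sy, hV, Code.key, weight, min_eq_right this]
  intro s₅ h₅ f₅
  have hbH₅ : s₅.arr Arr.bundleH = s₂.arr Arr.bundleH := by rw [f₅.arr _ rfl, hbH]
  have hbV₅ : s₅.arr Arr.bundleV = s₄.arr Arr.bundleV := f₅.arr _ rfl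
  have own : HasBundle g L n c s₅ :=
    ⟨by rw [h₅, if_pos rfl], by rw [hbH₅]; exact h₂', by rw [hbV₅]; exact h₄'⟩
  refine ⟨fun c' h => ?_, own⟩
  -- The bundle of `c` itself may have been overwritten, but by a correct one; the bundles of other
  -- blocks have other keys.
  by_cases hcc : c' = c
  · exact hcc ▸ own
  have hne : c'.key ≠ c.key := fun h => hcc (Code.key_injective h)
  have hne' : ∀ j j' : ℕ, c'.key ++ [j] ≠ c.key ++ [j'] := by
    intro j j' e
    exact hne (List.append_inj_left e rfl)
  refine ⟨by rw [h₅, if_neg hne, hbs, h.size], fun j hj => ?_, fun j hj => ?_⟩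
  · rw [hbH₅, h₂'' _ (hne' j), f₁.arr _ rfl, h.horizontal j hj]
  · rw [hbV₅, h₄'' _ (hne' j), hbV, h.vertical j hj]

/-- This weak description is enough. The main loop reaches height `h` with all lists of that height
still empty, so clearing must only be harmless, and no coverage of the rectangles has to be shown.
-/
theorem clearRectangles_spec {M N L n h : ℕ} {s : State} (hp : Params M N L n s)
    (hi : s.var Var.i = h) :
    Ends clearRectangles s (10 + (1 + (M + 1) * (1 + (1 + (N + 1) * (1 + 4))))) fun s' =>
      ∀ h' x y, s'.arr Arr.mpeLen [h', x, y] = s.arr Arr.mpeLen [h', x, y] ∨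
        h' = h ∧ s'.arr Arr.mpeLen [h', x, y] = 0 := by
  refine Ends.le (T₁ := 2 + (2 + (2 + (2 + (2 + (1 + (M + 1) * (1 + (1 + (N + 1) * (1 + 4)))))))))
    (Ends.seq (R₁ := fun s' => s'.var Var.w = n - h) (Ends.assign ?_) fun s₁ e₁ f₁ => Ends.seq
    (R₁ := fun s' => s'.var Var.xe = M - (n - h)) (Ends.assign ?_) fun s₂ e₂ f₂ => Ends.seq
    (R₁ := fun s' => s'.var Var.xe = M - (n - h) + 1) (Ends.assign ?_) fun s₃ e₃ f₃ => Ends.seq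
    (R₁ := fun s' => s'.var Var.ye = N - h) (Ends.assign ?_) fun s₄ e₄ f₄ => Ends.seq
    (R₁ := fun s' => s'.var Var.ye = N - h + 1) (Ends.assign ?_) fun s₅ e₅ f₅ =>
    Ends.mono (T₁ := 1 + (M - (n - h) + 1) * (1 + (1 + (N + 1) * (1 + 4)))) (Ends.loop
      (fun _ s' => ∀ h' x y, s'.arr Arr.mpeLen [h', x, y] = s.arr Arr.mpeLen [h', x, y] ∨
        h' = h ∧ s'.arr Arr.mpeLen [h', x, y] = 0) ?_ ?_ fun mx hmx s₆ f₆ h₆ => ?_)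
        (Nat.add_le_add_left (Nat.mul_le_mul_right _ (by omega)) 1) fun s' h _ => h) (by omega)
  · simp [Rhs.eval, Opd.eval, hp.rn, hi]
  · simp [Rhs.eval, Opd.eval, e₁, f₁.var Var.M rfl, hp.rM]
  · simp [Rhs.eval, Opd.eval, e₂]
  · simp [Rhs.eval, Opd.eval, f₃.var Var.N rfl, f₃.var Var.i rfl, f₂.var Var.N rfl,
      f₂.var Var.i rfl, f₁.var Var.N rfl, f₁.var Var.i rfl, hp.rN, hi]
  · simp [Rhs.eval, Opd.eval, e₄]
  · simp [Opd.eval, f₅.var Var.xe rfl, f₄.var Var.xe rfl, e₃]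
  · intro h' x y
    left
    rw [f₅.arr _ rfl, f₄.arr _ rfl, f₃.arr _ rfl, f₂.arr _ rfl, f₁.arr _ rfl]
  · refine Ends.mono (T₁ := 1 + (N - h + 1) * (1 + 4)) (Ends.loop
      (fun _ s' => ∀ h' x y, s'.arr Arr.mpeLen [h', x, y] = s.arr Arr.mpeLen [h', x, y] ∨
        h' = h ∧ s'.arr Arr.mpeLen [h', x, y] = 0) ?_ h₆ fun my hmy s₇ f₇ h₇ => ?_)
        (Nat.add_le_add_left (Nat.mul_le_mul_right _ (by omega)) 1) fun s' h _ => h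
    · simp [Opd.eval, f₆.var Var.ye rfl, e₅]
    · have hi₇ : s₇.var Var.i = h := by
        rw [f₇.var _ rfl]
        simp only [State.set_var, reduceCtorEq, if_false]
        rw [f₆.var _ rfl, f₅.var _ rfl, f₄.var _ rfl, f₃.var _ rfl, f₂.var _ rfl, f₁.var _ rfl, hi]
      refine Ends.store fun h' x y => ?_
      simp only [Opd.eval, List.map_cons, List.map_nil, State.put_arr, State.set_var, State.set_arr,
        reduceCtorEq, if_false, if_true, hi₇, true_and]
      split
      · rename_i e
        simp only [List.cons.injEq] at e
        exact Or.inr ⟨e.1, rfl⟩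
      · exact h₇ h' x y

end NativeClique

namespace NativeClique

/-! ### Chains of ell blocks -/

/-- The sequence `l` of ell blocks of heights `1, …, h`, every one of which is placed on the working
rectangle that its predecessor leaves, leaves the working rectangle of height `h` with
south-western cell `(x, y)`. -/
inductive Chain (M N n : ℕ) : ℕ → ℕ → ℕ → List Code → Prop
  | single {c : Code} (hv : c.Valid M N n) (hc : c.h = 1) : Chain M N n 1 (c.frX n) c.bot [c]
  | snoc {h : ℕ} {l : List Code} {c : Code} (hl : Chain M N n h (c.left n) c.toY l)
      (hv : c.Valid M N n) (hc : c.h = h + 1) : Chain M N n (h + 1) (c.frX n) c.bot (l ++ [c])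

/-- The block `c` can be placed after the sequence `q`. -/
def Precedes (M N n : ℕ) (q : List Code) (c : Code) : Prop :=
  if c.h = 1 then q = [] else Chain M N n (c.h - 1) (c.left n) c.toY q

theorem Precedes.chain {M N n : ℕ} {q : List Code} {c : Code} (h : Precedes M N n q c)
    (hv : c.Valid M N n) : Chain M N n c.h (c.frX n) c.bot (q ++ [c]) := by
  unfold Precedes at h
  split at h
  · rename_i h1
    subst h
    rw [h1]
    exact Chain.single hv h1
  · have := hv.one_le
    obtain ⟨k, hk⟩ : ∃ k, c.h = k + 1 := ⟨c.h - 1, by omega⟩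
    rw [hk] at h ⊢
    exact Chain.snoc h hv hk

theorem Chain.one_le {M N n h x y : ℕ} {l : List Code} (H : Chain M N n h x y l) : 1 ≤ h := by
  induction H <;> omega

theorem Chain.exists_last {M N n h x y : ℕ} {l : List Code} (H : Chain M N n h x y l) :
    ∃ q c, l = q ++ [c] ∧ c.Valid M N n ∧ c.h = h ∧ c.frX n = x ∧ c.bot = y ∧
      Precedes M N n q c := by
  induction H with
  | @single c hv hc => exact ⟨[], c, rfl, hv, hc, rfl, rfl, by simp [Precedes, hc]⟩
  | @snoc h l c hl hv hc =>
    refine ⟨l, c, rfl, hv, hc, rfl, rfl, ?_⟩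
    have := hl.one_le
    rw [Precedes, if_neg (by omega), hc]
    simpa using hl

/-- The working rectangle of height `h` with south-western cell `(x, y)` is contained in the
grid. -/
def InGrid (M N n h x y : ℕ) : Prop := x + (n - h) ≤ M ∧ y + h ≤ N

theorem Code.Valid.inGrid_to {M N n : ℕ} {c : Code} (hv : c.Valid M N n) :
    InGrid M N n (c.h - 1) (c.left n) c.toY := by
  obtain ⟨h1, h2, h3, h4, h5, h6, h7, h8, h9, h10⟩ := hv
  unfold InGrid Code.toY
  unfold Code.wd at h9
  split <;> omega

theorem Code.Valid.inGrid_from {M N n : ℕ} {c : Code} (hv : c.Valid M N n) :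
    InGrid M N n c.h (c.frX n) c.bot := by
  obtain ⟨h1, h2, h3, h4, h5, h6, h7, h8, h9, h10⟩ := hv
  unfold InGrid Code.frX
  unfold Code.wd at h9
  split <;> omega

/-- This makes the empty list a legitimate table entry: it is a final segment of the chain found
here. The chain is built backwards, by attaching a column to the rectangle and removing a row. -/
theorem exists_chain {M N n : ℕ} (hM : n ≤ M) (h : ℕ) :
    ∀ x y, 1 ≤ h → h < n → InGrid M N n h x y → ∃ l, Chain M N n h x y l := by
  induction h with
  | zero => intro x y h; omega
  | succ h ih =>
    intro x y _ hn hg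
    obtain ⟨hx, hy⟩ := hg
    obtain ⟨c, hv, hc, hcx, hcy⟩ : ∃ c : Code, c.Valid M N n ∧ c.h = h + 1 ∧ c.frX n = x ∧
        c.bot = y := by
      -- The corner column is attached to the east if the grid has room there. Otherwise `x + (n -
      -- h) > M ≥ n` forces `x > 0`, and it is attached to the west.
      by_cases hr : x + (n - h) ≤ M
      · refine ⟨⟨h + 1, x + (n - h) - 1, y, 1, 0⟩, ⟨?_, ?_, ?_, ?_, ?_, ?_, ?_, ?_, ?_, ?_⟩, rfl,
          ?_, ?_⟩ <;> simp [Code.wd, Code.left, Code.bot, Code.frX] <;> (try split_ifs) <;> omega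
      · refine ⟨⟨h + 1, x - 1, y, 0, 0⟩, ⟨?_, ?_, ?_, ?_, ?_, ?_, ?_, ?_, ?_, ?_⟩, rfl,
          ?_, ?_⟩ <;> simp [Code.wd, Code.left, Code.bot, Code.frX] <;> (try split_ifs) <;> omega
    obtain ⟨q, hq⟩ : ∃ q, Precedes M N n q c := by
      unfold Precedes
      split
      · exact ⟨[], rfl⟩
      · have := hv.inGrid_to
        rw [hc] at this ⊢
        exact ih _ _ (by omega) (by omega) this
    have := hq.chain hv
    rw [hc, hcx, hcy] at this
    exact ⟨_, this⟩

theorem exists_precedes {M N n : ℕ} (hM : n ≤ M) {c : Code} (hv : c.Valid M N n) :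
    ∃ q, Precedes M N n q c := by
  unfold Precedes
  split
  · exact ⟨[], rfl⟩
  · have := hv.one_le
    have := hv.le
    exact exists_chain hM _ _ _ (by omega) (by omega) hv.inGrid_to

theorem exists_full_chain {M N n : ℕ} (hn : 1 ≤ n) (hM : n ≤ M) (hN : n ≤ N) :
    ∃ x y l, Chain M N n n x y l := by
  -- Any block of height `n` and width one can end a full chain; it fits since `n ≤ N`.
  have hv : (⟨n, 0, 0, 0, 0⟩ : Code).Valid M N n := by
    refine ⟨hn, le_rfl, ?_, ?_, ?_, ?_, ?_, ?_, ?_, ?_⟩ <;>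
      simp [Code.wd, Code.left, Code.bot] <;> (try split_ifs) <;> omega
  obtain ⟨q, hq⟩ := exists_precedes hM hv
  exact ⟨_, _, _, hq.chain hv⟩

/-! ### How the blocks of a chain cross -/

/-- The column `t` meets the horizontal wires of the block. -/
def Code.InRow (n : ℕ) (c : Code) (t : ℕ) : Prop := c.left n ≤ t ∧ t < c.left n + c.wd n

/-- The row `t` meets the vertical wires of the block. -/
def Code.InCol (c : Code) (t : ℕ) : Prop := c.bot ≤ t ∧ t < c.bot + c.h

theorem Code.Valid.inRow {M N n : ℕ} {c : Code} (hv : c.Valid M N n) : c.InRow n c.x := by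
  obtain ⟨h1, h2, h3, h4, h5, h6, h7, h8, h9, h10⟩ := hv
  simp only [Code.InRow, Code.left, Code.wd] at *
  split_ifs at * <;> omega

theorem Code.Valid.inCol {M N n : ℕ} {c : Code} (hv : c.Valid M N n) : c.InCol c.y := by
  obtain ⟨h1, h2, h3, h4, h5, h6, h7, h8, h9, h10⟩ := hv
  simp only [Code.InCol, Code.bot] at *
  split_ifs at * <;> omega

/-- The corner is an end of the horizontal wires, so without it their columns still form an
interval, which is the column range of `R_from`. The same holds for the rows of `R_to` in
`inCol_iff_to`. -/
theorem Code.Valid.inRow_iff_from {M N n : ℕ} {c : Code} (hv : c.Valid M N n) (t : ℕ) :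
    c.InRow n t ∧ t ≠ c.x ↔ c.frX n ≤ t ∧ t < c.frX n + (n - c.h) := by
  obtain ⟨h1, h2, h3, h4, h5, h6, h7, h8, h9, h10⟩ := hv
  simp only [Code.InRow, Code.left, Code.wd, Code.frX] at *
  split_ifs at * <;> omega

theorem Code.Valid.inCol_iff_to {M N n : ℕ} {c : Code} (hv : c.Valid M N n) (t : ℕ) :
    c.InCol t ∧ t ≠ c.y ↔ c.toY ≤ t ∧ t < c.toY + (c.h - 1) := by
  obtain ⟨h1, h2, h3, h4, h5, h6, h7, h8, h9, h10⟩ := hv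
  simp only [Code.InCol, Code.bot, Code.toY] at *
  split_ifs at * <;> omega

/-- The horizontal component of `c` meets the vertical component of `c'`. -/
structure Dominates (n : ℕ) (c c' : Code) : Prop where
  inRow : c.InRow n c'.x
  x_ne : c'.x ≠ c.x
  inCol : c'.InCol c.y
  y_ne : c.y ≠ c'.y

/-- The horizontal component of `c` meets the vertical component of `c'`, and the blocks have no
other cell in common. -/
structure Crosses (n : ℕ) (c c' : Code) : Prop extends Dominates n c c' where
  not_inRow : ¬ c'.InRow n c.x
  not_inCol : ¬ c.InCol c'.y

/-- The middle clause is the strengthening that makes the induction work: every block of the chain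
spans the columns of the remaining rectangle, keeps its corner out of them, and has its vertical
wires within the rows. The row of the next block covers exactly these columns, and its corner row
lies outside these rows, so every earlier block crosses it. -/
theorem Chain.spec {M N n h x y : ℕ} {l : List Code} (H : Chain M N n h x y l) :
    l.length = h ∧ (∀ c ∈ l, c.Valid M N n ∧
      (∀ t, x ≤ t → t < x + (n - h) → c.InRow n t) ∧ ¬ (x ≤ c.x ∧ c.x < x + (n - h)) ∧
      (∀ t, c.InCol t → y ≤ t ∧ t < y + h)) ∧ l.Pairwise (Crosses n) := by
  induction H with
  | @single c hv hc =>
    refine ⟨rfl, ?_, List.pairwise_singleton _ _⟩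
    simp only [List.mem_singleton, forall_eq]
    refine ⟨hv, fun t h1 h2 => ((hv.inRow_iff_from t).2 ⟨h1, by rwa [hc]⟩).1, fun h => ?_,
      fun t h => by rwa [Code.InCol, hc] at h⟩
    exact ((hv.inRow_iff_from c.x).2 (by rwa [hc])).2 rfl
  | @snoc h l c hl hv hc ih =>
    obtain ⟨i1, i2, i3⟩ := ih
    have hto := hv.inCol_iff_to
    have hfr := hv.inRow_iff_from
    simp only [hc, Nat.add_sub_cancel] at hto hfr
    have hrow : ∀ t, c.InRow n t ↔ c.left n ≤ t ∧ t < c.left n + (n - h) := fun t => by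
      have := hv.le
      simp only [Code.InRow, Code.wd, hc, Nat.add_sub_add_right]
    refine ⟨by simp [i1], ?_, ?_⟩
    · intro c' hc'
      rw [List.mem_append, List.mem_singleton] at hc'
      rcases hc' with hc' | rfl
      · obtain ⟨j1, j2, j3, j4⟩ := i2 c' hc'
        refine ⟨j1, fun t h1 h2 => ?_, fun hh => ?_, fun t ht => ?_⟩
        · obtain ⟨k1, k2⟩ := (hrow t).1 ((hfr t).2 ⟨h1, h2⟩).1
          exact j2 t k1 k2
        · exact j3 ((hrow _).1 ((hfr _).2 hh).1)
        · have := ((hto t).2 (j4 t ht)).1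
          rwa [Code.InCol, hc] at this
      · exact ⟨hv, fun t h1 h2 => ((hfr t).2 ⟨h1, h2⟩).1, fun hh => ((hfr _).2 hh).2 rfl,
          fun t ht => by rwa [Code.InCol, hc] at ht⟩
    · rw [List.pairwise_append]
      refine ⟨i3, List.pairwise_singleton _ _, fun c' hc' c'' hc'' => ?_⟩
      rw [List.mem_singleton] at hc''
      subst hc''
      obtain ⟨j1, j2, j3, j4⟩ := i2 c' hc'
      have k1 := (hrow _).1 hv.inRow
      have k2 := (hto _).2 (j4 _ j1.inCol)
      refine ⟨⟨j2 _ k1.1 k1.2, fun e => ?_, k2.1, k2.2⟩, fun h => ?_, fun h => ?_⟩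
      · exact j3 (e ▸ k1)
      · exact j3 ((hrow _).1 h)
      · exact ((hto _).2 (j4 _ h)).2 rfl

theorem Chain.nodup {M N n h x y : ℕ} {l : List Code} (H : Chain M N n h x y l) : l.Nodup :=
  H.spec.2.2.imp fun h e => h.x_ne (by rw [e])

/-! ### The tournament of a block clique embedding -/

section Tournament

variable {M N n : ℕ} {S : Finset Code}

/-- Only the tournament structure is assumed. That the blocks fit together as a chain follows by
counting cells and from the convexity of rows. -/
theorem exists_chain_of_dominates (hn : 1 ≤ n) (hcard : S.card = n)
    (hv : ∀ c ∈ S, c.Valid M N n)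
    (hdom : ∀ c ∈ S, ∀ c' ∈ S, c ≠ c' → Dominates n c c' ∨ Dominates n c' c)
    (hasymm : ∀ c ∈ S, ∀ c' ∈ S, Dominates n c c' → ¬ Dominates n c' c) :
    ∃ x y l, Chain M N n n x y l ∧ l.toFinset = S := by
  classical
  have xinj : ∀ c ∈ S, ∀ c' ∈ S, c.x = c'.x → c = c' := by
    intro c hc c' hc' e
    by_contra hne
    rcases hdom c hc c' hc' hne with h | h
    · exact h.x_ne e.symm
    · exact h.x_ne e
  have yinj : ∀ c ∈ S, ∀ c' ∈ S, c.y = c'.y → c = c' := by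
    intro c hc c' hc' e
    by_contra hne
    rcases hdom c hc c' hc' hne with h | h
    · exact h.y_ne e
    · exact h.y_ne e.symm
  have irr : ∀ c, ¬ Dominates n c c := fun c h => h.x_ne rfl
  -- Outdegree and indegree are at most `wd - 1` and `h - 1`, because distinct blocks use distinct
  -- columns and rows. Both pairs have the sum `n - 1`, so equality holds and every cell besides the
  -- corner is a meeting point.
  have counts : ∀ c ∈ S,
      (S.filter (Dominates n c ·)).image Code.x =
        (Finset.Ico (c.left n) (c.left n + c.wd n)).erase c.x ∧
      (S.filter (Dominates n · c)).image Code.y = (Finset.Ico c.bot (c.bot + c.h)).erase c.y ∧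
      (S.filter (Dominates n · c)).card = c.h - 1 := by
    intro c hc
    have hout : (S.filter (Dominates n c ·)).image Code.x ⊆
        (Finset.Ico (c.left n) (c.left n + c.wd n)).erase c.x := by
      intro t ht
      obtain ⟨c', hc', rfl⟩ := Finset.mem_image.1 ht
      have := (Finset.mem_filter.1 hc').2
      exact Finset.mem_erase.2 ⟨this.x_ne, Finset.mem_Ico.2 this.inRow⟩
    have hin : (S.filter (Dominates n · c)).image Code.y ⊆
        (Finset.Ico c.bot (c.bot + c.h)).erase c.y := by
      intro t ht
      obtain ⟨c', hc', rfl⟩ := Finset.mem_image.1 ht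
      have := (Finset.mem_filter.1 hc').2
      exact Finset.mem_erase.2 ⟨this.y_ne, Finset.mem_Ico.2 this.inCol⟩
    have c1 : ((S.filter (Dominates n c ·)).image Code.x).card =
        (S.filter (Dominates n c ·)).card :=
      Finset.card_image_of_injOn fun a ha b hb e =>
        xinj a (Finset.mem_filter.1 ha).1 b (Finset.mem_filter.1 hb).1 e
    have c2 : ((S.filter (Dominates n · c)).image Code.y).card =
        (S.filter (Dominates n · c)).card :=
      Finset.card_image_of_injOn fun a ha b hb e =>
        yinj a (Finset.mem_filter.1 ha).1 b (Finset.mem_filter.1 hb).1 e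
    have d1 : ((Finset.Ico (c.left n) (c.left n + c.wd n)).erase c.x).card = c.wd n - 1 := by
      rw [Finset.card_erase_of_mem (Finset.mem_Ico.2 (hv c hc).inRow)]; simp
    have d2 : ((Finset.Ico c.bot (c.bot + c.h)).erase c.y).card = c.h - 1 := by
      rw [Finset.card_erase_of_mem (Finset.mem_Ico.2 (hv c hc).inCol)]; simp
    have hsplit : (S.filter (Dominates n c ·)).card + (S.filter (Dominates n · c)).card = n - 1 := by
      have he : n - 1 = (S.erase c).card := by rw [Finset.card_erase_of_mem hc, hcard]
      rw [he, ← Finset.card_union_of_disjoint]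
      · congr 1
        ext c'
        simp only [Finset.mem_union, Finset.mem_filter, Finset.mem_erase]
        constructor
        · rintro (⟨h, h'⟩ | ⟨h, h'⟩)
          · exact ⟨fun e => irr c (e ▸ h'), h⟩
          · exact ⟨fun e => irr c (e ▸ h'), h⟩
        · rintro ⟨h, h'⟩
          rcases hdom c hc c' h' (Ne.symm h) with hd | hd
          · exact Or.inl ⟨h', hd⟩
          · exact Or.inr ⟨h', hd⟩
      · rw [Finset.disjoint_left]
        intro c' h1 h2
        exact hasymm c hc c' (Finset.mem_filter.1 h1).1 (Finset.mem_filter.1 h1).2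
          (Finset.mem_filter.1 h2).2
    have e1 := Finset.card_le_card hout
    have e2 := Finset.card_le_card hin
    have := (hv c hc).one_le
    have := (hv c hc).le
    simp only [Code.wd] at d1
    refine ⟨Finset.eq_of_subset_of_card_le hout ?_, Finset.eq_of_subset_of_card_le hin ?_, ?_⟩ <;>
      simp only [Code.wd] at * <;> omega
  have rowDom : ∀ c ∈ S, ∀ t, c.InRow n t → t ≠ c.x → ∃ c' ∈ S, Dominates n c c' ∧ c'.x = t := by
    intro c hc t ht hne
    have : t ∈ (S.filter (Dominates n c ·)).image Code.x := by
      rw [(counts c hc).1]; exact Finset.mem_erase.2 ⟨hne, Finset.mem_Ico.2 ht⟩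
    obtain ⟨c', hc', e⟩ := Finset.mem_image.1 this
    exact ⟨c', (Finset.mem_filter.1 hc').1, (Finset.mem_filter.1 hc').2, e⟩
  have colDom : ∀ c ∈ S, ∀ t, c.InCol t → t ≠ c.y → ∃ c' ∈ S, Dominates n c' c ∧ c'.y = t := by
    intro c hc t ht hne
    have : t ∈ (S.filter (Dominates n · c)).image Code.y := by
      rw [(counts c hc).2.1]; exact Finset.mem_erase.2 ⟨hne, Finset.mem_Ico.2 ht⟩
    obtain ⟨c', hc', e⟩ := Finset.mem_image.1 this
    exact ⟨c', (Finset.mem_filter.1 hc').1, (Finset.mem_filter.1 hc').2, e⟩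
  have dom_of_inRow : ∀ c ∈ S, ∀ c' ∈ S, c ≠ c' → c.InRow n c'.x → Dominates n c c' := by
    intro c hc c' hc' hne h
    obtain ⟨c'', h1, h2, h3⟩ := rowDom c hc c'.x h fun e => hne (xinj c hc c' hc' e.symm)
    exact xinj c'' h1 c' hc' h3 ▸ h2
  have trans : ∀ a ∈ S, ∀ b ∈ S, ∀ c ∈ S, Dominates n a b → Dominates n b c →
      Dominates n a c := by
    intro a ha b hb c hc hab hbc
    have hac : a ≠ c := fun e => hasymm a ha b hb hab (e ▸ hbc)
    have hab' : a ≠ b := fun e => irr b (e ▸ hab)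
    have hbc' : b ≠ c := fun e => irr c (e ▸ hbc)
    rcases hdom a ha c hc hac with h | hca
    · exact h
    exfalso
    -- In a cyclic triple, each row contains its own corner column and that of the next block but
    -- not the third one. Whichever of the three columns lies in the middle contradicts convexity of
    -- the row containing the other two.
    have n1 : ¬ b.InRow n a.x := fun h => hasymm a ha b hb hab (dom_of_inRow b hb a ha hab'.symm h)
    have n2 : ¬ c.InRow n b.x := fun h => hasymm b hb c hc hbc (dom_of_inRow c hc b hb hbc'.symm h)
    have n3 : ¬ a.InRow n c.x := fun h => hasymm c hc a ha hca (dom_of_inRow a ha c hc hac h)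
    have p1 := hab.inRow
    have p2 := hbc.inRow
    have p3 := hca.inRow
    have q1 := (hv a ha).inRow
    have q2 := (hv b hb).inRow
    have q3 := (hv c hc).inRow
    unfold Code.InRow at *
    omega
  have lt_of_dom : ∀ a ∈ S, ∀ b ∈ S, Dominates n a b → a.h < b.h := by
    intro a ha b hb hab
    -- By transitivity, `b` is dominated by all blocks that dominate `a`, and by `a` itself; the
    -- height is the indegree plus one.
    have hss : S.filter (Dominates n · a) ⊂ S.filter (Dominates n · b) := by
      refine (Finset.ssubset_iff_of_subset fun c hc => ?_).2 ⟨a, ?_, ?_⟩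
      · rw [Finset.mem_filter] at hc ⊢
        exact ⟨hc.1, trans c hc.1 a ha b hb hc.2 hab⟩
      · exact Finset.mem_filter.2 ⟨ha, hab⟩
      · exact fun h => irr a (Finset.mem_filter.1 h).2
    have := Finset.card_lt_card hss
    rw [(counts a ha).2.2, (counts b hb).2.2] at this
    omega
  have dom_of_lt : ∀ a ∈ S, ∀ b ∈ S, a.h < b.h → Dominates n a b := by
    intro a ha b hb hab
    rcases hdom a ha b hb (fun e => by simp [e] at hab) with h | h
    · exact h
    · have := lt_of_dom b hb a ha h
      omega
  have himg : S.image Code.h = Finset.Icc 1 n := by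
    refine Finset.eq_of_subset_of_card_le (fun t ht => ?_) ?_
    · obtain ⟨c, hc, rfl⟩ := Finset.mem_image.1 ht
      exact Finset.mem_Icc.2 ⟨(hv c hc).one_le, (hv c hc).le⟩
    · rw [Finset.card_image_of_injOn, hcard, Nat.card_Icc, Nat.add_sub_cancel]
      intro a ha b hb e
      by_contra hne
      rcases hdom a ha b hb hne with h | h
      · exact (lt_of_dom a ha b hb h).ne e
      · exact (lt_of_dom b hb a ha h).ne e.symm
  have hex : ∀ i, ∃ c, 1 ≤ i → i ≤ n → c ∈ S ∧ c.h = i := by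
    intro i
    by_cases hi : 1 ≤ i ∧ i ≤ n
    · have : i ∈ S.image Code.h := himg ▸ Finset.mem_Icc.2 hi
      obtain ⟨c, hc, e⟩ := Finset.mem_image.1 this
      exact ⟨c, fun _ _ => ⟨hc, e⟩⟩
    -- A dummy code for indices outside `1, …, n`, so that `f` is total.
    · exact ⟨⟨0, 0, 0, 0, 0⟩, fun h1 h2 => absurd ⟨h1, h2⟩ hi⟩
  choose f hf using hex
  have chain : ∀ k, 1 ≤ k → k ≤ n →
      Chain M N n k ((f k).frX n) (f k).bot ((List.range k).map fun j => f (j + 1)) := by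
    intro k h1
    induction k, h1 using Nat.le_induction with
    | base =>
      intro h1
      obtain ⟨m1, m2⟩ := hf 1 le_rfl h1
      exact Chain.single (hv _ m1) m2
    | succ k h1 ih =>
      intro h2
      have ih := ih (by omega)
      obtain ⟨m1, m2⟩ := hf k h1 (by omega)
      obtain ⟨m3, m4⟩ := hf (k + 1) (by omega) h2
      rw [List.range_succ, List.map_append, List.map_singleton]
      have hd := dom_of_lt _ m1 _ m3 (by omega)
      generalize f k = c at *
      generalize f (k + 1) = c' at *
      have v := hv c m1
      have v' := hv c' m3
      -- Each column of the row of `c'` is the corner column of `c'` or of a block that `c'`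
      -- dominates; `c` dominates all of these.
      have hsub : ∀ t, c'.InRow n t → c.InRow n t ∧ t ≠ c.x := by
        intro t ht
        by_cases htx : t = c'.x
        · rw [htx]; exact ⟨hd.inRow, hd.x_ne⟩
        · obtain ⟨c'', k1, k2, rfl⟩ := rowDom c' m3 t ht htx
          have := trans c m1 c' m3 c'' k1 hd k2
          exact ⟨this.inRow, this.x_ne⟩
      have hsub' : ∀ t, c.InCol t → c'.InCol t ∧ t ≠ c'.y := by
        intro t ht
        by_cases hty : t = c.y
        · rw [hty]; exact ⟨hd.inCol, hd.y_ne⟩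
        · obtain ⟨c'', k1, k2, rfl⟩ := colDom c m1 t ht hty
          have := trans c'' k1 c m1 c' m3 k2 hd
          exact ⟨this.inCol, this.y_ne⟩
      -- The row of `c'` and the row of `c` without its corner are intervals of the same length `n -
      -- k`. The former is contained in the latter, so comparing its two ends suffices.
      have e1 : c.frX n = c'.left n := by
        have hw : c'.wd n = n - k := by simp [Code.wd, m4]
        have a1 := (v.inRow_iff_from _).1 (hsub (c'.left n) ⟨le_rfl, by omega⟩)
        have a2 := (v.inRow_iff_from _).1 (hsub (c'.left n + (n - k) - 1) ⟨by omega, by omega⟩)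
        omega
      have e2 : c.bot = c'.toY := by
        have a1 := (v'.inCol_iff_to _).1 (hsub' c.bot ⟨le_rfl, by omega⟩)
        have a2 := (v'.inCol_iff_to _).1 (hsub' (c.bot + c.h - 1) ⟨by omega, by omega⟩)
        omega
      exact Chain.snoc (e1 ▸ e2 ▸ ih) v' m4
  refine ⟨_, _, _, chain n hn le_rfl, ?_⟩
  refine Finset.eq_of_subset_of_card_le (fun c hc => ?_) ?_
  · simp only [List.mem_toFinset, List.mem_map, List.mem_range] at hc
    obtain ⟨j, hj, rfl⟩ := hc
    exact (hf (j + 1) (by omega) (by omega)).1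
  · rw [List.toFinset_card_of_nodup (chain n hn le_rfl).nodup, (chain n hn le_rfl).spec.1, hcard]

end Tournament

end NativeClique

namespace NativeClique

/-! ### The dynamic program -/

theorem forEachBlock_time {M N : ℕ} (hM : 1 ≤ M) (hN : 1 ≤ N) (T : ℕ) :
    12 + (1 + M * (1 + (1 + N * (1 + (1 + 2 * (1 + (1 + 2 * (1 + (40 + (1 + (T + 1)))))))))))
      ≤ M * N * (200 + 4 * T) := by
  have h1 : M ≤ M * N := Nat.le_mul_of_pos_right M hN
  calc _ = 13 + 2 * M + M * N * (178 + 4 * T) := by ring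
    _ ≤ 13 * (M * N) + 2 * (M * N) + M * N * (178 + 4 * T) := by omega
    _ ≤ M * N * (200 + 4 * T) := by nlinarith

theorem preprocess_spec {M N L n : ℕ} {s : State} {g : List ℕ → ℕ} (hM : 1 ≤ M) (hN : 1 ≤ N)
    (hp : Params M N L n s) (hg : s.arr Arr.inG = g) :
    Ends preprocess s (1 + n * (1 + (3 +
      M * N * (200 + 4 * (16 + 40 * L + 12 * L * (n + 1)))))) fun s' =>
      ∀ c : Code, c.Valid M N n → HasBundle g L n c s' := by
  refine Ends.mono (Ends.loop_forall (fun _ => True) (HasBundle g L n)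
    (fun m c => c.Valid M N n ∧ c.h = m + 1) hp.rn trivial fun m hm s₁ f₁ _ => ?_) le_rfl ?_
  · refine Ends.seq (R₁ := fun s' => s'.var Var.i = m + 1) (Ends.le (Ends.assign ?_) ?_)
      fun s₂ h₂ f₂ => ?_
    · simp [Rhs.eval, Opd.eval]
    · simp only [Rhs.time]; omega
    have hp₁ : Params M N L n s₁ := hp.of_frame f₁
    have hp₂ : Params M N L n s₂ := Params.of_frame hp₁.set f₂
    have hg₂ : s₂.arr Arr.inG = g := by
      rw [f₂.arr _ rfl, State.set_arr, f₁.arr _ rfl, hg]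
    refine Ends.mono (forEachBlock_spec (by decide) (fun s => s.arr Arr.inG = g) (HasBundle g L n)
      (fun s s' h hs => by rw [h.arr, hs])
      (fun c s s' h hs => hs.congr (by rw [h.arr]) (by rw [h.arr]) (by rw [h.arr])) hp₂ h₂
      (by omega) hm hg₂ fun c s hv hc hp' hpl hs =>
        (computeMaxBundle_spec hp' hpl hs hv).mono le_rfl ?_) (forEachBlock_time hM hN _) ?_
    · rintro s' ⟨k1, k2⟩ f
      exact ⟨by rw [f.arr _ rfl, hs], k1, k2⟩
    · rintro s' ⟨k1, k2, k3⟩ f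
      refine ⟨trivial, fun c hc => k2 c (hc.congr ?_ ?_ ?_), fun c hc => k3 c hc.1 hc.2⟩ <;>
      rw [f₂.arr _ rfl] <;> rfl
  · rintro s' ⟨-, -, k⟩ - c hc
    have := hc.one_le
    have := hc.le
    exact k (c.h - 1) (by omega) c ⟨hc, by omega⟩

theorem table_congr {s s' : State} (h : s'.arr = s.arr) : table s' = table s := by
  funext a b c
  rw [table, table, h]
  exact readBlocks_congr fun _ _ _ _ => by rw [h]

theorem length_table (s : State) (h x y : ℕ) :
    (table s h x y).length = s.arr Arr.mpeLen [h, x, y] := by simp [table]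

theorem table_eq_nil {s : State} {h x y : ℕ} (h₀ : s.arr Arr.mpeLen [h, x, y] = 0) :
    table s h x y = [] := List.length_eq_zero_iff.1 (by rw [length_table, h₀])

theorem table_congr_of_len {s s' : State} {h x y : ℕ} (h₁ : s'.arr Arr.mpe = s.arr Arr.mpe)
    (h₂ : s'.arr Arr.mpeLen [h, x, y] = s.arr Arr.mpeLen [h, x, y]) :
    table s' h x y = table s h x y := by
  rw [table, table, h₂]
  exact readBlocks_congr fun _ _ _ _ => by rw [h₁]

/-! ### Invariants of the dynamic program -/

section

variable (M N n : ℕ) (W : Code → ℕ)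

/-- Every list stored for a working rectangle of height `h` is the end of a chain. -/
def Partial (h : ℕ) (s : State) : Prop :=
  ∀ x y, InGrid M N n h x y → ∃ q, Chain M N n h x y (q ++ table s h x y)

/-- Every list stored for a working rectangle of height `h` has the greatest total weight. -/
def Optimal (h : ℕ) (s : State) : Prop :=
  ∀ x y, InGrid M N n h x y → ∀ q, Chain M N n h x y q →
    (q.map W).sum ≤ ((table s h x y).map W).sum

end

section

variable {M N L n : ℕ} {W : Code → ℕ} {s : State} {c : Code}

theorem total_eq (hW : ∀ c : Code, c.Valid M N n → s.arr Arr.bundleSize c.key = W c)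
    {l : List Code} (hl : ∀ c ∈ l, c.Valid M N n) : total s l = (l.map W).sum :=
  congrArg List.sum (List.map_congr_left fun c hc => hW c (hl c hc))

theorem Chain.valid {h x y : ℕ} {l : List Code} (H : Chain M N n h x y l) :
    ∀ c ∈ l, c.Valid M N n := fun c hc => (H.spec.2.1 c hc).1

theorem Precedes.length {q : List Code} (H : Precedes M N n q c) (hv : c.Valid M N n) :
    q.length + 1 = c.h := by
  have := (H.chain hv).spec.1
  simpa using this

/-- A block of height one has no predecessor, and the empty list is the only candidate; the table is
consulted only for larger heights. -/
theorem previous_spec (hv : c.Valid M N n)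
    (hP : c.h ≠ 1 → Partial M N n (c.h - 1) s) (hO : c.h ≠ 1 → Optimal M N n W (c.h - 1) s) :
    (∃ q, Precedes M N n (q ++ previous n s c) c) ∧
      ∀ q, Precedes M N n q c → (q.map W).sum ≤ ((previous n s c).map W).sum := by
  unfold Precedes previous
  split
  · exact ⟨⟨[], rfl⟩, by rintro q rfl; exact le_rfl⟩
  · rename_i h
    exact ⟨hP h _ _ hv.inGrid_to, hO h _ _ hv.inGrid_to⟩

/-- Optimality at height `h` does not hold during the phase. Instead, `Post c` says that the entry
reached through `c` is at least as heavy as every chain that ends with `c`. It persists because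
stored totals never decrease, and at the end it gives optimality because every chain of height `h`
ends with some valid block of that height. -/
theorem relax_phase {h : ℕ} (hM : 1 ≤ M) (hN : 1 ≤ N) (hp : Params M N L n s)
    (hi : s.var Var.i = h) (h₁ : 1 ≤ h) (hn : h < n)
    (hW : ∀ c : Code, c.Valid M N n → s.arr Arr.bundleSize c.key = W c)
    (hP : ∀ h', 1 ≤ h' → h' ≤ h → Partial M N n h' s)
    (hO : ∀ h', 1 ≤ h' → h' < h → Optimal M N n W h' s)
    (hZ : ∀ h', h < h' → ∀ x y, table s h' x y = []) :
    Ends (forEachBlock relax) s (M * N * (200 + 4 * (300 + 200 * n))) fun s' =>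
      (∀ h', 1 ≤ h' → h' ≤ h → Partial M N n h' s') ∧
      (∀ h', 1 ≤ h' → h' ≤ h → Optimal M N n W h' s') ∧
      ∀ h', h < h' → ∀ x y, table s' h' x y = [] := by
  let I : State → Prop := fun s =>
    (∀ c : Code, c.Valid M N n → s.arr Arr.bundleSize c.key = W c) ∧
    (∀ h', 1 ≤ h' → h' ≤ h → Partial M N n h' s) ∧
    (∀ h', 1 ≤ h' → h' < h → Optimal M N n W h' s) ∧
    ∀ h', h < h' → ∀ x y, table s h' x y = []
  let Post : Code → State → Prop := fun c s => c.h = h → c.Valid M N n → ∀ q, Precedes M N n q c →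
    (q.map W).sum + W c ≤ ((table s h (c.frX n) c.bot).map W).sum
  refine Ends.mono (forEachBlock_spec (by decide) I Post ?_ ?_ hp hi h₁ hn.le ⟨hW, hP, hO, hZ⟩
    (T := 300 + 200 * n) ?_) (forEachBlock_time hM hN _) ?_
  · rintro s s' hd ⟨i1, i2, i3, i4⟩
    simp only [I, Partial, Optimal, table_congr hd.arr, hd.arr]
    exact ⟨i1, i2, i3, i4⟩
  · intro c s s' hd hc
    simp only [Post, table_congr hd.arr]
    exact hc
  · rintro c s hv rfl hp' hpl ⟨i1, i2, i3, i4⟩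
    obtain ⟨⟨q, hq⟩, hopt⟩ := previous_spec (s := s) (W := W) hv
      (fun hc => i2 _ (by have := hv.one_le; omega) (by omega))
      (fun hc => i3 _ (by have := hv.one_le; omega) (by omega))
    have hle := hv.le
    have hnew := hq.chain hv
    rw [List.append_assoc] at hnew
    obtain ⟨q', hold⟩ := i2 c.h hv.one_le le_rfl _ _ hv.inGrid_from
    have tnew : total s (previous n s c ++ [c]) = ((previous n s c).map W).sum + W c := by
      rw [total_eq i1 (fun d hd => hnew.valid d (by simp only [List.mem_append] at hd ⊢; tauto))]
      simp
    have told := total_eq i1 (l := table s c.h (c.frX n) c.bot)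
      (fun d hd => hold.valid d (by simp [hd]))
    -- Both lists are final segments of chains, hence have at most `n` entries.
    refine Ends.mono (relax_spec hpl (k := n) ?_ ?_) le_rfl ?_
    · have := hq.length hv
      rw [List.length_append] at this
      omega
    · have := hold.spec.1
      rw [List.length_append] at this
      omega
    intro s' ht f
    rw [told, tnew] at ht
    have hother : ∀ h' x y, h' ≠ c.h → table s' h' x y = table s h' x y := fun h' x y hne => by
      rw [ht, if_neg fun hh => hne hh.1.1]
    have hmono : ∀ x y, ((table s c.h x y).map W).sum ≤ ((table s' c.h x y).map W).sum := by
      intro x y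
      rw [ht]
      split
      · rename_i hh
        obtain ⟨⟨-, rfl, rfl⟩, hlt⟩ := hh
        simpa using hlt.le
      · exact le_rfl
    refine ⟨⟨fun c hc => by rw [f.arr _ rfl, i1 c hc], ?_, ?_, ?_⟩, ?_, ?_⟩
    · intro h' a1 a2 x y hg
      by_cases hh : h' = c.h
      · subst hh
        rw [ht]
        split
        · rename_i hh
          obtain ⟨⟨-, rfl, rfl⟩, hlt⟩ := hh
          exact ⟨q, hnew⟩
        · exact i2 _ a1 a2 x y hg
      · rw [hother _ _ _ hh]
        exact i2 _ a1 a2 x y hg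
    · intro h' a1 a2 x y hg
      rw [hother _ _ _ a2.ne]
      exact i3 h' a1 a2 x y hg
    · intro h' a1 x y
      rw [hother _ _ _ a1.ne', i4 h' a1]
    · intro c' hc' e hv' q hq
      exact (hc' e hv' q hq).trans (hmono _ _)
    · intro _ _ q₁ hq₁
      have h1 := hopt q₁ hq₁
      rw [ht]
      split
      · simp; omega
      · rename_i hh
        simp only [and_self, true_and, not_lt] at hh
        omega
  · rintro s' ⟨⟨i1, i2, i3, i4⟩, -, i5⟩ -
    refine ⟨i2, fun h' a1 a2 x y hg q hq => ?_, i4⟩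
    rcases a2.lt_or_eq with a2 | rfl
    · exact i3 h' a1 a2 x y hg q hq
    · obtain ⟨q', c, rfl, hv, hc, rfl, rfl, hpr⟩ := hq.exists_last
      simpa using i5 c hv hc hc hv q' hpr

theorem bestList_congr {s s' : State} (h : s'.arr = s.arr)
    (h' : s'.var Var.bestLen = s.var Var.bestLen) : bestList s' = bestList s := by
  rw [bestList, bestList, h']
  exact readBlocks_congr fun _ _ _ _ => by rw [h]

/-- The argument of `relax_phase` with a single entry: a block of width one leaves an empty
rectangle, so all final blocks compete for the list `best`. The initial empty list is a final
segment of a full chain by `exists_full_chain`. -/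
theorem relaxFinal_phase (hM : 1 ≤ M) (hN : 1 ≤ N) (hp : Params M N L n s)
    (hi : s.var Var.i = n) (h₁ : 1 ≤ n) (hnM : n ≤ M) (hnN : n ≤ N)
    (hW : ∀ c : Code, c.Valid M N n → s.arr Arr.bundleSize c.key = W c)
    (hP : ∀ h', 1 ≤ h' → h' < n → Partial M N n h' s)
    (hO : ∀ h', 1 ≤ h' → h' < n → Optimal M N n W h' s)
    (hb : s.var Var.bestLen = 0) :
    Ends (forEachBlock relaxFinal) s (M * N * (200 + 4 * (300 + 200 * n))) fun s' =>
      (∃ x y q, Chain M N n n x y (q ++ bestList s')) ∧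
      ∀ x y q, Chain M N n n x y q → (q.map W).sum ≤ ((bestList s').map W).sum := by
  let I : State → Prop := fun s =>
    (∀ c : Code, c.Valid M N n → s.arr Arr.bundleSize c.key = W c) ∧
    (∀ h', 1 ≤ h' → h' < n → Partial M N n h' s) ∧
    (∀ h', 1 ≤ h' → h' < n → Optimal M N n W h' s) ∧
    ∃ x y q, Chain M N n n x y (q ++ bestList s)
  let Post : Code → State → Prop := fun c s => c.h = n → c.Valid M N n → ∀ q, Precedes M N n q c →
    (q.map W).sum + W c ≤ ((bestList s).map W).sum
  have hb₀ : bestList s = [] := by simp [bestList, hb, readBlocks]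
  refine Ends.mono (forEachBlock_spec (by decide) I Post ?_ ?_ hp hi h₁ le_rfl
    ⟨hW, hP, hO, by simpa [hb₀] using exists_full_chain h₁ hnM hnN⟩
    (T := 300 + 200 * n) ?_) (forEachBlock_time hM hN _) ?_
  · rintro s s' hd ⟨i1, i2, i3, i4⟩
    simp only [I, Partial, Optimal, table_congr hd.arr, hd.arr, bestList_congr hd.arr hd.bestLen]
    exact ⟨i1, i2, i3, i4⟩
  · intro c s s' hd hc
    simp only [Post, bestList_congr hd.arr hd.bestLen]
    exact hc
  · rintro c s hv hcn hp' hpl ⟨i1, i2, i3, x, y, q', hold⟩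
    obtain ⟨⟨q, hq⟩, hopt⟩ := previous_spec (s := s) (W := W) hv
      (fun hc => i2 _ (by have := hv.one_le; omega) (by omega))
      (fun hc => i3 _ (by have := hv.one_le; omega) (by omega))
    have hnew := hq.chain hv
    rw [List.append_assoc, hcn] at hnew
    have tnew : total s (previous n s c ++ [c]) = ((previous n s c).map W).sum + W c := by
      rw [total_eq i1 (fun d hd => hnew.valid d (by simp only [List.mem_append] at hd ⊢; tauto))]
      simp
    have told := total_eq i1 (l := bestList s) (fun d hd => hold.valid d (by simp [hd]))
    refine Ends.mono (relaxFinal_spec hpl (k := n) ?_ ?_) le_rfl ?_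
    · have := hq.length hv
      rw [List.length_append] at this
      omega
    · have := hold.spec.1
      rw [List.length_append] at this
      omega
    intro s' ht f
    rw [told, tnew] at ht
    have hmono : ((bestList s).map W).sum ≤ ((bestList s').map W).sum := by
      rw [ht]
      split
      · rename_i hlt
        simpa using hlt.le
      · exact le_rfl
    have htab : table s' = table s := by
      funext h x y
      exact table_congr_of_len (f.arr _ rfl) (by rw [f.arr _ rfl])
    refine ⟨⟨fun c hc => by rw [f.arr _ rfl, i1 c hc], ?_, ?_, ?_⟩, ?_, ?_⟩
    · simpa only [Partial, htab] using i2
    · simpa only [Optimal, htab] using i3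
    · rw [ht]
      split
      · exact ⟨_, _, _, hnew⟩
      · exact ⟨_, _, _, hold⟩
    · intro c' hc' e hv' q hq
      exact (hc' e hv' q hq).trans hmono
    · intro _ _ q₁ hq₁
      have h1 := hopt q₁ hq₁
      rw [ht]
      split
      · simp; omega
      · rename_i hh
        rw [not_lt] at hh
        omega
  · rintro s' ⟨⟨i1, i2, i3, i4⟩, -, i5⟩ -
    refine ⟨i4, fun x y q hq => ?_⟩
    obtain ⟨q', c, rfl, hv, hc, -, -, hpr⟩ := hq.exists_last
    simpa using i5 c hv hc hc hv q' hpr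

/-- The loop over the heights `1, …, n - 1`. -/
theorem mainLoop_spec (hM : 1 ≤ M) (hN : 1 ≤ N) (hnM : n ≤ M) (hp : Params M N L n s)
    (htmp : s.var Var.tmp = n - 1)
    (hW : ∀ c : Code, c.Valid M N n → s.arr Arr.bundleSize c.key = W c)
    (hZ : ∀ j, s.arr Arr.mpeLen j = 0) :
    Ends (Prog.loop Var.p Var.tmp (Prog.block [
        Prog.assign Var.i (Rhs.add Var.p 1),
        clearRectangles,
        forEachBlock relax])) s
      (1 + (n - 1) * (1 + (3 + ((10 + (1 + (M + 1) * (1 + (1 + (N + 1) * (1 + 4))))) +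
        M * N * (200 + 4 * (300 + 200 * n)))))) fun s' =>
      (∀ h', 1 ≤ h' → h' < n → Partial M N n h' s') ∧
      (∀ h', 1 ≤ h' → h' < n → Optimal M N n W h' s') := by
  refine Ends.mono (Ends.loop (b := n - 1) (fun m s' =>
    (∀ h', 1 ≤ h' → h' ≤ m → Partial M N n h' s') ∧
    (∀ h', 1 ≤ h' → h' ≤ m → Optimal M N n W h' s') ∧
    ∀ h', m < h' → ∀ x y, table s' h' x y = []) htmp
    ⟨fun _ _ _ => by omega, fun _ _ _ => by omega, fun h' _ x y => table_eq_nil (hZ _)⟩ ?_) le_rfl ?_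
  · rintro m hm s₁ f₁ ⟨i1, i2, i3⟩
    refine Ends.seq (R₁ := fun s' => s'.var Var.i = m + 1) (Ends.le (Ends.assign ?_) ?_)
      fun s₂ h₂ f₂ => ?_
    · simp [Rhs.eval, Opd.eval]
    · simp only [Rhs.time]; omega
    have hp₁ : Params M N L n s₁ := hp.of_frame f₁
    have hp₂ : Params M N L n s₂ := Params.of_frame hp₁.set f₂
    refine Ends.seq (clearRectangles_spec hp₂ h₂) fun s₃ h₃ f₃ => ?_
    have hp₃ : Params M N L n s₃ := hp₂.of_frame f₃
    have hi₃ : s₃.var Var.i = m + 1 := by rw [f₃.var _ rfl, h₂]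
    -- Clearing changes no list, since those of height `m + 1` are still empty.
    have htab : ∀ h x y, table s₃ h x y = table s₁ h x y := by
      intro h x y
      rcases h₃ h x y with e | ⟨rfl, e⟩
      · exact table_congr_of_len (by rw [f₃.arr _ rfl, f₂.arr _ rfl]; rfl)
          (by rw [e, f₂.arr _ rfl]; rfl)
      · rw [table_eq_nil e, i3 _ (by omega)]
    have hW₃ : ∀ c : Code, c.Valid M N n → s₃.arr Arr.bundleSize c.key = W c := by
      intro c hc
      rw [f₃.arr _ rfl, f₂.arr _ rfl, State.set_arr, f₁.arr _ rfl, hW c hc]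
    refine Ends.mono (relax_phase hM hN hp₃ hi₃ (by omega) (by omega) hW₃ ?_ ?_ ?_) le_rfl
      fun s' h _ => h
    · intro h' a1 a2 x y hg
      rw [htab]
      rcases a2.lt_or_eq with a2 | rfl
      · exact i1 h' a1 (by omega) x y hg
      · rw [i3 _ (by omega)]
        -- The lists of the new height are empty, and some chain ends in each rectangle.
        simpa using exists_chain hnM _ x y a1 (by omega) hg
    · intro h' a1 a2 x y hg
      rw [htab]
      exact i2 h' a1 (by omega) x y hg
    · intro h' a1 x y
      rw [htab, i3 _ (by omega)]
  · rintro s' ⟨i1, i2, -⟩ -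
    exact ⟨fun h' a1 a2 => i1 h' a1 (by omega), fun h' a1 a2 => i2 h' a1 (by omega)⟩

end

end NativeClique

namespace NativeClique

/-! ### The output -/

theorem Ends.seq_assign {v : Var} {e : Rhs} {Q : Prog} {s : State} {T : ℕ} {R : State → Prop}
    (h : Ends Q (s.set v (e.eval s)) T R) :
    Ends (Prog.seq (Prog.assign v e) Q) s ((1 + e.time) + T) R :=
  Ends.seq (R₁ := fun s' => s' = s.set v (e.eval s)) (Ends.assign rfl) (by rintro _ rfl _; exact h)

/-- The coordinates of the vertex number `q` of the ell number `p` in the maximum bundle of `c`. -/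
def vertexAt (g : List ℕ → ℕ) (L n : ℕ) (c : Code) (p q : ℕ) : List ℕ :=
  if q < c.wd n then [c.left n + q, c.y, 0, (hIndices g L n c).getD p 0]
  else [c.x, c.bot + (q - c.wd n), 1, (vIndices g L c).getD p 0]

/-- The coordinates stored for the vertex number `q` of the ell number `p` of the bundle number
`t`. -/
def outVertex (s : State) (t p q : ℕ) : List ℕ :=
  [s.arr Arr.out [t, p, q, 0], s.arr Arr.out [t, p, q, 1], s.arr Arr.out [t, p, q, 2],
    s.arr Arr.out [t, p, q, 3]]

theorem weight_le (g : List ℕ → ℕ) (L n : ℕ) (c : Code) : weight g L n c ≤ L :=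
  (min_le_left _ _).trans ((List.length_filter_le _ _).trans (by simp))

/-- Write the vertices of one ell. -/
def writeEll : Prog := Prog.block [
  Prog.assign Var.kH (Rhs.read Arr.bundleH [Var.i, Var.x, Var.y, Var.sx, Var.sy, Var.p]),
  Prog.assign Var.kV (Rhs.read Arr.bundleV [Var.i, Var.x, Var.y, Var.sx, Var.sy, Var.p]),
  Prog.loop Var.q Var.w (Prog.block [
    Prog.assign Var.col (Rhs.add Var.xl Var.q),
    Prog.store Arr.out [Var.t, Var.p, Var.q, 0] Var.col,
    Prog.store Arr.out [Var.t, Var.p, Var.q, 1] Var.y,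
    Prog.store Arr.out [Var.t, Var.p, Var.q, 2] 0,
    Prog.store Arr.out [Var.t, Var.p, Var.q, 3] Var.kH]),
  Prog.loop Var.q Var.i (Prog.block [
    Prog.assign Var.col (Rhs.add Var.yl Var.q),
    Prog.assign Var.pos (Rhs.add Var.w Var.q),
    Prog.store Arr.out [Var.t, Var.p, Var.pos, 0] Var.x,
    Prog.store Arr.out [Var.t, Var.p, Var.pos, 1] Var.col,
    Prog.store Arr.out [Var.t, Var.p, Var.pos, 2] 1,
    Prog.store Arr.out [Var.t, Var.p, Var.pos, 3] Var.kV])]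

theorem writeEll_spec {g : List ℕ → ℕ} {L n t p : ℕ} {c : Code} {s : State} (hc : Placed n c s)
    (ht : s.var Var.t = t) (hp : s.var Var.p = p) (hb : HasBundle g L n c s)
    (hpw : p < weight g L n c) (hcn : c.h ≤ n) :
    Ends writeEll s (20 + 30 * (n + 1)) fun s' =>
      (∀ q < n + 1, outVertex s' t p q = vertexAt g L n c p q) ∧
        ∀ t' p' r, ¬ (t' = t ∧ p' = p) →
          s'.arr Arr.out (t' :: p' :: r) = s.arr Arr.out (t' :: p' :: r) := by
  have hwn : c.wd n + c.h = n + 1 := by simp only [Code.wd]; omega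
  refine Ends.le (T₁ := 8 + (8 + ((1 + c.wd n * (1 + 23)) + (1 + c.h * (1 + 25)))))
    (Ends.seq (R₁ := fun s' => s'.var Var.kH = (hIndices g L n c).getD p 0)
      (Ends.assign ?_) fun s₁ h₁ f₁ => Ends.seq
      (R₁ := fun s' => s'.var Var.kV = (vIndices g L c).getD p 0)
      (Ends.assign ?_) fun s₂ h₂ f₂ => Ends.seq
      (R₁ := fun s' => (∀ t' p' r, ¬ (t' = t ∧ p' = p) →
          s'.arr Arr.out (t' :: p' :: r) = s.arr Arr.out (t' :: p' :: r)) ∧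
          ∀ q < c.wd n, outVertex s' t p q = vertexAt g L n c p q)
      (Ends.loop (b := c.wd n) (T := 23) (fun m s' => (∀ t' p' r, ¬ (t' = t ∧ p' = p) →
          s'.arr Arr.out (t' :: p' :: r) = s.arr Arr.out (t' :: p' :: r)) ∧
          ∀ q < m, outVertex s' t p q = vertexAt g L n c p q) ?_ ?_ fun m hm s₃ f₃ h₃ => ?_)
      fun s₄ h₄ f₄ => Ends.mono (Ends.loop (b := c.h) (T := 25)
      (fun m s' => (∀ t' p' r, ¬ (t' = t ∧ p' = p) →
          s'.arr Arr.out (t' :: p' :: r) = s.arr Arr.out (t' :: p' :: r)) ∧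
          ∀ q < c.wd n + m, outVertex s' t p q = vertexAt g L n c p q) ?_ ?_
          fun m hm s₅ f₅ h₅ => ?_) le_rfl ?_) (by omega)
  · have := hb.horizontal p (lt_of_lt_of_le hpw (min_le_left _ _))
    simpa [Rhs.eval, Opd.eval, hc.i, hc.x, hc.y, hc.sx, hc.sy, hp, Code.key] using this
  · have := hb.vertical p (lt_of_lt_of_le hpw (min_le_right _ _))
    have hc₁ := hc.of_frame f₁
    simpa [Rhs.eval, Opd.eval, hc₁.i, hc₁.x, hc₁.y, hc₁.sx, hc₁.sy, f₁.var Var.p rfl, hp, Code.key,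
      f₁.arr Arr.bundleV rfl] using this
  · simpa [Opd.eval] using ((hc.of_frame f₁).of_frame f₂ :).w
  · refine ⟨fun t' p' r _ => ?_, by simp⟩
    rw [f₂.arr _ rfl, f₁.arr _ rfl]
  · have hc₃ : Placed n c s₃ := ((hc.of_frame f₁).of_frame f₂).of_frame f₃
    have ht₃ : s₃.var Var.t = t := by rw [f₃.var _ rfl, f₂.var _ rfl, f₁.var _ rfl, ht]
    have hp₃ : s₃.var Var.p = p := by rw [f₃.var _ rfl, f₂.var _ rfl, f₁.var _ rfl, hp]
    have hk₃ : s₃.var Var.kH = (hIndices g L n c).getD p 0 := by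
      rw [f₃.var _ rfl, f₂.var _ rfl, h₁]
    refine Ends.le (Ends.of_loopFree ?_) (by decide)
    refine ⟨fun t' p' r hne => ?_, fun q hq => ?_⟩
    · rw [← h₃.1 t' p' r hne]
      have h1 : ∀ r' : List ℕ, t' :: p' :: r ≠ t :: p :: r' := by
        intro r' e
        simp only [List.cons.injEq] at e
        exact hne ⟨e.1, e.2.1⟩
      simp [Prog.block, Prog.exec, Rhs.eval, Opd.eval, ht₃, hp₃, h1]
    · rcases Nat.lt_succ_iff_lt_or_eq.1 hq with hq | rfl
      · rw [← h₃.2 q hq]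
        have h1 : q ≠ m := hq.ne
        simp [outVertex, Prog.block, Prog.exec, Rhs.eval, Opd.eval, ht₃, hp₃, h1]
      · simp [outVertex, vertexAt, hm, Prog.block, Prog.exec, Rhs.eval, Opd.eval, ht₃, hp₃, hk₃,
          hc₃.xl, hc₃.y]
  · have hc₄ : Placed n c s₄ := ((hc.of_frame f₁).of_frame f₂).of_frame f₄
    simpa [Opd.eval] using hc₄.i
  · exact h₄
  · have hc₄ : Placed n c s₄ := ((hc.of_frame f₁).of_frame f₂).of_frame f₄
    have hc₅ : Placed n c s₅ := hc₄.of_frame f₅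
    have ht₅ : s₅.var Var.t = t := by
      rw [f₅.var _ rfl, f₄.var _ rfl, f₂.var _ rfl, f₁.var _ rfl, ht]
    have hp₅ : s₅.var Var.p = p := by
      rw [f₅.var _ rfl, f₄.var _ rfl, f₂.var _ rfl, f₁.var _ rfl, hp]
    have hk₅ : s₅.var Var.kV = (vIndices g L c).getD p 0 := by
      rw [f₅.var _ rfl, f₄.var _ rfl, h₂]
    refine Ends.le (Ends.of_loopFree ?_) (by decide)
    refine ⟨fun t' p' r hne => ?_, fun q hq => ?_⟩
    · rw [← h₅.1 t' p' r hne]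
      have h1 : ∀ r' : List ℕ, t' :: p' :: r ≠ t :: p :: r' := by
        intro r' e
        simp only [List.cons.injEq] at e
        exact hne ⟨e.1, e.2.1⟩
      simp [Prog.block, Prog.exec, Rhs.eval, Opd.eval, ht₅, hp₅, h1]
    · rcases Nat.lt_succ_iff_lt_or_eq.1 hq with hq | rfl
      · rw [← h₅.2 q hq]
        have h1 : q ≠ c.wd n + m := hq.ne
        simp [outVertex, Prog.block, Prog.exec, Rhs.eval, Opd.eval, ht₅, hp₅, hc₅.w, h1]
      · simp [outVertex, vertexAt, Prog.block, Prog.exec, Rhs.eval, Opd.eval, ht₅, hp₅, hk₅,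
          hc₅.yl, hc₅.x, hc₅.w]
  · rintro s' ⟨k1, k2⟩ -
    exact ⟨fun q hq => k2 q (by omega), k1⟩

/-- The maximum bundle of `c` is written out as the bundle number `t`. -/
def Written (g : List ℕ → ℕ) (L n : ℕ) (c : Code) (t : ℕ) (s : State) : Prop :=
  s.arr Arr.outSize [t] = weight g L n c ∧
    ∀ p < weight g L n c, ∀ q < n + 1, outVertex s t p q = vertexAt g L n c p q

theorem writeOutput_spec {M N L n : ℕ} {g : List ℕ → ℕ} {s : State} (hp : Params M N L n s)
    (hv : ∀ c ∈ bestList s, c.Valid M N n)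
    (hb : ∀ c : Code, c.Valid M N n → HasBundle g L n c s) :
    Ends writeOutput s (1 + s.var Var.bestLen * (1 + (100 + L * (21 + 30 * (n + 1))))) fun s' =>
      ∀ t < s.var Var.bestLen, Written g L n (readBlock s Arr.best [] t) t s' := by
  have hv' : ∀ t < s.var Var.bestLen, (readBlock s Arr.best [] t).Valid M N n := fun t ht =>
    hv _ (List.mem_map.2 ⟨t, List.mem_range.2 ht, rfl⟩)
  refine Ends.mono (Ends.loop_forall (fun _ => True)
    (fun t => Written g L n (readBlock s Arr.best [] t) t) (fun m t => t = m) rfl trivial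
    fun t ht s₁ f₁ _ => ?_) le_rfl ?_
  · have hvc := hv' t ht
    set c := readBlock s Arr.best [] t with hcdef
    have hp₁ : Params M N L n s₁ := hp.of_frame f₁
    have hbest : s₁.arr Arr.best = s.arr Arr.best := f₁.arr _ rfl
    have hcn := hvc.le
    have hwL := weight_le g L n c
    -- A pass has to write bundle `t` correctly and to leave alone the output addresses of the
    -- others.
    have loc : ∀ s' : State, (∀ t', t' ≠ t → s'.arr Arr.outSize [t'] = s₁.arr Arr.outSize [t'] ∧
        ∀ p' r, s'.arr Arr.out (t' :: p' :: r) = s₁.arr Arr.out (t' :: p' :: r)) →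
        Written g L n c t s' → True ∧
        (∀ t', Written g L n (readBlock s Arr.best [] t') t' s₁ →
          Written g L n (readBlock s Arr.best [] t') t' s') ∧
        ∀ t', t' = t → Written g L n (readBlock s Arr.best [] t') t' s' := by
      intro s' h1 h2
      have own : ∀ t', t' = t → Written g L n (readBlock s Arr.best [] t') t' s' := by
        rintro t' rfl; exact h2
      refine ⟨trivial, fun t' hw => ?_, own⟩
      by_cases htt : t' = t
      · exact own t' htt
      · refine ⟨by rw [(h1 t' htt).1, hw.1], fun p hp q hq => ?_⟩
        rw [← hw.2 p hp q hq]
        simp only [outVertex, (h1 t' htt).2]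
    refine Ends.le (T₁ := 20 + (2 + (2 + (2 + (2 + (2 + (2 + (2 + (40 + (7 + (2 +
      (1 + weight g L n c * (1 + (20 + 30 * (n + 1))))))))))))))) ?_ ?_
    swap
    · have : weight g L n c * (1 + (20 + 30 * (n + 1))) ≤ L * (21 + 30 * (n + 1)) := by
        calc _ ≤ L * (1 + (20 + 30 * (n + 1))) := Nat.mul_le_mul_right _ hwL
          _ = _ := by ring
      generalize weight g L n c * (1 + (20 + 30 * (n + 1))) = a at *
      generalize L * (21 + 30 * (n + 1)) = b at *
      omega
    have hT : ∀ s', s' = s₁.set Var.t t → Ends (loadBlock Arr.best []) s' 20 fun s' =>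
        s'.var Var.bht = c.h ∧ s'.var Var.bcx = c.x ∧ s'.var Var.bcy = c.y ∧
          s'.var Var.bsx = c.sx ∧ s'.var Var.bsy = c.sy := by
      rintro _ rfl
      refine Ends.le (Ends.of_loopFree ?_) (by decide)
      simp [loadBlock, Prog.block, Prog.exec, Rhs.eval, Opd.eval, hbest, hcdef, readBlock]
    refine Ends.seq (hT _ rfl) ?_
    rintro s₂ ⟨e1, e2, e3, e4, e5⟩ f₂
    have hp₂ : Params M N L n s₂ := Params.of_frame hp₁.set f₂
    -- These assignments make `c` the current block; the last two compute its width.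
    iterate 7 refine Ends.seq_assign ?_
    generalize hs₃ : State.set _ Var.w _ = s₃
    have hcur : Current n c s₃ := by
      subst hs₃
      constructor <;> simp [Rhs.eval, Opd.eval, e1, e2, e3, e4, e5, hp₂.rn, Code.wd]
    have hp₃ : Params M N L n s₃ := by
      subst hs₃
      exact hp₂.set.set.set.set.set.set.set
    have ht₃ : s₃.var Var.t = t := by
      subst hs₃
      simp only [State.set_var, reduceCtorEq, if_false]
      rw [f₂.var _ rfl]; simp
    have ha₃ : s₃.arr = s₁.arr := by
      subst hs₃
      simp only [State.set_arr]
      funext A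
      rw [f₂.arr A (by cases A <;> rfl)]; rfl
    clear hs₃
    refine Ends.seq (geometry_spec hp₃ hcur) ?_
    rintro s₄ ⟨x1, x2, -⟩ f₄
    have hpl : Placed n c s₄ := ⟨⟨(f₄.var _ rfl).trans hcur.i, (f₄.var _ rfl).trans hcur.w,
      (f₄.var _ rfl).trans hcur.x, (f₄.var _ rfl).trans hcur.y, (f₄.var _ rfl).trans hcur.sx,
      (f₄.var _ rfl).trans hcur.sy⟩, x1, x2⟩
    have ha₄ : s₄.arr = s₁.arr := by
      funext A
      rw [f₄.arr A (by cases A <;> rfl), ha₃]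
    have ht₄ : s₄.var Var.t = t := by rw [f₄.var _ rfl, ht₃]
    have hb₁ : HasBundle g L n c s₁ :=
      (hb c hvc).congr (f₁.arr _ rfl) (f₁.arr _ rfl) (f₁.arr _ rfl)
    refine Ends.seq (R₁ := fun s' => s'.var Var.sz = weight g L n c) (Ends.assign ?_)
      fun s₅ h₅ f₅ => ?_
    · have := hb₁.size
      simpa [Rhs.eval, Opd.eval, hpl.i, hpl.x, hpl.y, hpl.sx, hpl.sy, ha₄, Code.key] using this
    have hpl₅ := hpl.of_frame f₅
    refine Ends.seq (R₁ := fun s' => ∀ j, s'.arr Arr.outSize j =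
        if j = [t] then weight g L n c else s₁.arr Arr.outSize j) (Ends.store fun j => ?_)
        fun s₆ h₆ f₆ => ?_
    · simp only [State.put_arr, true_and, Opd.eval, List.map_cons, List.map_nil, h₅,
        f₅.var Var.t rfl, ht₄, f₅.arr Arr.outSize rfl, ha₄]
    have hpl₆ := hpl₅.of_frame f₆
    have ht₆ : s₆.var Var.t = t := by rw [f₆.var _ rfl, f₅.var _ rfl, ht₄]
    have hb₆ : HasBundle g L n c s₆ := by
      refine hb₁.congr ?_ ?_ ?_ <;> rw [f₆.arr _ rfl, f₅.arr _ rfl, ha₄]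
    refine Ends.mono (Ends.loop_forall
      (fun s' => ∀ t', t' ≠ t → ∀ p' r, s'.arr Arr.out (t' :: p' :: r) = s₁.arr Arr.out (t' :: p' :: r))
      (fun p s' => ∀ q < n + 1, outVertex s' t p q = vertexAt g L n c p q) (fun m p => p = m)
      (P := writeEll) (v := Var.p) (a := Var.sz) (s := s₆) (b := weight g L n c)
      (by simp [Opd.eval, f₆.var Var.sz rfl, h₅])
      (fun t' _ p' r => by rw [f₆.arr _ rfl, f₅.arr _ rfl, ha₄]) fun p hpp s₇ f₇ i₇ => ?_) le_rfl ?_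
    · have hpl₇ : Placed n c s₇ := hpl₆.of_frame f₇
      have ht₇ : s₇.var Var.t = t := by rw [f₇.var _ rfl, ht₆]
      have hb₇ : HasBundle g L n c s₇ := hb₆.congr (f₇.arr _ rfl) (f₇.arr _ rfl) (f₇.arr _ rfl)
      have hpl₈ : Placed n c (s₇.set Var.p p) := ⟨⟨hpl₇.i, hpl₇.w, hpl₇.x, hpl₇.y, hpl₇.sx,
        hpl₇.sy⟩, hpl₇.xl, hpl₇.yl⟩
      refine Ends.mono (writeEll_spec (t := t) (p := p) hpl₈ (by simpa using ht₇) (by simp)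
        (hb₇.congr rfl rfl rfl) hpp hcn) le_rfl ?_
      rintro s' ⟨k1, k2⟩ -
      have own : ∀ p', p' = p → ∀ q < n + 1, outVertex s' t p' q = vertexAt g L n c p' q := by
        rintro p' rfl; exact k1
      refine ⟨fun t' hne p' r => ?_, fun p' hp' q hq => ?_, own⟩
      · rw [← i₇ t' hne p' r]
        exact k2 t' p' r fun e => hne e.1
      · by_cases hpe : p' = p
        · exact own p' hpe q hq
        · rw [← hp' q hq]
          simp only [outVertex]
          rw [k2 _ _ _ fun e => hpe e.2, k2 _ _ _ fun e => hpe e.2, k2 _ _ _ fun e => hpe e.2,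
            k2 _ _ _ fun e => hpe e.2]
          rfl
    · rintro s' ⟨i1, -, i3⟩ f
      refine loc s' (fun t' hne => ⟨?_, i1 t' hne⟩) ⟨?_, fun p hp => i3 p hp p rfl⟩
      · rw [f.arr _ rfl, h₆, if_neg (by simpa using hne)]
      · rw [f.arr _ rfl, h₆, if_pos rfl]
  · rintro s' ⟨-, -, k⟩ - t ht
    exact k t ht t rfl

end NativeClique

namespace NativeClique

/-! ### Ell blocks and their codes -/

theorem Vertex.ext_iff {M N L : ℕ} {u v : Vertex M N L} :
    u = v ↔ u.cell.1 = v.cell.1 ∧ u.cell.2 = v.cell.2 ∧ u.side = v.side ∧ u.idx = v.idx := by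
  simp [Prod.ext_iff, Vertex.cell, Vertex.side, Vertex.idx]

theorem Vertex.coords_injective {M N L : ℕ} :
    Function.Injective (Vertex.coords : Vertex M N L → List ℕ) := by
  intro u v h
  simp only [Vertex.coords, List.cons.injEq, and_true] at h
  exact Vertex.ext_iff.2 ⟨Fin.ext h.1, Fin.ext h.2.1, Fin.ext h.2.2.1, Fin.ext h.2.2.2⟩

instance (n : ℕ) (c : Code) (t : ℕ) : Decidable (c.InRow n t) :=
  inferInstanceAs (Decidable (_ ∧ _))

instance (c : Code) (t : ℕ) : Decidable (c.InCol t) := inferInstanceAs (Decidable (_ ∧ _))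

/-- The unit cells of the block. -/
def Code.cells (M N n : ℕ) (c : Code) : Finset (Cell M N) :=
  Finset.univ.filter fun z =>
    (z.2.val = c.y ∧ c.InRow n z.1.val) ∨ (z.1.val = c.x ∧ c.InCol z.2.val)

/-- The ell block represented by the code. -/
def Code.block (M N n : ℕ) [NeZero M] [NeZero N] (c : Code) : Block M N :=
  (c.cells M N n, (Fin.ofNat M c.x, Fin.ofNat N c.y))

/-- The ell in the block `c` that consists of the horizontal wire number `k` and the vertical wire
number `k'`. -/
def Code.ell (M N L n : ℕ) (c : Code) (k k' : ℕ) : Finset (Vertex M N L) :=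
  Finset.univ.filter fun v =>
    (v.side = 0 ∧ v.idx.val = k ∧ v.cell.2.val = c.y ∧ c.InRow n v.cell.1.val) ∨
    (v.side = 1 ∧ v.idx.val = k' ∧ v.cell.1.val = c.x ∧ c.InCol v.cell.2.val)

section

variable {M N L n : ℕ} {c c' : Code}

@[simp] theorem Code.mem_cells {z : Cell M N} : z ∈ c.cells M N n ↔
    (z.2.val = c.y ∧ c.InRow n z.1.val) ∨ (z.1.val = c.x ∧ c.InCol z.2.val) := by
  simp [Code.cells]

@[simp] theorem Code.mem_ell {k k' : ℕ} {v : Vertex M N L} : v ∈ c.ell M N L n k k' ↔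
    (v.side = 0 ∧ v.idx.val = k ∧ v.cell.2.val = c.y ∧ c.InRow n v.cell.1.val) ∨
    (v.side = 1 ∧ v.idx.val = k' ∧ v.cell.1.val = c.x ∧ c.InCol v.cell.2.val) := by
  simp [Code.ell]

theorem Code.Valid.inRow_lt (hv : c.Valid M N n) {t : ℕ} (ht : c.InRow n t) : t < M :=
  lt_of_lt_of_le ht.2 hv.fits.2.2.1

theorem Code.Valid.inCol_lt (hv : c.Valid M N n) {t : ℕ} (ht : c.InCol t) : t < N :=
  lt_of_lt_of_le ht.2 hv.fits.2.2.2

/-- The row contributes `w` cells, and the column contributes `h - 1` further ones, because the two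
share only the corner. -/
theorem card_cross {x y l w m h : ℕ} (hx : l ≤ x ∧ x < l + w) (hy : m ≤ y ∧ y < m + h)
    (hM : l + w ≤ M) (hN : m + h ≤ N) :
    (Finset.univ.filter fun z : Cell M N =>
      (z.2.val = y ∧ (l ≤ z.1.val ∧ z.1.val < l + w)) ∨
      (z.1.val = x ∧ (m ≤ z.2.val ∧ z.2.val < m + h))).card = w + h - 1 := by
  have h1 : (Finset.univ.filter fun z : Cell M N =>
      z.2.val = y ∧ (l ≤ z.1.val ∧ z.1.val < l + w)).card = w := by
    have : (Finset.univ.filter fun z : Cell M N =>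
      z.2.val = y ∧ (l ≤ z.1.val ∧ z.1.val < l + w)).image (fun z => z.1.val) =
        Finset.Ico l (l + w) := by
      ext t
      simp only [Finset.mem_image, Finset.mem_filter, Finset.mem_univ, true_and, Finset.mem_Ico]
      constructor
      · rintro ⟨z, ⟨-, h⟩, rfl⟩; exact h
      · intro h
        exact ⟨(⟨t, by omega⟩, ⟨y, by omega⟩), ⟨rfl, h⟩, rfl⟩
    rw [← Finset.card_image_of_injOn (f := fun z : Cell M N => z.1.val), this]
    · simp
    · intro u hu v hv e
      simp only [Finset.coe_filter, Finset.mem_univ, true_and, Set.mem_ofPred_eq] at hu hv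
      exact Prod.ext (Fin.ext e) (Fin.ext (hu.1.trans hv.1.symm))
  have h2 : (Finset.univ.filter fun z : Cell M N =>
      z.1.val = x ∧ (m ≤ z.2.val ∧ z.2.val < m + h) ∧ z.2.val ≠ y).card = h - 1 := by
    have : (Finset.univ.filter fun z : Cell M N =>
      z.1.val = x ∧ (m ≤ z.2.val ∧ z.2.val < m + h) ∧ z.2.val ≠ y).image (fun z => z.2.val) =
        (Finset.Ico m (m + h)).erase y := by
      ext t
      simp only [Finset.mem_image, Finset.mem_filter, Finset.mem_univ, true_and, Finset.mem_Ico,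
        Finset.mem_erase]
      constructor
      · rintro ⟨z, ⟨-, h⟩, rfl⟩; exact ⟨h.2, h.1⟩
      · intro h
        exact ⟨(⟨x, by omega⟩, ⟨t, by omega⟩), ⟨rfl, h.2, h.1⟩, rfl⟩
    rw [← Finset.card_image_of_injOn (f := fun z : Cell M N => z.2.val), this,
      Finset.card_erase_of_mem (Finset.mem_Ico.2 hy)]
    · simp
    · intro u hu v hv e
      simp only [Finset.coe_filter, Finset.mem_univ, true_and, Set.mem_ofPred_eq] at hu hv
      exact Prod.ext (Fin.ext (hu.1.trans hv.1.symm)) (Fin.ext e)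
  have : w + h - 1 = w + (h - 1) := by omega
  rw [this, ← h1, ← h2, ← Finset.card_union_of_disjoint]
  · congr 1
    ext z
    simp only [Finset.mem_union, Finset.mem_filter, Finset.mem_univ, true_and]
    omega
  · rw [Finset.disjoint_left]
    intro z hz hz'
    simp only [Finset.mem_filter, Finset.mem_univ, true_and] at hz hz'
    exact hz'.2.2 hz.1

theorem Code.Valid.card_cells (hv : c.Valid M N n) : (c.cells M N n).card = n := by
  have := card_cross hv.inRow hv.inCol hv.fits.2.2.1 hv.fits.2.2.2
  have h1 := hv.one_le
  have h2 := hv.le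
  have e : c.wd n + c.h - 1 = n := by simp only [Code.wd]; omega
  rw [e] at this
  exact this

theorem Code.Valid.row_cell (hv : c.Valid M N n) {z : Cell M N} (hz : z.2.val = c.y) :
    z ∈ c.cells M N n ↔ c.InRow n z.1.val := by
  rw [Code.mem_cells]
  constructor
  · rintro (h | h)
    · exact h.2
    · rw [h.1]; exact hv.inRow
  · exact fun h => Or.inl ⟨hz, h⟩

theorem Code.Valid.col_cell (hv : c.Valid M N n) {z : Cell M N} (hz : z.1.val = c.x) :
    z ∈ c.cells M N n ↔ c.InCol z.2.val := by
  rw [Code.mem_cells]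
  constructor
  · rintro (h | h)
    · rw [h.1]; exact hv.inCol
    · exact h.2
  · exact fun h => Or.inr ⟨hz, h⟩

variable [NeZero M] [NeZero N]

theorem Code.Valid.block_fst (hv : c.Valid M N n) : (c.block M N n).2.1.val = c.x :=
  Nat.mod_eq_of_lt hv.x_lt

theorem Code.Valid.block_snd (hv : c.Valid M N n) : (c.block M N n).2.2.val = c.y :=
  Nat.mod_eq_of_lt hv.y_lt

/-- The corner and the cells determine both intervals, hence the height and the two first cells. The
orientation bits follow, because `Valid` prescribes the bit `0` for wires of length one, the only
ambiguous case. -/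
theorem Code.Valid.block_injective (hv : c.Valid M N n) (hv' : c'.Valid M N n)
    (h : c.block M N n = c'.block M N n) : c = c' := by
  have hx : c.x = c'.x := by rw [← hv.block_fst, h, hv'.block_fst]
  have hy : c.y = c'.y := by rw [← hv.block_snd, h, hv'.block_snd]
  have hcells : c.cells M N n = c'.cells M N n := congrArg Prod.fst h
  have hrow : ∀ t, c.InRow n t ↔ c'.InRow n t := by
    intro t
    by_cases ht : t < M
    · rw [← hv.row_cell (z := (⟨t, ht⟩, ⟨c.y, hv.y_lt⟩)) rfl, hcells, hv'.row_cell hy]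
    · exact iff_of_false (fun h => ht (hv.inRow_lt h)) fun h => ht (hv'.inRow_lt h)
  have hcol : ∀ t, c.InCol t ↔ c'.InCol t := by
    intro t
    by_cases ht : t < N
    · rw [← hv.col_cell (z := (⟨c.x, hv.x_lt⟩, ⟨t, ht⟩)) rfl, hcells, hv'.col_cell hx]
    · exact iff_of_false (fun h => ht (hv.inCol_lt h)) fun h => ht (hv'.inCol_lt h)
  have r1 := hrow (c.left n)
  have r2 := hrow (c.left n + c.wd n - 1)
  have r3 := hrow (c'.left n)
  have r4 := hrow (c'.left n + c'.wd n - 1)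
  have s1 := hcol c.bot
  have s3 := hcol c'.bot
  have t1 := hv.inRow
  have t2 := hv'.inRow
  have u1 := hv.inCol
  have u2 := hv'.inCol
  have v1 := hv.le
  have v2 := hv'.le
  have w1 := hv.sx_lt
  have w2 := hv'.sx_lt
  have w3 := hv.sy_lt
  have w4 := hv'.sy_lt
  unfold Code.InRow at r1 r2 r3 r4 t1 t2
  unfold Code.InCol at s1 s3 u1 u2
  have e1 : c.left n = c'.left n := by omega
  have e2 : c.wd n = c'.wd n := by omega
  have e3 : c.bot = c'.bot := by omega
  have e4 : c.h = c'.h := by simp only [Code.wd] at e2; omega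
  have e5 : c.sx = c'.sx := by
    rw [e2] at w1
    unfold Code.left at e1
    have f1 := hv.fits.1
    have f2 := hv'.fits.1
    split_ifs at e1 w1 w2 <;> omega
  have e6 : c.sy = c'.sy := by
    rw [e4] at w3
    unfold Code.bot at e3
    have f1 := hv.fits.2.1
    have f2 := hv'.fits.2.1
    split_ifs at e3 w3 w4 <;> omega
  exact Code.ext e4 hx hy e5 e6

theorem Code.Valid.hasBlock_ell (hv : c.Valid M N n) {k k' : ℕ} (hk : k < L) (hk' : k' < L) :
    HasBlock (c.ell M N L n k k') (c.block M N n) := by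
  have hr := hv.inRow
  have hc := hv.inCol
  have hM := hv.fits.2.2.1
  have hN := hv.fits.2.2.2
  have hfst := hv.block_fst
  have hsnd := hv.block_snd
  have hx := hv.x_lt
  have hy := hv.y_lt
  -- The corner is an end of both wires, as the definition of an ell demands; the bits decide which
  -- end.
  have hrow : c.left n = c.x ∨ c.left n + c.wd n = c.x + 1 := by
    have := hv.fits.1
    simp only [Code.left] at *
    split_ifs at * <;> omega
  have hcol : c.bot = c.y ∨ c.bot + c.h = c.y + 1 := by
    have := hv.fits.2.1
    simp only [Code.bot] at *
    split_ifs at * <;> omega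
  constructor
  · refine ⟨Finset.univ.filter fun v =>
        v.side = 0 ∧ v.idx.val = k ∧ v.cell.2.val = c.y ∧ c.InRow n v.cell.1.val,
      Finset.univ.filter fun v =>
        v.side = 1 ∧ v.idx.val = k' ∧ v.cell.1.val = c.x ∧ c.InCol v.cell.2.val,
      (⟨c.left n, hv.inRow_lt ⟨le_rfl, by unfold Code.InRow at hr; omega⟩⟩, ⟨c.y, hy⟩, 0, ⟨k, hk⟩),
      (⟨c.left n + c.wd n - 1, by unfold Code.InRow at hr; omega⟩, ⟨c.y, hy⟩, 0, ⟨k, hk⟩),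
      (⟨c.x, hx⟩, ⟨c.bot, hv.inCol_lt ⟨le_rfl, by unfold Code.InCol at hc; omega⟩⟩, 1, ⟨k', hk'⟩),
      (⟨c.x, hx⟩, ⟨c.bot + c.h - 1, by unfold Code.InCol at hc; omega⟩, 1, ⟨k', hk'⟩),
      ⟨rfl, rfl, rfl, rfl, ?_, ?_⟩, ⟨rfl, rfl, rfl, rfl, ?_, ?_⟩, ?_,
      (⟨c.x, hx⟩, ⟨c.y, hy⟩, 0, ⟨k, hk⟩), (⟨c.x, hx⟩, ⟨c.y, hy⟩, 1, ⟨k', hk'⟩), ?_, ?_, ?_, ?_, ?_⟩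
    · unfold Code.InRow at hr
      simp only [Vertex.cell, Fin.le_def]
      omega
    · intro v
      unfold Code.InRow at hr
      simp only [Finset.mem_filter, Finset.mem_univ, true_and, Vertex.idx, Vertex.cell, Fin.ext_iff,
        Fin.le_def, Code.InRow]
      constructor
      · rintro ⟨h1, h2, h3, h4, h5⟩; exact ⟨h1, h2, h3, h4, by omega⟩
      · rintro ⟨h1, h2, h3, h4, h5⟩; exact ⟨h1, h2, h3, h4, by omega⟩
    · unfold Code.InCol at hc
      simp only [Vertex.cell, Fin.le_def]
      omega
    · intro v
      unfold Code.InCol at hc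
      simp only [Finset.mem_filter, Finset.mem_univ, true_and, Vertex.idx, Vertex.cell, Fin.ext_iff,
        Fin.le_def, Code.InCol]
      constructor
      · rintro ⟨h1, h2, h3, h4, h5⟩; exact ⟨h1, h2, h3, h4, by omega⟩
      · rintro ⟨h1, h2, h3, h4, h5⟩; exact ⟨h1, h2, h3, h4, by omega⟩
    · ext v
      simp
    · unfold Code.InRow at hr
      rcases hrow with e | e
      · left; simp [e]
      · right; simp [Prod.ext_iff, Fin.ext_iff]; omega
    · unfold Code.InCol at hc
      rcases hcol with e | e
      · left; simp [e]
      · right; simp [Prod.ext_iff, Fin.ext_iff]; omega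
    · rw [chimera, SimpleGraph.fromRel_adj]
      exact ⟨by simp, Or.inl (Or.inr (Or.inr ⟨rfl, rfl, rfl⟩))⟩
    · exact Prod.ext (Fin.ext hfst.symm) (Fin.ext hsnd.symm)
    · exact Prod.ext (Fin.ext hfst.symm) (Fin.ext hsnd.symm)
  · ext z
    simp only [Finset.mem_image, Code.mem_ell, Code.block, Code.mem_cells]
    constructor
    · rintro ⟨v, h | h, rfl⟩
      · exact Or.inl h.2.2
      · exact Or.inr h.2.2
    · rintro (h | h)
      · exact ⟨(z.1, z.2, 0, ⟨k, hk⟩), Or.inl ⟨rfl, rfl, h⟩, rfl⟩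
      · exact ⟨(z.1, z.2, 1, ⟨k', hk'⟩), Or.inr ⟨rfl, rfl, h⟩, rfl⟩

/-- The code is read off from the ends of the two wires. A bit is `0` if the corner is the first
cell of the wire, which also covers wires of length one. -/
theorem HasBlock.exists_code {l : Finset (Vertex M N L)} {b : Block M N} (hl : HasBlock l b)
    (hcard : b.1.card = n) : ∃ c : Code, c.Valid M N n ∧ c.block M N n = b ∧
      ∃ k k', k < L ∧ k' < L ∧ l = c.ell M N L n k k' := by
  obtain ⟨X, x₀, y₀⟩ := b
  obtain ⟨⟨H, V, a, b, a', b', ⟨ha0, hb0, hab1, hab2, hab3, hH⟩,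
    ⟨ha0', hb0', hab1', hab2', hab3', hV⟩, rfl, p, q, hp, hq, -, hpc, hqc⟩, hX⟩ := hl
  simp only at hpc hqc hX hcard
  have hy : y₀ = a.cell.2 := by
    have : p.cell.2 = y₀ := by rw [hpc]
    rcases hp with rfl | rfl
    · exact this.symm
    · exact this.symm.trans hab2.symm
  have hx : x₀ = a'.cell.1 := by
    have : q.cell.1 = x₀ := by rw [hqc]
    rcases hq with rfl | rfl
    · exact this.symm
    · exact this.symm.trans hab2'.symm
  have hx' : x₀ = a.cell.1 ∨ x₀ = b.cell.1 := by
    have : p.cell.1 = x₀ := by rw [hpc]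
    rcases hp with rfl | rfl
    · exact Or.inl this.symm
    · exact Or.inr this.symm
  have hy' : y₀ = a'.cell.2 ∨ y₀ = b'.cell.2 := by
    have : q.cell.2 = y₀ := by rw [hqc]
    rcases hq with rfl | rfl
    · exact Or.inl this.symm
    · exact Or.inr this.symm
  obtain ⟨l, hl⟩ : ∃ l, l = a.cell.1.val := ⟨_, rfl⟩
  obtain ⟨w, hw⟩ : ∃ w, w = b.cell.1.val - a.cell.1.val + 1 := ⟨_, rfl⟩
  obtain ⟨m, hm⟩ : ∃ m, m = a'.cell.2.val := ⟨_, rfl⟩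
  obtain ⟨h, hh⟩ : ∃ h, h = b'.cell.2.val - a'.cell.2.val + 1 := ⟨_, rfl⟩
  rw [Fin.le_def] at hab3 hab3'
  have hbM := b.cell.1.isLt
  have hbN := b'.cell.2.isLt
  have hx'' : x₀.val = l ∨ x₀.val + 1 = l + w := by
    rcases hx' with e | e <;> rw [e] <;> omega
  have hy'' : y₀.val = m ∨ y₀.val + 1 = m + h := by
    rcases hy' with e | e <;> rw [e] <;> omega
  have hH' : ∀ v, v ∈ H ↔ v.side = 0 ∧ v.idx.val = a.idx.val ∧ v.cell.2.val = y₀.val ∧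
      l ≤ v.cell.1.val ∧ v.cell.1.val < l + w := by
    intro v
    rw [hH, hy, Fin.le_def, Fin.le_def, Fin.ext_iff (a := v.idx), Fin.ext_iff (a := v.cell.2)]
    refine and_congr_right fun _ => and_congr_right fun _ => and_congr_right fun _ => ?_
    omega
  have hV' : ∀ v, v ∈ V ↔ v.side = 1 ∧ v.idx.val = a'.idx.val ∧ v.cell.1.val = x₀.val ∧
      m ≤ v.cell.2.val ∧ v.cell.2.val < m + h := by
    intro v
    rw [hV, hx, Fin.le_def, Fin.le_def, Fin.ext_iff (a := v.idx), Fin.ext_iff (a := v.cell.1)]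
    refine and_congr_right fun _ => and_congr_right fun _ => and_congr_right fun _ => ?_
    omega
  have hlM : l + w ≤ M := by omega
  have hmN : m + h ≤ N := by omega
  have hw1 : 1 ≤ w := by omega
  have hh1 : 1 ≤ h := by omega
  have hX' : X = Finset.univ.filter fun z : Cell M N =>
      (z.2.val = y₀.val ∧ (l ≤ z.1.val ∧ z.1.val < l + w)) ∨
      (z.1.val = x₀.val ∧ (m ≤ z.2.val ∧ z.2.val < m + h)) := by
    rw [← hX]
    ext z
    simp only [Finset.mem_image, Finset.mem_union, Finset.mem_filter, Finset.mem_univ, true_and]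
    constructor
    · rintro ⟨v, hv | hv, rfl⟩
      · exact Or.inl ((hH' v).1 hv).2.2
      · exact Or.inr ((hV' v).1 hv).2.2
    · rintro (hz | hz)
      · exact ⟨(z.1, z.2, 0, a.idx), Or.inl ((hH' _).2 ⟨rfl, rfl, hz⟩), rfl⟩
      · exact ⟨(z.1, z.2, 1, a'.idx), Or.inr ((hV' _).2 ⟨rfl, rfl, hz⟩), rfl⟩
  -- The cell count ties the two lengths together, so that the width need not be part of the code.
  have hn : n = w + h - 1 := by
    rw [← hcard, hX']
    exact card_cross (by omega) (by omega) hlM hmN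
  clear hab3 hab3' hX hp hq hH hV hx' hy' hw hh hl hm hbM hbN
  obtain ⟨c, hc⟩ : ∃ c : Code, c = ⟨h, x₀.val, y₀.val, if x₀.val = l then 0 else 1,
    if y₀.val = m then 0 else 1⟩ := ⟨_, rfl⟩
  have hch : c.h = h := by rw [hc]
  have hcx : c.x = x₀.val := by rw [hc]
  have hcy : c.y = y₀.val := by rw [hc]
  have hwd : c.wd n = w := by simp only [Code.wd, hch]; omega
  have hleft : c.left n = l := by
    simp only [Code.left, hwd, hcx]
    split_ifs with hs
    · by_contra hne
      simp [hc, hne] at hs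
    · have : x₀.val ≠ l := fun e => hs (by simp [hc, e])
      omega
  have hbot : c.bot = m := by
    simp only [Code.bot, hch, hcy]
    split_ifs with hs
    · by_contra hne
      simp [hc, hne] at hs
    · have : y₀.val ≠ m := fun e => hs (by simp [hc, e])
      omega
  have hsx : c.sx = if x₀.val = l then 0 else 1 := by rw [hc]
  have hsy : c.sy = if y₀.val = m then 0 else 1 := by rw [hc]
  have hv : c.Valid M N n := by
    refine ⟨by omega, by omega, by rw [hcx]; exact x₀.isLt, by rw [hcy]; exact y₀.isLt, ?_, ?_,
      fun h => ?_, fun h => ?_, by rw [hleft, hwd]; exact hlM, by rw [hbot, hch]; exact hmN⟩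
    · rw [hsx, hwd]; split_ifs <;> omega
    · rw [hsy, hch]; split_ifs <;> omega
    · have : x₀.val ≠ l := fun e => h (by rw [hsx, if_pos e])
      rw [hwd, hcx]; omega
    · have : y₀.val ≠ m := fun e => h (by rw [hsy, if_pos e])
      rw [hch, hcy]; omega
  have hir : ∀ t, c.InRow n t ↔ l ≤ t ∧ t < l + w := fun t => by rw [Code.InRow, hleft, hwd]
  have hic : ∀ t, c.InCol t ↔ m ≤ t ∧ t < m + h := fun t => by rw [Code.InCol, hbot, hch]
  refine ⟨c, hv, ?_, a.idx.val, a'.idx.val, a.idx.isLt, a'.idx.isLt, ?_⟩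
  · refine Prod.ext ?_ (Prod.ext (Fin.ext ?_) (Fin.ext ?_))
    · ext z
      rw [hX']
      simp only [Code.block, Code.mem_cells, Finset.mem_filter, Finset.mem_univ, true_and, hir, hic,
        hcx, hcy]
    · rw [hv.block_fst, hcx]
    · rw [hv.block_snd, hcy]
  · ext v
    rw [Finset.mem_union, hH', hV', Code.mem_ell, hir, hic, hcx, hcy]

/-- All horizontal vertices of an ell lie in the row of its corner and all vertical ones in its
column, and both kinds occur. This makes bundles in distinct blocks disjoint. -/
theorem HasBlock.corner_unique {l : Finset (Vertex M N L)} {b b' : Block M N} (h : HasBlock l b)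
    (h' : HasBlock l b') : b = b' := by
  have hX : b.1 = b'.1 := by rw [← h.2, ← h'.2]
  obtain ⟨n, hn⟩ : ∃ n, n = b.1.card := ⟨_, rfl⟩
  obtain ⟨c, hv, rfl, k, k', hk, hk', e⟩ := h.exists_code hn.symm
  obtain ⟨c', hv', rfl, j, j', -, -, e'⟩ := h'.exists_code (hX ▸ hn.symm)
  have hy : c.y = c'.y := by
    have : ((⟨c.x, hv.x_lt⟩, ⟨c.y, hv.y_lt⟩, 0, ⟨k, hk⟩) : Vertex M N L) ∈ l := by
      rw [e, Code.mem_ell]; exact Or.inl ⟨rfl, rfl, rfl, hv.inRow⟩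
    rw [e', Code.mem_ell] at this
    rcases this with h | h
    · exact h.2.2.1
    · exact absurd h.1 (by simp [Vertex.side])
  have hx : c.x = c'.x := by
    have : ((⟨c.x, hv.x_lt⟩, ⟨c.y, hv.y_lt⟩, 1, ⟨k', hk'⟩) : Vertex M N L) ∈ l := by
      rw [e, Code.mem_ell]; exact Or.inr ⟨rfl, rfl, rfl, hv.inCol⟩
    rw [e', Code.mem_ell] at this
    rcases this with h | h
    · exact absurd h.1 (by simp [Vertex.side])
    · exact h.2.2.1
  exact Prod.ext hX (Prod.ext (Fin.ext (by rw [hv.block_fst, hv'.block_fst, hx]))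
    (Fin.ext (by rw [hv.block_snd, hv'.block_snd, hy])))

theorem HasBlock.eq_ell {l : Finset (Vertex M N L)} (hv : c.Valid M N n)
    (hl : HasBlock l (c.block M N n)) : ∃ k k', k < L ∧ k' < L ∧ l = c.ell M N L n k k' := by
  obtain ⟨c', hv', e, h⟩ := hl.exists_code hv.card_cells
  rwa [hv'.block_injective hv e] at h

theorem Code.Valid.mem_horizontal (hv : c.Valid M N n) {z : Cell M N} :
    z ∈ (c.block M N n).horizontal ↔ z.2.val = c.y ∧ c.InRow n z.1.val ∧ z.1.val ≠ c.x := by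
  have e : z = (c.block M N n).2 ↔ z.1.val = c.x ∧ z.2.val = c.y := by
    rw [Prod.ext_iff, Fin.ext_iff, Fin.ext_iff, hv.block_fst, hv.block_snd]
  have e' : z.2 = (c.block M N n).2.2 ↔ z.2.val = c.y := by
    rw [Fin.ext_iff, hv.block_snd]
  rw [Block.horizontal, Finset.mem_erase, Finset.mem_filter, e', ne_eq, e]
  constructor
  · rintro ⟨h1, h2, h3⟩
    exact ⟨h3, (hv.row_cell h3).1 h2, fun h => h1 ⟨h, h3⟩⟩
  · rintro ⟨h1, h2, h3⟩
    exact ⟨fun h => h3 h.1, (hv.row_cell h1).2 h2, h1⟩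

theorem Code.Valid.mem_vertical (hv : c.Valid M N n) {z : Cell M N} :
    z ∈ (c.block M N n).vertical ↔ z.1.val = c.x ∧ c.InCol z.2.val ∧ z.2.val ≠ c.y := by
  have e : z = (c.block M N n).2 ↔ z.1.val = c.x ∧ z.2.val = c.y := by
    rw [Prod.ext_iff, Fin.ext_iff, Fin.ext_iff, hv.block_fst, hv.block_snd]
  have e' : z.1 = (c.block M N n).2.1 ↔ z.1.val = c.x := by
    rw [Fin.ext_iff, hv.block_fst]
  rw [Block.vertical, Finset.mem_erase, Finset.mem_filter, e', ne_eq, e]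
  constructor
  · rintro ⟨h1, h2, h3⟩
    exact ⟨h3, (hv.col_cell h3).1 h2, fun h => h1 ⟨h3, h⟩⟩
  · rintro ⟨h1, h2, h3⟩
    exact ⟨fun h => h3 h.2, (hv.col_cell h1).2 h2, h1⟩

theorem dominates_of_mem (hv : c.Valid M N n) (hv' : c'.Valid M N n) {z : Cell M N}
    (h : z ∈ (c.block M N n).horizontal) (h' : z ∈ (c'.block M N n).vertical) :
    Dominates n c c' := by
  rw [hv.mem_horizontal] at h
  rw [hv'.mem_vertical] at h'
  obtain ⟨h1, h2, h3⟩ := h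
  obtain ⟨h4, h5, h6⟩ := h'
  exact ⟨h4 ▸ h2, h4 ▸ h3, h1 ▸ h5, h1 ▸ h6⟩

theorem Crosses.inter (hv : c.Valid M N n) (hv' : c'.Valid M N n) (h : Crosses n c c') :
    ∃ z, (c.block M N n).1 ∩ (c'.block M N n).1 = {z} ∧ z ∈ (c.block M N n).horizontal ∧
      z ∈ (c'.block M N n).vertical := by
  refine ⟨(⟨c'.x, hv'.x_lt⟩, ⟨c.y, hv.y_lt⟩), ?_, hv.mem_horizontal.2 ⟨rfl, h.inRow, h.x_ne⟩,
    hv'.mem_vertical.2 ⟨rfl, h.inCol, h.y_ne⟩⟩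
  ext z
  simp only [Code.block, Finset.mem_inter, Code.mem_cells, Finset.mem_singleton, Prod.ext_iff,
    Fin.ext_iff]
  constructor
  · rintro ⟨⟨h1, h2⟩ | ⟨h1, h2⟩, ⟨h3, h4⟩ | ⟨h3, h4⟩⟩
    · exact absurd (h1.symm.trans h3) h.y_ne
    · exact ⟨h3, h1⟩
    · exact absurd (h1 ▸ h4) h.not_inRow
    · exact absurd (h3.symm.trans h1) h.x_ne
  · rintro ⟨h1, h2⟩
    exact ⟨Or.inl ⟨h2, h1 ▸ h.inRow⟩, Or.inr ⟨h1, h2 ▸ h.inCol⟩⟩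

/-! ### Block clique embeddings are chains -/

/-- The ell blocks of a chain form a block clique embedding. -/
theorem Chain.isBlockCliqueEmbedding {x y : ℕ} {l : List Code} (hL : 1 ≤ L)
    (H : Chain M N n n x y l) :
    (l.map (Code.block M N n)).Nodup ∧
      IsBlockCliqueEmbedding L n (l.map (Code.block M N n)).toFinset := by
  have hnd : (l.map (Code.block M N n)).Nodup :=
    H.nodup.map_on fun c hc c' hc' e => (H.valid c hc).block_injective (H.valid c' hc') e
  refine ⟨hnd, fun b hb => ?_, ?_, fun b hb => ?_, fun b hb b' hb' hne => ?_⟩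
  · simp only [List.mem_toFinset, List.mem_map] at hb
    obtain ⟨c, hc, rfl⟩ := hb
    exact ⟨_, (H.valid c hc).hasBlock_ell hL hL⟩
  · rw [List.toFinset_card_of_nodup hnd, List.length_map, H.spec.1]
  · simp only [List.mem_toFinset, List.mem_map] at hb
    obtain ⟨c, hc, rfl⟩ := hb
    exact (H.valid c hc).card_cells
  · simp only [List.mem_toFinset, List.mem_map] at hb hb'
    obtain ⟨c, hc, rfl⟩ := hb
    obtain ⟨c', hc', rfl⟩ := hb'
    have hcc : c ≠ c' := fun e => hne (e ▸ rfl)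
    have hv := H.valid c hc
    have hv' := H.valid c' hc'
    have hs : Std.Symm fun c c' => Crosses n c c' ∨ Crosses n c' c := ⟨fun _ _ => Or.symm⟩
    have hp : l.Pairwise fun c c' => Crosses n c c' ∨ Crosses n c' c :=
      H.spec.2.2.imp fun h => Or.inl h
    have := hp.forall hc hc' hcc
    rcases this with h | h
    · obtain ⟨z, h1, h2, h3⟩ := h.inter hv hv'
      exact ⟨z, h1, Or.inl ⟨h2, h3⟩⟩
    · obtain ⟨z, h1, h2, h3⟩ := h.inter hv' hv
      exact ⟨z, by rw [Finset.inter_comm, h1], Or.inr ⟨h3, h2⟩⟩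

/-- Every block clique embedding consists of the ell blocks of a chain. -/
theorem IsBlockCliqueEmbedding.exists_chain {X : Finset (Block M N)} (hn : 1 ≤ n)
    (hX : IsBlockCliqueEmbedding L n X) :
    ∃ x y l, Chain M N n n x y l ∧ X = (l.map (Code.block M N n)).toFinset := by
  have hex : ∀ b, ∃ c : Code, b ∈ X → c.Valid M N n ∧ c.block M N n = b := by
    intro b
    by_cases hb : b ∈ X
    · obtain ⟨l, hl⟩ := hX.isEllBlock b hb
      obtain ⟨c, hv, e, -⟩ := hl.exists_code (hX.card_cells b hb)
      exact ⟨c, fun _ => ⟨hv, e⟩⟩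
    · exact ⟨⟨0, 0, 0, 0, 0⟩, fun h => absurd h hb⟩
  choose f hf using hex
  have hinj : Set.InjOn f X := by
    intro b hb b' hb' e
    rw [← (hf b hb).2, ← (hf b' hb').2, e]
  obtain ⟨x, y, l, hl, hS⟩ : ∃ x y l, Chain M N n n x y l ∧ l.toFinset = X.image f := by
    refine exists_chain_of_dominates hn
      (by rw [Finset.card_image_of_injOn hinj, hX.card_eq]) ?_ ?_ ?_
    · simp only [Finset.forall_mem_image]
      exact fun b hb => (hf b hb).1
    · simp only [Finset.forall_mem_image]
      intro b hb b' hb' hne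
      obtain ⟨z, -, h⟩ := hX.inter b hb b' hb' fun e => hne (e ▸ rfl)
      rw [← (hf b hb).2, ← (hf b' hb').2] at h
      rcases h with h | h
      · exact Or.inl (dominates_of_mem (hf b hb).1 (hf b' hb').1 h.1 h.2)
      · exact Or.inr (dominates_of_mem (hf b' hb').1 (hf b hb).1 h.2 h.1)
    · simp only [Finset.forall_mem_image]
      intro b hb b' hb' hd hd'
      have hne : b ≠ b' := fun e => hd.x_ne (e ▸ rfl)
      obtain ⟨z, hz, -⟩ := hX.inter b hb b' hb' hne
      obtain ⟨hv, e⟩ := hf b hb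
      obtain ⟨hv', e'⟩ := hf b' hb'
      -- Two blocks that dominate each other would share two cells, one in each corner column, but
      -- they share only `z`.
      have key : ∀ w : Cell M N, w ∈ (f b).cells M N n → w ∈ (f b').cells M N n → w = z := by
        intro w h1 h2
        have : w ∈ b.1 ∩ b'.1 := by
          rw [← e, ← e']; exact Finset.mem_inter.2 ⟨h1, h2⟩
        rw [hz] at this
        exact Finset.mem_singleton.1 this
      have k1 := key (⟨(f b').x, hv'.x_lt⟩, ⟨(f b).y, hv.y_lt⟩)
        (Code.mem_cells.2 (Or.inl ⟨rfl, hd.inRow⟩)) (Code.mem_cells.2 (Or.inr ⟨rfl, hd.inCol⟩))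
      have k2 := key (⟨(f b).x, hv.x_lt⟩, ⟨(f b').y, hv'.y_lt⟩)
        (Code.mem_cells.2 (Or.inr ⟨rfl, hd'.inCol⟩)) (Code.mem_cells.2 (Or.inl ⟨rfl, hd'.inRow⟩))
      rw [← k2] at k1
      simp only [Prod.ext_iff, Fin.ext_iff] at k1
      exact hd.x_ne k1.1
  refine ⟨x, y, l, hl, ?_⟩
  ext b
  simp only [List.mem_toFinset, List.mem_map]
  constructor
  · intro hb
    refine ⟨f b, ?_, (hf b hb).2⟩
    rw [← List.mem_toFinset, hS]
    exact Finset.mem_image_of_mem f hb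
  · rintro ⟨c, hc, rfl⟩
    rw [← List.mem_toFinset, hS] at hc
    obtain ⟨b, hb, rfl⟩ := Finset.mem_image.1 hc
    rwa [(hf b hb).2]

end

end NativeClique

namespace NativeClique

/-! ### Maximum bundles -/

section

variable {M N L n : ℕ} {c c' : Code} {G : (chimera M N L).Subgraph}

theorem input_inG_ne_zero (m : ℕ) (j : List ℕ) :
    (input G m).arr Arr.inG j ≠ 0 ↔ ∃ v ∈ G.verts, v.coords = j := by
  by_cases h : ∃ v ∈ G.verts, v.coords = j
  · simp only [input, if_pos (And.intro (Eq.refl Arr.inG) h)]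
    exact ⟨fun _ => h, fun _ => one_ne_zero⟩
  · simp only [input, if_neg (fun h' : Arr.inG = Arr.inG ∧ _ => h h'.2)]
    exact ⟨fun h' => absurd rfl h', fun h' => absurd h' h⟩

theorem mem_hIndices {g : List ℕ → ℕ} {k : ℕ} : k ∈ hIndices g L n c ↔
    k < L ∧ ∀ t < c.wd n, g [c.left n + t, c.y, 0, k] ≠ 0 := by
  simp [hIndices]

theorem mem_vIndices {g : List ℕ → ℕ} {k : ℕ} : k ∈ vIndices g L c ↔
    k < L ∧ ∀ t < c.h, g [c.x, c.bot + t, 1, k] ≠ 0 := by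
  simp [vIndices]

theorem hIndices_nodup (g : List ℕ → ℕ) : (hIndices g L n c).Nodup :=
  List.nodup_range.filter _

theorem vIndices_nodup (g : List ℕ → ℕ) : (vIndices g L c).Nodup :=
  List.nodup_range.filter _

theorem Code.Valid.ell_subset_iff (hv : c.Valid M N n) (m : ℕ) {k k' : ℕ} (hk : k < L)
    (hk' : k' < L) : (∀ v ∈ c.ell M N L n k k', v ∈ G.verts) ↔
      k ∈ hIndices ((input G m).arr Arr.inG) L n c ∧
        k' ∈ vIndices ((input G m).arr Arr.inG) L c := by
  simp only [mem_hIndices, mem_vIndices, input_inG_ne_zero, hk, hk', true_and]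
  constructor
  · intro h
    refine ⟨fun t ht => ?_, fun t ht => ?_⟩
    · have hr : c.InRow n (c.left n + t) := ⟨by omega, by omega⟩
      exact ⟨(⟨_, hv.inRow_lt hr⟩, ⟨c.y, hv.y_lt⟩, 0, ⟨k, hk⟩),
        h _ (Code.mem_ell.2 (Or.inl ⟨rfl, rfl, rfl, hr⟩)), rfl⟩
    · have hr : c.InCol (c.bot + t) := ⟨by omega, by omega⟩
      exact ⟨(⟨c.x, hv.x_lt⟩, ⟨_, hv.inCol_lt hr⟩, 1, ⟨k', hk'⟩),
        h _ (Code.mem_ell.2 (Or.inr ⟨rfl, rfl, rfl, hr⟩)), rfl⟩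
  · rintro ⟨h1, h2⟩ v hvm
    rw [Code.mem_ell] at hvm
    rcases hvm with ⟨e1, e2, e3, e4⟩ | ⟨e1, e2, e3, e4⟩
    · obtain ⟨u, hu, e⟩ := h1 (v.cell.1.val - c.left n) (by have := e4.1; have := e4.2; omega)
      have : u = v := Vertex.coords_injective (e.trans (by
        have := e4.1
        simp only [Vertex.coords, e1, e2, e3, List.cons.injEq, and_true, Fin.val_zero]
        omega))
      exact this ▸ hu
    · obtain ⟨u, hu, e⟩ := h2 (v.cell.2.val - c.bot) (by have := e4.1; have := e4.2; omega)
      have : u = v := Vertex.coords_injective (e.trans (by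
        have := e4.1
        simp only [Vertex.coords, e1, e2, e3, List.cons.injEq, and_true, true_and, Fin.val_one]
        omega))
      exact this ▸ hu

theorem Code.Valid.row_vertex_mem (hv : c.Valid M N n) {k : ℕ} (hk : k < L) (j j' : ℕ) :
    ((⟨c.x, hv.x_lt⟩, ⟨c.y, hv.y_lt⟩, 0, ⟨k, hk⟩) : Vertex M N L) ∈ c.ell M N L n j j' ↔ k = j := by
  rw [Code.mem_ell]
  constructor
  · rintro (h | h)
    · exact h.2.1
    · exact absurd h.1 (by simp [Vertex.side])
  · exact fun h => Or.inl ⟨rfl, h, rfl, hv.inRow⟩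

theorem Code.disjoint_ell {k k' j j' : ℕ} (h : k ≠ j) (h' : k' ≠ j') :
    Disjoint (c.ell M N L n k k') (c.ell M N L n j j') := by
  rw [Finset.disjoint_left]
  intro v h1 h2
  rw [Code.mem_ell] at h1 h2
  rcases h1 with h1 | h1 <;> rcases h2 with h2 | h2
  · exact h (h1.2.1.symm.trans h2.2.1)
  · exact absurd (h1.1.symm.trans h2.1) (by decide)
  · exact absurd (h1.1.symm.trans h2.1) (by decide)
  · exact h' (h1.2.1.symm.trans h2.2.1)

theorem List.getD_mem_of_lt {l : List ℕ} {p : ℕ} (hp : p < l.length) : l.getD p 0 ∈ l := by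
  rw [List.getD_eq_getElem _ _ hp]; exact List.getElem_mem hp

theorem List.Nodup.getD_inj {l : List ℕ} (hl : l.Nodup) {p q : ℕ} (hp : p < l.length)
    (hq : q < l.length) (h : l.getD p 0 = l.getD q 0) : p = q := by
  rw [List.getD_eq_getElem _ _ hp, List.getD_eq_getElem _ _ hq] at h
  exact (hl.getElem_inj_iff).1 h

/-- A maximum bundle in the block `c`. -/
def Code.bundle (M N L n : ℕ) (g : List ℕ → ℕ) (c : Code) : Finset (Finset (Vertex M N L)) :=
  (Finset.range (weight g L n c)).image fun p =>
    c.ell M N L n ((hIndices g L n c).getD p 0) ((vIndices g L c).getD p 0)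

theorem weight_le_horizontal {g : List ℕ → ℕ} {p : ℕ} (hp : p < weight g L n c) :
    p < (hIndices g L n c).length := lt_of_lt_of_le hp (min_le_left _ _)

theorem weight_le_vertical {g : List ℕ → ℕ} {p : ℕ} (hp : p < weight g L n c) :
    p < (vIndices g L c).length := lt_of_lt_of_le hp (min_le_right _ _)

theorem Code.Valid.card_bundle (hv : c.Valid M N n) (g : List ℕ → ℕ) :
    (c.bundle M N L n g).card = weight g L n c := by
  rw [Code.bundle, Finset.card_image_of_injOn, Finset.card_range]
  intro p hp q hq e
  simp only [Finset.coe_range, Set.mem_Iio] at hp hq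
  have hk := (mem_hIndices.1 (List.getD_mem_of_lt (weight_le_horizontal hp))).1
  have h1 := (hv.row_vertex_mem hk _ ((vIndices g L c).getD p 0)).2 rfl
  simp only at e
  rw [e, hv.row_vertex_mem hk] at h1
  exact List.Nodup.getD_inj (hIndices_nodup g) (weight_le_horizontal hp) (weight_le_horizontal hq) h1

theorem Code.Valid.image_bundle (hv : c.Valid M N n) (g : List ℕ → ℕ) :
    ((c.bundle M N L n g).image fun l => l.image Vertex.coords) =
      (Finset.range (weight g L n c)).image fun p =>
        (Finset.range (n + 1)).image fun q => vertexAt g L n c p q := by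
  rw [Code.bundle, Finset.image_image]
  refine Finset.image_congr fun p hp => ?_
  simp only [Finset.coe_range, Set.mem_Iio] at hp
  have hk := (mem_hIndices.1 (List.getD_mem_of_lt (weight_le_horizontal hp))).1
  have hk' := (mem_vIndices.1 (List.getD_mem_of_lt (weight_le_vertical hp))).1
  have hwn : c.wd n + c.h = n + 1 := by have := hv.le; simp only [Code.wd]; omega
  ext j
  simp only [Function.comp, Finset.mem_image, Code.mem_ell, Finset.mem_range]
  constructor
  · rintro ⟨v, ⟨e1, e2, e3, e4, e5⟩ | ⟨e1, e2, e3, e4, e5⟩, rfl⟩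
    · refine ⟨v.cell.1.val - c.left n, by omega, ?_⟩
      rw [vertexAt, if_pos (by omega)]
      simp only [Vertex.coords, e1, e2, e3, List.cons.injEq, and_true, Fin.val_zero]
      omega
    · refine ⟨c.wd n + (v.cell.2.val - c.bot), by omega, ?_⟩
      rw [vertexAt, if_neg (by omega)]
      simp only [Vertex.coords, e1, e2, e3, List.cons.injEq, and_true, true_and, Fin.val_one]
      omega
  · rintro ⟨q, hq, rfl⟩
    unfold vertexAt
    split
    · have hr : c.InRow n (c.left n + q) := ⟨by omega, by omega⟩
      exact ⟨(⟨_, hv.inRow_lt hr⟩, ⟨c.y, hv.y_lt⟩, 0, ⟨_, hk⟩), Or.inl ⟨rfl, rfl, rfl, hr⟩, rfl⟩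
    · have hr : c.InCol (c.bot + (q - c.wd n)) := ⟨by omega, by omega⟩
      exact ⟨(⟨c.x, hv.x_lt⟩, ⟨_, hv.inCol_lt hr⟩, 1, ⟨_, hk'⟩), Or.inr ⟨rfl, rfl, rfl, hr⟩, rfl⟩

variable [NeZero M] [NeZero N]

theorem Code.Valid.isBundleIn (hv : c.Valid M N n) (m : ℕ) :
    IsBundleIn G (c.block M N n) (c.bundle M N L n ((input G m).arr Arr.inG)) := by
  have hmem : ∀ p < weight ((input G m).arr Arr.inG) L n c, _ ∧ _ := fun p hp =>
    And.intro (List.getD_mem_of_lt (weight_le_horizontal hp))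
      (List.getD_mem_of_lt (weight_le_vertical hp))
  have hlt := fun p hp => And.intro (mem_hIndices.1 (hmem p hp).1).1
    (mem_vIndices.1 (hmem p hp).2).1
  refine ⟨?_, ?_, ?_⟩
  · simp only [Code.bundle, Finset.forall_mem_image, Finset.mem_range]
    exact fun p hp => hv.hasBlock_ell (hlt p hp).1 (hlt p hp).2
  · simp only [Code.bundle, Finset.forall_mem_image, Finset.mem_range]
    exact fun p hp => (hv.ell_subset_iff m (hlt p hp).1 (hlt p hp).2).2 (hmem p hp)
  · simp only [Code.bundle, Finset.forall_mem_image, Finset.mem_range]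
    intro p hp q hq hne
    have hpq : p ≠ q := fun e => hne (e ▸ rfl)
    exact Code.disjoint_ell
      (fun e => hpq (List.Nodup.getD_inj (hIndices_nodup _) (weight_le_horizontal hp)
        (weight_le_horizontal hq) e))
      (fun e => hpq (List.Nodup.getD_inj (vIndices_nodup _) (weight_le_vertical hp)
        (weight_le_vertical hq) e))

/-- All ells of the bundle have a horizontal and a vertical vertex in the corner cell. By
disjointness, the indices of these vertices differ from ell to ell, so the ells inject into either
list of spanning wires. -/
theorem IsBundleIn.card_le (hv : c.Valid M N n) (m : ℕ) {B : Finset (Finset (Vertex M N L))}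
    (hB : IsBundleIn G (c.block M N n) B) :
    B.card ≤ weight ((input G m).arr Arr.inG) L n c := by
  have hex : ∀ l, ∃ k k', l ∈ B → k < L ∧ k' < L ∧ l = c.ell M N L n k k' := by
    intro l
    by_cases hl : l ∈ B
    · obtain ⟨k, k', h⟩ := (hB.hasBlock l hl).eq_ell hv
      exact ⟨k, k', fun _ => h⟩
    · exact ⟨0, 0, fun h => absurd h hl⟩
  choose κ κ' hκ using hex
  have hin : ∀ l ∈ B, κ l ∈ hIndices ((input G m).arr Arr.inG) L n c ∧
      κ' l ∈ vIndices ((input G m).arr Arr.inG) L c := by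
    intro l hl
    obtain ⟨h1, h2, h3⟩ := hκ l hl
    rw [← hv.ell_subset_iff m h1 h2, ← h3]
    exact hB.subset l hl
  refine le_min ?_ ?_
  · rw [← List.toFinset_card_of_nodup (hIndices_nodup _)]
    refine Finset.card_le_card_of_injOn κ (fun l hl => List.mem_toFinset.2 (hin l hl).1) ?_
    intro l hl l' hl' e
    by_contra hne
    obtain ⟨h1, -, h3⟩ := hκ l hl
    obtain ⟨-, -, h6⟩ := hκ l' hl'
    have hd := hB.disjoint l hl l' hl' hne
    rw [h3, h6, Finset.disjoint_left] at hd
    exact hd ((hv.row_vertex_mem h1 _ _).2 rfl) ((hv.row_vertex_mem h1 _ _).2 e)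
  · rw [← List.toFinset_card_of_nodup (vIndices_nodup _)]
    refine Finset.card_le_card_of_injOn κ' (fun l hl => List.mem_toFinset.2 (hin l hl).2) ?_
    intro l hl l' hl' e
    by_contra hne
    obtain ⟨-, h2, h3⟩ := hκ l hl
    obtain ⟨-, -, h6⟩ := hκ l' hl'
    have hd := hB.disjoint l hl l' hl' hne
    rw [h3, h6, Finset.disjoint_left] at hd
    refine hd (a := (⟨c.x, hv.x_lt⟩, ⟨c.y, hv.y_lt⟩, 1, ⟨κ' l, h2⟩))
      (Code.mem_ell.2 (Or.inr ⟨rfl, rfl, rfl, hv.inCol⟩))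
      (Code.mem_ell.2 (Or.inr ⟨rfl, e, rfl, hv.inCol⟩))

/-! ### The embedding returned by the algorithm -/

/-- For a competing embedding only an upper bound is needed, so the union bound is enough. -/
theorem IsNativeCliqueEmbedding.size_le (m : ℕ) (hn : 1 ≤ n)
    {𝓑 : Multiset (Finset (Finset (Vertex M N L)))} (h : IsNativeCliqueEmbedding G n 𝓑) :
    ∃ x y l, Chain M N n n x y l ∧
      size 𝓑 ≤ (l.map (weight ((input G m).arr Arr.inG) L n)).sum := by
  obtain ⟨X, hX, B, hB, rfl⟩ := h
  obtain ⟨x, y, l, hl, rfl⟩ := hX.exists_chain hn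
  refine ⟨x, y, l, hl, ?_⟩
  have hnd : (l.map (Code.block M N n)).Nodup :=
    hl.nodup.map_on fun c hc c' hc' e => (hl.valid c hc).block_injective (hl.valid c' hc') e
  have e : (((l.map (Code.block M N n)).toFinset.val.map B).toFinset.biUnion id) =
      (l.map (Code.block M N n)).toFinset.biUnion B := by
    ext u
    simp
  rw [size, e]
  refine Finset.card_biUnion_le.trans ?_
  rw [List.sum_toFinset _ hnd, List.map_map]
  refine List.sum_le_sum fun c hc => ?_
  exact (hB _ (by simpa using ⟨c, hc, rfl⟩)).card_le (hl.valid c hc) m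

theorem size_bundles (m : ℕ) {l : List Code} (hl : ∀ c ∈ l, c.Valid M N n) (hnd : l.Nodup) :
    size ((l : Multiset Code).map (Code.bundle M N L n ((input G m).arr Arr.inG))) =
      (l.map (weight ((input G m).arr Arr.inG) L n)).sum := by
  set g := (input G m).arr Arr.inG with hg
  have e : ((l : Multiset Code).map (Code.bundle M N L n g)).toFinset.biUnion id =
      l.toFinset.biUnion (Code.bundle M N L n g) := by
    ext u
    simp
  rw [size, e, Finset.card_biUnion]
  · rw [List.sum_toFinset _ hnd]
    exact congrArg List.sum (List.map_congr_left fun c hc => (hl c hc).card_bundle g)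
  · intro c hc c' hc' hne
    simp only [List.coe_toFinset, Set.mem_ofPred_eq] at hc hc'
    rw [Function.onFun, Finset.disjoint_left]
    intro u hu hu'
    -- A common ell would have both blocks as its block.
    exact hne ((hl c hc).block_injective (hl c' hc')
      ((((hl c hc).isBundleIn m).hasBlock u hu).corner_unique
        (((hl c' hc').isBundleIn m).hasBlock u hu')))

/-- `l` is the list found by the algorithm and `q` the part of the chain that it lacks, whose blocks
get empty bundles. As codes are determined by their blocks, the bundle chosen for the block of a
code in `l` is the bundle of that very code. -/
theorem Chain.isNativeCliqueEmbedding (m : ℕ) {x y : ℕ} {q l : List Code} (hL : 1 ≤ L)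
    (H : Chain M N n n x y (q ++ l)) :
    IsNativeCliqueEmbedding G n
      ((l : Multiset Code).map (Code.bundle M N L n ((input G m).arr Arr.inG)) +
        Multiset.replicate (n - l.length) ∅) := by
  classical
  obtain ⟨hnd, hX⟩ := H.isBlockCliqueEmbedding hL
  set g := (input G m).arr Arr.inG with hg
  refine ⟨_, hX, fun b => if h : ∃ c ∈ l, c.block M N n = b then h.choose.bundle M N L n g else ∅,
    fun b hb => ?_, ?_⟩
  · dsimp only
    split
    · rename_i h
      obtain ⟨h1, h2⟩ := h.choose_spec
      have := (H.valid h.choose (List.mem_append_right q h1)).isBundleIn (G := G) m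
      rwa [h2] at this
    · exact ⟨by simp, by simp, by simp⟩
  · rw [List.toFinset_val, hnd.dedup]
    simp only [Multiset.map_coe, List.map_map, List.map_append]
    have h1 : ∀ c ∈ l, ((fun b => if h : ∃ c ∈ l, c.block M N n = b then
        h.choose.bundle M N L n g else ∅) ∘ Code.block M N n) c = c.bundle M N L n g := by
      intro c hc
      have h : ∃ c' ∈ l, c'.block M N n = c.block M N n := ⟨c, hc, rfl⟩
      simp only [Function.comp, dif_pos h]
      obtain ⟨h1, h2⟩ := h.choose_spec
      rw [(H.valid _ (List.mem_append_right q h1)).block_injective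
        (H.valid c (List.mem_append_right q hc)) h2]
    have h2 : ∀ c ∈ q, ((fun b => if h : ∃ c ∈ l, c.block M N n = b then
        h.choose.bundle M N L n g else ∅) ∘ Code.block M N n) c = ∅ := by
      intro c hc
      have h : ¬ ∃ c' ∈ l, c'.block M N n = c.block M N n := by
        rintro ⟨c', hc', e⟩
        have := (H.valid c' (List.mem_append_right q hc')).block_injective
          (H.valid c (List.mem_append_left l hc)) e
        subst this
        exact (List.nodup_append.1 H.nodup).2.2 c' hc c' hc' rfl
      simp only [Function.comp, dif_neg h]
    have hlen := H.spec.1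
    rw [List.length_append] at hlen
    rw [List.map_congr_left h1, List.map_congr_left h2, ← Multiset.coe_add, add_comm]
    rw [List.map_const', ← Multiset.coe_replicate, show n - l.length = q.length by omega]

end

theorem output_eq {M N L n : ℕ} {s s' : State} {g : List ℕ → ℕ}
    (hv : ∀ c ∈ bestList s, c.Valid M N n) (hlen : s'.var Var.bestLen = s.var Var.bestLen)
    (hw : ∀ t < s.var Var.bestLen, Written g L n (readBlock s Arr.best [] t) t s') :
    output n s' = toCoords ((bestList s : Multiset Code).map (Code.bundle M N L n g)) := by
  rw [output, toCoords, Multiset.map_map, bestList, readBlocks, ← Multiset.map_coe,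
    Multiset.map_map, hlen]
  refine Multiset.map_congr rfl fun t ht => ?_
  rw [Multiset.mem_coe, List.mem_range] at ht
  obtain ⟨h1, h2⟩ := hw t ht
  have hvt := hv _ (List.mem_map.2 ⟨t, List.mem_range.2 ht, rfl⟩)
  simp only [Function.comp]
  rw [hvt.image_bundle, h1]
  refine Finset.image_congr fun p hp => Finset.image_congr fun q hq => ?_
  simp only [Finset.coe_range, Set.mem_Iio] at hp hq
  exact h2 p hp q hq

/-! ### The whole algorithm -/

theorem time_bound {M N L n : ℕ} (hM : 1 ≤ M) (hN : 1 ≤ N) (hL : 1 ≤ L) (hn : 1 ≤ n) :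
    (1 + n * (1 + (3 + M * N * (200 + 4 * (16 + 40 * L + 12 * L * (n + 1)))))) + (2 +
      ((1 + n * (1 + (3 + ((10 + (1 + (M + 1) * (1 + (1 + (N + 1) * (1 + 4))))) +
        M * N * (200 + 4 * (300 + 200 * n)))))) + (2 + (2 +
        (M * N * (200 + 4 * (300 + 200 * n)) +
          (1 + n * (1 + (100 + L * (21 + 30 * (n + 1)))))))))) ≤ 10000 * (n ^ 2 * M * N * L) := by
  -- Written in `M - 1`, `N - 1`, `L - 1`, `n - 1`, both sides are polynomials with natural
  -- coefficients, and `omega` compares them with the monomials as atoms. The constant `10000` is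
  -- generous.
  obtain ⟨M, rfl⟩ := Nat.exists_eq_add_of_le' hM
  obtain ⟨N, rfl⟩ := Nat.exists_eq_add_of_le' hN
  obtain ⟨L, rfl⟩ := Nat.exists_eq_add_of_le' hL
  obtain ⟨n, rfl⟩ := Nat.exists_eq_add_of_le' hn
  ring_nf
  omega

theorem nativeCliqueEmbed_spec {M N L n : ℕ} (hL : 1 ≤ L) (hn : 1 ≤ n) (hnM : n ≤ M) (hnN : n ≤ N)
    (G : (chimera M N L).Subgraph) :
    Ends nativeCliqueEmbed (input G n) (10000 * (n ^ 2 * M * N * L)) fun s =>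
      ∃ l : List Code,
        (∃ x y q, Chain M N n n x y (q ++ l)) ∧
        (∀ x y q, Chain M N n n x y q →
          (q.map (weight ((input G n).arr Arr.inG) L n)).sum ≤
            (l.map (weight ((input G n).arr Arr.inG) L n)).sum) ∧
        output n s =
          toCoords ((l : Multiset Code).map (Code.bundle M N L n ((input G n).arr Arr.inG))) := by
  set g := (input G n).arr Arr.inG with hg
  have hM : 1 ≤ M := hn.trans hnM
  have hN : 1 ≤ N := hn.trans hnN
  have hp : Params M N L n (input G n) := ⟨rfl, rfl, rfl, rfl⟩
  have hmpe : ∀ j, (input G n).arr Arr.mpeLen j = 0 := fun j => by simp [input]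
  refine Ends.le ?_ (time_bound hM hN hL hn)
  have A₁ := preprocess_spec hM hN hp hg.symm
  have A₂ := fun s h₁ h₂ h₃ h₄ => mainLoop_spec (W := weight g L n) (s := s) (L := L) hM hN hnM
    h₁ h₂ h₃ h₄
  have A₃ := fun s h₁ h₂ h₃ h₄ h₅ h₆ => relaxFinal_phase (W := weight g L n) (s := s) (L := L) hM hN
    h₁ h₂ hn hnM hnN h₃ h₄ h₅ h₆
  have A₄ := fun s h₁ h₂ h₃ => writeOutput_spec (M := M) (N := N) (L := L) (n := n) (g := g)
    (s := s) h₁ h₂ h₃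
  generalize 1 + n * (1 + (3 + M * N * (200 + 4 * (16 + 40 * L + 12 * L * (n + 1))))) = T₁ at *
  generalize M * N * (200 + 4 * (300 + 200 * n)) = T₃ at *
  generalize 1 + (3 + ((10 + (1 + (M + 1) * (1 + (1 + (N + 1) * (1 + 4))))) + T₃)) = T₂ at *
  generalize 100 + L * (21 + 30 * (n + 1)) = T₄ at *
  have hT : 1 + (n - 1) * T₂ ≤ 1 + n * T₂ :=
    Nat.add_le_add_left (Nat.mul_le_mul_right _ (Nat.sub_le _ _)) 1
  refine Ends.seq A₁ fun s₁ h₁ f₁ => ?_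
  have hp₁ : Params M N L n s₁ := hp.of_frame f₁
  refine Ends.seq (R₁ := fun s' => s'.var Var.tmp = n - 1)
    (Ends.assign (by simp [Rhs.eval, Opd.eval, hp₁.rn])) fun s₂ h₂ f₂ => ?_
  have hp₂ : Params M N L n s₂ := hp₁.of_frame f₂
  have hb₂ : ∀ c : Code, c.Valid M N n → HasBundle g L n c s₂ := fun c hc =>
    (h₁ c hc).congr (f₂.arr _ rfl) (f₂.arr _ rfl) (f₂.arr _ rfl)
  refine Ends.seq ((A₂ s₂ hp₂ h₂ (fun c hc => (hb₂ c hc).size)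
    fun j => by rw [f₂.arr _ rfl, f₁.arr _ rfl, hmpe]).le hT) ?_
  rintro s₃ ⟨h₃, h₃'⟩ f₃
  have hp₃ : Params M N L n s₃ := hp₂.of_frame f₃
  have hb₃ : ∀ c : Code, c.Valid M N n → HasBundle g L n c s₃ := fun c hc =>
    (hb₂ c hc).congr (f₃.arr _ rfl) (f₃.arr _ rfl) (f₃.arr _ rfl)
  refine Ends.seq_assign (Ends.seq_assign ?_)
  generalize hs₄ : State.set _ Var.i _ = s₄
  have hp₄ : Params M N L n s₄ := by subst hs₄; exact hp₃.set.set
  have hb₄ : ∀ c : Code, c.Valid M N n → HasBundle g L n c s₄ := fun c hc => by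
    subst hs₄; exact (hb₃ c hc).congr rfl rfl rfl
  have htab : table s₄ = table s₃ := table_congr (by subst hs₄; rfl)
  refine Ends.seq (A₃ s₄ hp₄ (by subst hs₄; simp [Rhs.eval, Opd.eval, hp₃.rn])
    (fun c hc => (hb₄ c hc).size) (by simpa only [Partial, htab] using h₃)
    (by simpa only [Optimal, htab] using h₃') (by subst hs₄; simp [Rhs.eval, Opd.eval])) ?_
  rintro s₅ ⟨⟨x, y, q, h₅⟩, h₅'⟩ f₅
  have hp₅ : Params M N L n s₅ := hp₄.of_frame f₅
  have hv₅ : ∀ c ∈ bestList s₅, c.Valid M N n := fun c hc =>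
    h₅.valid c (List.mem_append_right q hc)
  refine (A₄ s₅ hp₅ hv₅ fun c hc => (hb₄ c hc).congr (f₅.arr _ rfl) (f₅.arr _ rfl)
    (f₅.arr _ rfl)).mono ?_ fun s₆ h₆ f₆ => ⟨bestList s₅, ⟨x, y, q, h₅⟩, h₅',
      output_eq hv₅ (f₆.var _ rfl) h₆⟩
  -- At most `n` bundles are written, because `best` is a final segment of a chain of length `n`.
  refine Nat.add_le_add_left (Nat.mul_le_mul_right _ ?_) 1
  have := h₅.spec.1
  rw [List.length_append, bestList, length_readBlocks] at this
  omega

end NativeClique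
theorem theorem2 :
    ∃ C : ℕ, ∀ (M N L n : ℕ), 1 ≤ L → 1 ≤ n → n ≤ M → n ≤ N →
      ∀ G : (NativeClique.chimera M N L).Subgraph, G.IsInduced →
        (∃ 𝓑 : Multiset (Finset (Finset (NativeClique.Vertex M N L))),
          NativeClique.output n
              (NativeClique.nativeCliqueEmbed.exec (NativeClique.input G n)) =
            NativeClique.toCoords 𝓑 ∧
          𝓑.card ≤ n ∧
          NativeClique.IsNativeCliqueEmbedding G n (𝓑 + Multiset.replicate (n - 𝓑.card) ∅) ∧
          ∀ 𝓑' : Multiset (Finset (Finset (NativeClique.Vertex M N L))),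
            NativeClique.IsNativeCliqueEmbedding G n 𝓑' →
              NativeClique.size 𝓑' ≤ NativeClique.size 𝓑) ∧
        NativeClique.nativeCliqueEmbed.time (NativeClique.input G n) ≤
          C * (n ^ 2 * M * N * L) := by
  refine ⟨10000, fun M N L n hL hn hnM hnN G _ => ?_⟩
  have : NeZero M := ⟨by omega⟩
  have : NeZero N := ⟨by omega⟩
  obtain ⟨⟨l, ⟨x, y, q, hl⟩, hmax, hout⟩, htime⟩ :=
    NativeClique.nativeCliqueEmbed_spec hL hn hnM hnN G
  refine ⟨⟨_, hout, ?_, ?_, fun 𝓑' h' => ?_⟩, htime⟩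
  · have := hl.spec.1
    rw [List.length_append] at this
    simp only [Multiset.card_map, Multiset.coe_card]
    omega
  · simpa using hl.isNativeCliqueEmbedding n hL
  · obtain ⟨x', y', l', hl', hle⟩ := h'.size_le n hn
    rw [NativeClique.size_bundles n (fun c hc => hl.valid c (List.mem_append_right q hc))
      (List.nodup_append.1 hl.nodup).2.1]
    exact hle.trans (hmax x' y' l' hl')
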